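/- **Setting.** Let $K\ge J\ge 2$, $M\ge 1$, $T\ge K$. For $i\in[K]$ let $\phi_i:\mathbb{R}^d\to\mathbb{R}^{d_i}$, $U_i>0$, and $\mathcal{F}_i=\{x\mapsto\langle w,\phi_i(x)\rangle: w\in\mathbb{R}^{d_i},\ \|w\|_2\le U_i\}$. Each client $j\in[M]$ receives a fixed (oblivious) sequence of examples $(x^{(j)}_t,y^{(j)}_t)_{t\in[T]}$. The loss $\ell(v,y)$ is convex in $v\in\mathbb R$, with derivative (or, where it is not differentiable, a fixed choice of subgradient) $\ell'(v,y)$. **Algorithm NCO-OMS.** Put $g=\frac{K-J}{J-1}$. Every client $j$ keeps a distribution $p^{(j)}_t$ on $[K]$ and vectors $w^{(j)}_{t,i}$, $i\in[K]$. In round $t$, independently of the other clients given the past, it draws in order $A_{t,1}\sim p^{(j)}_t$ and $A_{t,a}\sim\mathrm{Uni}([K]\setminus\{A_{t,1},\dots,A_{t,a-1}\})$ for $2\le a\le J$, sets $O^{(j)}_t=\{A_{t,1},\dots,A_{t,J}\}$, and predicts with $f^{(j)}_t=\langle w^{(j)}_{t,A_{t,1}},\phi_{A_{t,1}}(\cdot)\rangle$.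 With $c^{(j)}_{t,i}=\ell(\langle w^{(j)}_{t,i},\phi_i(x^{(j)}_t)\rangle,y^{(j)}_t)$ and $\nabla^{(j)}_{t,i}=\ell'(\langle w^{(j)}_{t,i},\phi_i(x^{(j)}_t)\rangle,y^{(j)}_t)\,\phi_i(x^{(j)}_t)$, it forms $$\tilde c^{(j)}_{t,i}=\frac{c^{(j)}_{t,i}\,\mathbb{I}_{i\in O^{(j)}_t}}{\mathbb{P}[i\in O^{(j)}_t]},\qquad \tilde\nabla^{(j)}_{t,i}=\frac{\nabla^{(j)}_{t,i}\,\mathbb{I}_{i\in O^{(j)}_t}}{\mathbb{P}[i\in O^{(j)}_t]}$$ (the probability being conditional on the past) and performs online mirror descent steps: $\nabla\psi(\bar p)=\nabla\psi(p^{(j)}_t)-\tilde c^{(j)}_t$, $p^{(j)}_{t+1}=\arg\min_{p\in\Delta_K}\mathcal{D}_\psi(p,\bar p)$ with $\psi(p)=\sum_i\frac{C_i}{\eta}p_i\ln p_i$, and $\nabla\psi_{t,i}(\bar w)=\nabla\psi_{t,i}(w^{(j)}_{t,i})-\tilde\nabla^{(j)}_{t,i}$, $w^{(j)}_{t+1,i}=\arg\min_{\|w\|_2\le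 U_i}\mathcal{D}_{\psi_{t,i}}(w,\bar w)$ with $\psi_{t,i}(w)=\frac{1}{2\lambda_{t,i}}\|w\|_2^2$, where $\mathcal{D}$ is the Bregman divergence. Here $C_i,G_i>0$ are constants such that $0\le c^{(j)}_{t,i}\le C_i$ and $\|\nabla^{(j)}_{t,i}\|_2\le G_i$ for all $t,j$ throughout the run. The parameters, the same for all clients, are $w^{(j)}_{1,i}=0$, $$\eta=\frac{\sqrt{\ln(KT)}}{2\sqrt{(1+g)T}}\wedge\frac{J-1}{2(K-J)},\qquad \lambda_{t,i}=\frac{U_i}{2G_i\sqrt{(1+g)(g^2\vee t)}}$$ (the second term in $\eta$ is $+\infty$ if $J=K$), and, with $A_m=\arg\min_{i}C_i$ the set of all minimizers, $p^{(j)}_{1,i}=\frac{1-\sqrt{K/T}}{|A_m|}+\frac{1}{\sqrt{KT}}$ for $i\in A_m$ and $p^{(j)}_{1,i}=\frac1{\sqrt{KT}}$ for $i\notin A_m$. The regret is $$\mathrm{Reg}_D(\mathcal{F}_i)=\sum_{t=1}^T\sum_{j=1}^M\ell\big(f^{(j)}_t(x^{(j)}_t),y^{(j)}_t\big)-\min_{f\in\mathcal{F}_i}\sum_{t=1}^T\sum_{j=1}^M\ell\big(f(x^{(j)}_t),y^{(j)}_t\big).$$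 **Theorem (Regret bound of NCO-OMS).** Let $C=\max_i C_i$, $B_{i,1}=U_iG_i+C_i\sqrt{\ln(KT)}$, $B_{i,2}=C+U_iG_i$, $B_{i,3}=U_iG_i+\sqrt{CC_i}$. There is an absolute constant $c_1>0$, and for every $\kappa>0$ there is a constant $c_2>0$ depending only on $\kappa$, such that the following holds for all data as above and all $\delta\in(0,1)$ in the regime 1. $T\ge\kappa g^2$ and $T\ge \kappa K\,(C/C_i)^2$ for all $i\in[K]$, and 2. $g\ge\kappa$, or $\kappa\, C\ln\frac1\delta\le C_i\ln(KT)$ for all $i\in[K]$. With probability at least $1-c_1M\log_2(KT)\,\delta$, $$\forall i\in[K],\quad \mathrm{Reg}_D(\mathcal{F}_i)\le c_2\,M\left(B_{i,1}\sqrt{\Big(1+\frac{K-J}{J-1}\Big)T}+\frac{B_{i,2}(K-J)}{J-1}\ln\frac1\delta+B_{i,3}\sqrt{\frac{(K-J)T}{J-1}\ln\frac1\delta}\right).$$ (For fixed $K>J$ and fixed ratio $C/\min_iC_i$, all conditions hold for every $T\ge K$ and every $\delta\in(0,1)$ once $\kappa$ is small; for $J=K$ they allow every $\delta$ that is polynomially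 small in $KT$.) -/

import Mathlib

open MeasureTheory

noncomputable section

namespace NCOOMS

/-! ### Online mirror descent -/

section Mirror

variable {E : Type*} [NormedAddCommGroup E] [InnerProductSpace ℝ E] [CompleteSpace E]

/-- Bregman divergence `D_ψ(u, v) = ψ(u) - ψ(v) - ⟨∇ψ(v), u - v⟩`. -/
def bregman (ψ : E → ℝ) (u v : E) : ℝ :=
  ψ u - ψ v - inner ℝ (gradient ψ v) (u - v)

/-- `u'` is a result of one step of online mirror descent with regularizer `ψ`, from the point `u`
with gradient (estimate) `g`: for some `ū` in the open domain `dom` of `∇ψ` with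
`∇ψ(ū) = ∇ψ(u) - g`, the point `u'` minimizes `D_ψ(·, ū)` over the decision set `S`. -/
def IsMirrorStep (ψ : E → ℝ) (dom S : Set E) (u g u' : E) : Prop :=
  ∃ ubar ∈ dom, gradient ψ ubar = gradient ψ u - g ∧
    u' ∈ S ∧ IsMinOn (fun z => bregman ψ z ubar) S u'

/-- The point produced by one step of online mirror descent. (For the two strictly convex
regularizers used below there is exactly one such point.) -/
def mirrorStep (ψ : E → ℝ) (dom S : Set E) (u g : E) : E :=
  Classical.epsilon (IsMirrorStep ψ dom S u g)

end Mirror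

/-! ### The problem: `K` hypothesis spaces, `M` clients -/

/-- An instance of online model selection with decentralized data. The `i`-th hypothesis space is
`F_i = {x ↦ ⟨w, φ_i(x)⟩ : w ∈ ℝ^{d_i}, ‖w‖₂ ≤ U_i}`; client `j` receives in round `t + 1` the
example `(x j t, y j t)`. The function `dloss v y` is the derivative of `loss · y` at `v`
(a subgradient where the loss is not differentiable, see `IsSubgradient`). -/
structure Problem (K M : ℕ) where
  inDim : ℕ
  dim : Fin K → ℕ
  φ : (i : Fin K) → EuclideanSpace ℝ (Fin inDim) → EuclideanSpace ℝ (Fin (dim i))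
  U : Fin K → ℝ
  loss : ℝ → ℝ → ℝ
  dloss : ℝ → ℝ → ℝ
  x : Fin M → ℕ → EuclideanSpace ℝ (Fin inDim)
  y : Fin M → ℕ → ℝ

/-- `dloss · y` selects a subgradient of `loss · y` at every point. For a convex loss that is
differentiable in its first argument the derivative is the only such selection. -/
def IsSubgradient (loss dloss : ℝ → ℝ → ℝ) : Prop :=
  ∀ v u y, loss v y + dloss v y * (u - v) ≤ loss u y

/-- State of one client at the beginning of a round: the sampling distribution `p_t` and the
parameters `w_{t,i}` of the `K` hypotheses. -/
structure State {K M : ℕ} (P : Problem K M) where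
  p : EuclideanSpace ℝ (Fin K)
  w : (i : Fin K) → EuclideanSpace ℝ (Fin (P.dim i))

variable {K M : ℕ}

/-- Loss of the linear hypothesis with parameter `w` in `F_i` on the `t`-th example of client `j`. -/
def hypLoss (P : Problem K M) (j : Fin M) (t : ℕ) (i : Fin K)
    (w : EuclideanSpace ℝ (Fin (P.dim i))) : ℝ :=
  P.loss (inner ℝ w (P.φ i (P.x j t))) (P.y j t)

/-- Gradient with respect to `w` of `hypLoss`. -/
def hypGrad (P : Problem K M) (j : Fin M) (t : ℕ) (i : Fin K)
    (w : EuclideanSpace ℝ (Fin (P.dim i))) : EuclideanSpace ℝ (Fin (P.dim i)) :=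
  P.dloss (inner ℝ w (P.φ i (P.x j t))) (P.y j t) • P.φ i (P.x j t)

/-! ### Sampling -/

/-- The indices `{A_1, …, A_{s-1}}` drawn before the draw `s`. -/
def prior {J : ℕ} (a : Fin J → Fin K) (s : Fin J) : Finset (Fin K) :=
  (Finset.univ.filter (fun r => r < s)).image a

/-- The set `O = {A_1, …, A_J}`. -/
def sampled {J : ℕ} (a : Fin J → Fin K) : Finset (Fin K) :=
  Finset.univ.image a

/-- Probability that drawing in order `A_1 ∼ p` and `A_s ∼ Uni([K] \ {A_1, …, A_{s-1}})` for
`s = 2, …, J` gives the sequence `a`. -/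
def sampleProb {J : ℕ} [NeZero J] (p : EuclideanSpace ℝ (Fin K)) (a : Fin J → Fin K) : ℝ :=
  p (a 0) * ∏ s ∈ Finset.univ.erase (0 : Fin J),
    (if a s ∈ prior a s then 0 else 1 / ((Finset.univ \ prior a s).card : ℝ))

/-- `ℙ[i ∈ O]` under this sampling scheme. -/
def inclusionProb (J : ℕ) [NeZero J] (p : EuclideanSpace ℝ (Fin K)) (i : Fin K) : ℝ :=
  ∑ a ∈ Finset.univ.filter (fun a : Fin J → Fin K => i ∈ sampled a), sampleProb p a

/-! ### Parameters of the algorithm -/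

/-- `g_{K,J} = (K - J) / (J - 1)`. -/
def gKJ (K J : ℕ) : ℝ := ((K : ℝ) - J) / ((J : ℝ) - 1)

/-- Learning rate for the sampling distribution,
`√(ln(KT)) / (2 √((1 + g) T)) ∧ (J - 1) / (2 (K - J))`, where the second term is `+∞` if `J = K`. -/
def eta (K J T : ℕ) : ℝ :=
  if J = K then √(Real.log (K * T)) / (2 * √((1 + gKJ K J) * T))
  else min (√(Real.log (K * T)) / (2 * √((1 + gKJ K J) * T)))
    (((J : ℝ) - 1) / (2 * ((K : ℝ) - J)))

/-- Learning rate `U_i / (2 G_i √((1 + g) (g² ∨ t)))` for the hypotheses in round `t ≥ 1`. -/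
def lam (K J : ℕ) (Ui Gi : ℝ) (t : ℕ) : ℝ :=
  Ui / (2 * Gi * √((1 + gKJ K J) * max (gKJ K J ^ 2) t))

open Classical in
/-- `A_m = argmin_i C_i`, as the set of all minimizers. -/
def argminSet (C : Fin K → ℝ) : Finset (Fin K) :=
  Finset.univ.filter (fun i => ∀ k, C i ≤ C k)

/-- The initial sampling distribution `p_1`. -/
def initDist (T : ℕ) (C : Fin K → ℝ) : EuclideanSpace ℝ (Fin K) :=
  WithLp.toLp 2 fun i =>
    if i ∈ argminSet C then
      (1 - √(K : ℝ) / √(T : ℝ)) / ((argminSet C).card : ℝ) + 1 / √((K : ℝ) * T)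
    else 1 / √((K : ℝ) * T)

/-- Weighted negative entropy `∑_i (C_i / η) p_i ln p_i`. -/
def entropyReg (C : Fin K → ℝ) (η : ℝ) (p : EuclideanSpace ℝ (Fin K)) : ℝ :=
  ∑ i, C i / η * (p i * Real.log (p i))

/-- The open positive orthant, where the gradient of the entropy is defined. -/
def posOrthant (K : ℕ) : Set (EuclideanSpace ℝ (Fin K)) := {p | ∀ i, 0 < p i}

/-- The probability simplex in `ℝ^K`. -/
def simplex (K : ℕ) : Set (EuclideanSpace ℝ (Fin K)) := {p | (∀ i, 0 ≤ p i) ∧ ∑ i, p i = 1}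

/-- Euclidean regularizer `‖w‖² / (2 λ)`. -/
def euclReg {d : ℕ} (l : ℝ) (w : EuclideanSpace ℝ (Fin d)) : ℝ := 1 / (2 * l) * ‖w‖ ^ 2

/-! ### The algorithm -/

/-- Importance-weighted loss vector: `c_i / ℙ[i ∈ O]` for `i ∈ O`, and `0` otherwise. -/
def lossEst (P : Problem K M) {J : ℕ} [NeZero J] (j : Fin M) (t : ℕ) (s : State P)
    (a : Fin J → Fin K) : EuclideanSpace ℝ (Fin K) :=
  WithLp.toLp 2 fun i =>
    if i ∈ sampled a then hypLoss P j t i (s.w i) / inclusionProb J s.p i else 0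

/-- Importance-weighted gradient: `∇_i / ℙ[i ∈ O]` for `i ∈ O`, and `0` otherwise. -/
def gradEst (P : Problem K M) {J : ℕ} [NeZero J] (j : Fin M) (t : ℕ) (s : State P)
    (a : Fin J → Fin K) (i : Fin K) : EuclideanSpace ℝ (Fin (P.dim i)) :=
  if i ∈ sampled a then (inclusionProb J s.p i)⁻¹ • hypGrad P j t i (s.w i) else 0

/-- State of client `j` after `t` rounds, i.e. at the beginning of round `t + 1`, when the indices
drawn by this client in the successive rounds are `a 0, a 1, …`. Clients do not interact. -/
def state (P : Problem K M) (J T : ℕ) [NeZero J] (C G : Fin K → ℝ) (j : Fin M)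
    (a : ℕ → Fin J → Fin K) : ℕ → State P
  | 0 => { p := initDist T C, w := fun _ => 0 }
  | t + 1 =>
    let s := state P J T C G j a t
    { p := mirrorStep (entropyReg C (eta K J T)) (posOrthant K) (simplex K) s.p
        (lossEst P j t s (a t))
      w := fun i => mirrorStep (euclReg (lam K J (P.U i) (G i) (t + 1))) Set.univ
        (Metric.closedBall 0 (P.U i)) (s.w i) (gradEst P j t s (a t) i) }

variable {Ω : Type*}

/-- Random state of client `j` at the beginning of round `t + 1`, where `A t j ω` are the indices
drawn by client `j` in round `t + 1`. -/
def run (P : Problem K M) (J T : ℕ) [NeZero J] (C G : Fin K → ℝ)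
    (A : ℕ → Fin M → Ω → Fin J → Fin K) (j : Fin M) (t : ℕ) (ω : Ω) : State P :=
  state P J T C G j (fun τ => A τ j ω) t

/-- The σ-algebra generated by all draws of all clients in the first `t` rounds. -/
abbrev past {J : ℕ} (A : ℕ → Fin M → Ω → Fin J → Fin K) (t : ℕ) : MeasurableSpace Ω :=
  ⨆ (τ : ℕ) (_ : τ < t) (j : Fin M), MeasurableSpace.comap (A τ j) inferInstance

/-- The random draws `A` are those of NCO-OMS: in each of the `T` rounds, conditionally on the past,
the clients draw independently of each other, client `j` with its current distribution. -/
structure IsSampling [MeasurableSpace Ω] (μ : Measure Ω) (P : Problem K M) (J T : ℕ) [NeZero J]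
    (C G : Fin K → ℝ) (A : ℕ → Fin M → Ω → Fin J → Fin K) : Prop where
  measurable : ∀ t j, Measurable (A t j)
  law : ∀ t < T, ∀ a : Fin M → Fin J → Fin K,
    μ[Set.indicator {ω | ∀ j, A t j ω = a j} (fun _ => (1 : ℝ)) | past A t] =ᵐ[μ]
      fun ω => ∏ j, sampleProb (run P J T C G A j t ω).p (a j)

/-- Regret with respect to `F_i`: the total loss of the predictions `f_{t,A_{t,1}}` of all clients
minus the minimal total loss of a single hypothesis in `F_i`. -/
def regret (P : Problem K M) (J T : ℕ) [NeZero J] (C G : Fin K → ℝ)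
    (A : ℕ → Fin M → Ω → Fin J → Fin K) (i : Fin K) (ω : Ω) : ℝ :=
  (∑ t ∈ Finset.range T, ∑ j, hypLoss P j t (A t j ω 0) ((run P J T C G A j t ω).w (A t j ω 0)))
    - sInf ((fun w => ∑ t ∈ Finset.range T, ∑ j, hypLoss P j t i w) ''
        Metric.closedBall 0 (P.U i))

end NCOOMS

end

/-!
The regret of one client against the hypothesis `i`, with comparator `u ∈ F_i`, is split along the
estimated losses. Write `c_t` for the losses of the hypotheses, `W_t = 𝕀[i ∈ O_t] / ℙ[i ∈ O_t]` for
the importance weight of `i`, `C = max_k C_k` and `g = (K - J) / (J - 1)`. The weights have mean one,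
are at most `1 + g`, and have variance at most `g`.

*Predictions against hypothesis `i`.* The losses of the predictions are compared with their
conditional means `⟨p_t, c_t⟩`, these with their estimates, and the estimates with `∑ W_t c_{t,i}`.
The last step is mirror descent with the weighted entropy, `ValidParams.sum_meanCostEst_le`, whose
second order term is a small multiple of the estimate itself. The two deviations,
`tail_prediction` and `tail_meanCostEst`, have variance at most `C` and `g C` times the sum `Y` of
the conditional means. As `Y` is, up to lower order terms, at most a multiple of `C_i T`, this yields
`√(C C_i g T ln (1 / δ))` in place of `C √(g T ln (1 / δ))`. The tail bounds need a deterministic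
scale in place of the random `Y`; one scale for each of the `O(log (K T))` dyadic fractions of `C` is
enough (`exists_dyadic_scale`), and this is where the factor `log₂ (K T)` in the probability
comes from.

*Hypothesis `i` against the comparator.* Online gradient descent bounds `∑ W_t (c_{t,i} - v_t)` for
comparator losses `v_t`, and `∑ v_t (W_t - 1)` remains. This must hold for all `K` hypotheses at
once, so its confidence parameter is `δ / K`. The resulting `ln K` may multiply the part of the
variance that comes from `C_i`, because the bound contains `C_i √(ln (K T))`, but not the part that
comes from `U_i G_i`. Hence the `v_t` have to be deterministic with `∑ v_t² = O(C_i² T)` up to lower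
order terms (`exists_comparator`). The losses of `u` may be larger than `C_i`. If their total excess
over `C_i` is of lower order they can be used, truncated. Otherwise, they are replaced by the losses
along one fixed run of the algorithm (`exists_path`): these lie in `[0, C_i]`, they exceed the losses
of `u` by little, and the run can be chosen so that its parameters move slowly. The descent bound with
the moving comparator then costs less than the excess over `C_i` gains. (For `J = K` there is no
choice of the run, but then all weights are one and `∑ v_t (W_t - 1)` vanishes.)

All tail bounds come from one exponential supermartingale, by `exp x ≤ 1 + x + x²` for `x ≤ 1`
(`tail_bound`). The regret of the network is the sum over the clients, with a union bound.
-/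

namespace NCOOMS

/-! ### Sampling without replacement -/

section Sampling

variable {K J : ℕ}

theorem sum_comp_perm (σ : Equiv.Perm (Fin K)) (f : (Fin J → Fin K) → ℝ) :
    ∑ a, f (σ ∘ a) = ∑ a, f a :=
  Equiv.sum_comp (Equiv.arrowCongr (Equiv.refl (Fin J)) σ) f

theorem gKJ_nonneg (hJ : 2 ≤ J) (hJK : J ≤ K) : 0 ≤ gKJ K J := by
  have h1 : (2 : ℝ) ≤ J := by exact_mod_cast hJ
  have h2 : (J : ℝ) ≤ K := by exact_mod_cast hJK
  exact div_nonneg (by linarith) (by linarith)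

theorem one_add_gKJ (hJ : 2 ≤ J) : 1 + gKJ K J = ((K : ℝ) - 1) / ((J : ℝ) - 1) := by
  have h1 : (2 : ℝ) ≤ J := by exact_mod_cast hJ
  rw [gKJ, eq_div_iff (by linarith), add_mul, div_mul_cancel₀ _ (by linarith)]
  ring

theorem exists_injective_notMem (hJK : J < K) (i : Fin K) :
    ∃ a : Fin J → Fin K, Function.Injective a ∧ i ∉ sampled a := by
  refine ⟨Equiv.swap ⟨J, hJK⟩ i ∘ Fin.castLE hJK.le,
    (Equiv.injective _).comp (Fin.castLE_injective hJK.le), ?_⟩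
  simp only [sampled, Finset.mem_image, Finset.mem_univ, true_and, Function.comp_apply, not_exists]
  intro s hs
  rw [Equiv.swap_apply_eq_iff, Equiv.swap_apply_right] at hs
  have := congrArg Fin.val hs
  simp only [Fin.val_castLE] at this
  exact absurd this s.2.ne

variable [NeZero J]

/-- Conditional probability of the draws `A_2, …, A_J` given the draw `A_1`. -/
noncomputable def drawWeight (a : Fin J → Fin K) : ℝ :=
  ∏ s ∈ Finset.univ.erase (0 : Fin J),
    (if a s ∈ prior a s then 0 else 1 / ((Finset.univ \ prior a s).card : ℝ))

theorem sampleProb_eq (p : EuclideanSpace ℝ (Fin K)) (a : Fin J → Fin K) :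
    sampleProb p a = p (a 0) * drawWeight a := rfl

theorem drawWeight_nonneg (a : Fin J → Fin K) : 0 ≤ drawWeight a := by
  refine Finset.prod_nonneg fun s _ => ?_
  split_ifs
  · exact le_rfl
  · positivity

theorem drawWeight_eq_zero {a : Fin J → Fin K} (ha : ¬ Function.Injective a) :
    drawWeight a = 0 := by
  rw [Function.Injective] at ha
  push Not at ha
  obtain ⟨r, s, hrs, hne⟩ := ha
  wlog hlt : r < s generalizing r s
  · exact this s r hrs.symm hne.symm (lt_of_le_of_ne (not_lt.mp hlt) hne.symm)
  have hs : s ≠ 0 := by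
    rintro rfl
    exact absurd hlt (by simp)
  refine Finset.prod_eq_zero (i := s) (by simp [hs]) ?_
  rw [if_pos]
  simp only [prior, Finset.mem_image, Finset.mem_filter, Finset.mem_univ, true_and]
  exact ⟨r, hlt, hrs⟩

theorem drawWeight_of_injective {a : Fin J → Fin K} (ha : Function.Injective a) :
    drawWeight a = ∏ s ∈ Finset.univ.erase (0 : Fin J), (1 / ((K : ℝ) - (s : ℕ))) := by
  refine Finset.prod_congr rfl fun s _ => ?_
  have h1 : a s ∉ prior a s := by
    simp only [prior, Finset.mem_image, Finset.mem_filter, Finset.mem_univ, true_and, not_exists,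
      not_and]
    intro r hr h
    exact hr.ne (ha h)
  have h2 : (prior a s).card = (s : ℕ) := by
    rw [prior, Finset.card_image_of_injective _ ha]
    have : (Finset.univ.filter fun r : Fin J => r < s) = Finset.Iio s := by
      ext r; simp
    rw [this, Fin.card_Iio]
  have h3 : (s : ℕ) ≤ K := by
    have := Finset.card_le_univ (prior a s)
    rw [h2, Fintype.card_fin] at this
    exact this
  rw [if_neg h1, Finset.card_sdiff_of_subset (Finset.subset_univ _), h2, Finset.card_univ,
    Fintype.card_fin, Nat.cast_sub h3]

theorem drawWeight_pos (hJK : J ≤ K) {a : Fin J → Fin K} (ha : Function.Injective a) :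
    0 < drawWeight a := by
  rw [drawWeight_of_injective ha]
  refine Finset.prod_pos fun s _ => ?_
  have : ((s : ℕ) : ℝ) < K := by exact_mod_cast s.2.trans_le hJK
  exact one_div_pos.mpr (by linarith)

theorem sum_drawWeight (hJK : J ≤ K) : ∑ a : Fin J → Fin K, drawWeight a = K := by
  classical
  set W : ℝ := ∏ s ∈ Finset.univ.erase (0 : Fin J), (1 / ((K : ℝ) - (s : ℕ))) with hW
  have h1 : ∑ a : Fin J → Fin K, drawWeight a
      = ∑ a ∈ Finset.univ.filter (fun a : Fin J → Fin K => Function.Injective a), W := by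
    rw [Finset.sum_filter]
    refine Finset.sum_congr rfl fun a _ => ?_
    split_ifs with h
    · exact drawWeight_of_injective h
    · exact drawWeight_eq_zero h
  have h2 : (Finset.univ.filter (fun a : Fin J → Fin K => Function.Injective a)).card
      = K.descFactorial J := by
    rw [← Fintype.card_subtype,
      Fintype.card_congr (Equiv.subtypeInjectiveEquivEmbedding (Fin J) (Fin K)),
      Fintype.card_embedding_eq, Fintype.card_fin, Fintype.card_fin]
  have h3 : ((K.descFactorial J : ℕ) : ℝ) = ∏ s : Fin J, ((K : ℝ) - (s : ℕ)) := by
    rw [Nat.descFactorial_eq_prod_range, Nat.cast_prod, Finset.prod_range]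
    refine Finset.prod_congr rfl fun s _ => ?_
    rw [Nat.cast_sub (s.2.le.trans hJK)]
  rw [h1, Finset.sum_const, h2, nsmul_eq_mul, h3,
    ← Finset.mul_prod_erase _ _ (Finset.mem_univ (0 : Fin J)), mul_assoc, hW,
    ← Finset.prod_mul_distrib, Finset.prod_eq_one]
  · simp
  · intro s _
    have : ((s : ℕ) : ℝ) < K := by exact_mod_cast s.2.trans_le hJK
    exact mul_one_div_cancel (by linarith)

theorem drawWeight_comp (σ : Equiv.Perm (Fin K)) (a : Fin J → Fin K) :
    drawWeight (σ ∘ a) = drawWeight a := by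
  by_cases ha : Function.Injective a
  · rw [drawWeight_of_injective ha, drawWeight_of_injective (σ.injective.comp ha)]
  · rw [drawWeight_eq_zero ha, drawWeight_eq_zero]
    exact fun h => ha (h.of_comp)

/-- Given `A_1 = k`, the conditional probabilities of the remaining draws sum to one: by symmetry
the sum does not depend on `k`. -/
theorem sum_drawWeight_first (hJK : J ≤ K) (k : Fin K) :
    ∑ a : Fin J → Fin K, (if a 0 = k then drawWeight a else 0) = 1 := by
  have hK : (0 : ℝ) < K := by
    have := k.2
    exact_mod_cast (by omega : 0 < K)
  have hsym : ∀ k' : Fin K, ∑ a : Fin J → Fin K, (if a 0 = k' then drawWeight a else 0)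
      = ∑ a : Fin J → Fin K, (if a 0 = k then drawWeight a else 0) := by
    intro k'
    rw [← sum_comp_perm (Equiv.swap k k')]
    refine Finset.sum_congr rfl fun a _ => ?_
    rw [drawWeight_comp]
    have : (Equiv.swap k k') (a 0) = k' ↔ a 0 = k := by
      rw [Equiv.swap_apply_eq_iff, Equiv.swap_apply_right]
    simp only [Function.comp_apply, this]
  have hsum : ∑ k' : Fin K, ∑ a : Fin J → Fin K, (if a 0 = k' then drawWeight a else 0) = K := by
    rw [Finset.sum_comm, ← sum_drawWeight hJK]
    exact Finset.sum_congr rfl fun a _ => by simp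
  rw [Finset.sum_congr rfl fun k' _ => hsym k'] at hsum
  simp only [Finset.sum_const, Finset.card_univ, Fintype.card_fin, nsmul_eq_mul] at hsum
  exact mul_left_cancel₀ hK.ne' (by rw [hsum, mul_one])

/-- Given `A_1 = k`, every other index is among the `J - 1` remaining draws with the same
probability. -/
theorem sum_drawWeight_first_mem (hJ : 2 ≤ J) (hJK : J ≤ K) {i k : Fin K} (hik : i ≠ k) :
    ∑ a : Fin J → Fin K, (if a 0 = k ∧ i ∈ sampled a then drawWeight a else 0)
      = ((J : ℝ) - 1) / ((K : ℝ) - 1) := by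
  classical
  have hK : (0 : ℝ) < (K : ℝ) - 1 := by
    have : (2 : ℝ) ≤ K := by exact_mod_cast hJ.trans hJK
    linarith
  have hsym : ∀ i' ∈ Finset.univ.erase k,
      ∑ a : Fin J → Fin K, (if a 0 = k ∧ i' ∈ sampled a then drawWeight a else 0)
      = ∑ a : Fin J → Fin K, (if a 0 = k ∧ i ∈ sampled a then drawWeight a else 0) := by
    intro i' hi'
    have hi'k : i' ≠ k := by simpa using hi'
    rw [← sum_comp_perm (Equiv.swap i i')]
    refine Finset.sum_congr rfl fun a _ => ?_
    rw [drawWeight_comp]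
    have h1 : (Equiv.swap i i') (a 0) = k ↔ a 0 = k := by
      rw [Equiv.swap_apply_eq_iff, Equiv.swap_apply_of_ne_of_ne hik.symm hi'k.symm]
    have h2 : i' ∈ sampled (Equiv.swap i i' ∘ a) ↔ i ∈ sampled a := by
      simp only [sampled, Finset.mem_image, Finset.mem_univ, true_and, Function.comp_apply,
        Equiv.swap_apply_eq_iff, Equiv.swap_apply_right]
    simp only [Function.comp_apply, h1, h2]
  have hsum : ∑ i' ∈ Finset.univ.erase k,
      ∑ a : Fin J → Fin K, (if a 0 = k ∧ i' ∈ sampled a then drawWeight a else 0)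
      = (J : ℝ) - 1 := by
    rw [Finset.sum_comm]
    have : ∀ a : Fin J → Fin K,
        ∑ i' ∈ Finset.univ.erase k, (if a 0 = k ∧ i' ∈ sampled a then drawWeight a else 0)
        = ((J : ℝ) - 1) * (if a 0 = k then drawWeight a else 0) := by
      intro a
      by_cases ha0 : a 0 = k
      · by_cases hinj : Function.Injective a
        · simp only [ha0, true_and, if_true]
          rw [← Finset.sum_filter, Finset.sum_const, nsmul_eq_mul]
          congr 1
          have : (Finset.univ.erase k).filter (fun i' => i' ∈ sampled a) = (sampled a).erase k := by
            ext x
            simp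
          rw [this, Finset.card_erase_of_mem, sampled, Finset.card_image_of_injective _ hinj,
            Finset.card_univ, Fintype.card_fin, Nat.cast_sub (by omega), Nat.cast_one]
          rw [← ha0, sampled]
          exact Finset.mem_image_of_mem _ (Finset.mem_univ _)
        · simp [drawWeight_eq_zero hinj]
      · simp [ha0]
    rw [Finset.sum_congr rfl fun a _ => this a, ← Finset.mul_sum, sum_drawWeight_first hJK, mul_one]
  rw [Finset.sum_congr rfl hsym, Finset.sum_const, Finset.card_erase_of_mem (Finset.mem_univ _),
    Finset.card_univ, Fintype.card_fin, nsmul_eq_mul, Nat.cast_sub (by omega), Nat.cast_one] at hsum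
  rw [eq_div_iff hK.ne', mul_comm]
  exact hsum

theorem sampleProb_nonneg {p : EuclideanSpace ℝ (Fin K)} (hp : p ∈ simplex K) (a : Fin J → Fin K) :
    0 ≤ sampleProb p a :=
  mul_nonneg (hp.1 _) (drawWeight_nonneg a)

/-- The first draw has distribution `p`. -/
theorem sum_sampleProb_mul_first (hJK : J ≤ K) (p : EuclideanSpace ℝ (Fin K)) (f : Fin K → ℝ) :
    ∑ a : Fin J → Fin K, sampleProb p a * f (a 0) = ∑ k, p k * f k := by
  have : ∀ a : Fin J → Fin K, sampleProb p a * f (a 0)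
      = ∑ k, p k * f k * (if a 0 = k then drawWeight a else 0) := by
    intro a
    simp [sampleProb_eq]
    ring
  rw [Finset.sum_congr rfl fun a _ => this a, Finset.sum_comm]
  refine Finset.sum_congr rfl fun k _ => ?_
  rw [← Finset.mul_sum, sum_drawWeight_first hJK, mul_one]

theorem sum_sampleProb (hJK : J ≤ K) {p : EuclideanSpace ℝ (Fin K)} (hp : p ∈ simplex K) :
    ∑ a : Fin J → Fin K, sampleProb p a = 1 := by
  have := sum_sampleProb_mul_first hJK p (fun _ => 1)
  simpa [hp.2] using this

theorem inclusionProb_eq (hJ : 2 ≤ J) (hJK : J ≤ K) {p : EuclideanSpace ℝ (Fin K)}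
    (hp : p ∈ simplex K) (i : Fin K) :
    inclusionProb J p i = p i + (1 - p i) * (((J : ℝ) - 1) / ((K : ℝ) - 1)) := by
  classical
  have h1 : inclusionProb J p i = ∑ a : Fin J → Fin K, ∑ k,
      p k * (if a 0 = k ∧ i ∈ sampled a then drawWeight a else 0) := by
    rw [inclusionProb, Finset.sum_filter]
    refine Finset.sum_congr rfl fun a _ => ?_
    by_cases hi : i ∈ sampled a <;> simp [hi, sampleProb_eq]
  have h2 : ∑ a : Fin J → Fin K, (if a 0 = i ∧ i ∈ sampled a then drawWeight a else 0) = 1 := by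
    rw [← sum_drawWeight_first hJK i]
    refine Finset.sum_congr rfl fun a _ => ?_
    have : a 0 = i → i ∈ sampled a := by
      rintro rfl
      exact Finset.mem_image_of_mem _ (Finset.mem_univ _)
    by_cases h : a 0 = i <;> simp [h, this]
  have h3 : 1 - p i = ∑ k ∈ Finset.univ.erase i, p k := by
    rw [← hp.2, ← Finset.add_sum_erase _ _ (Finset.mem_univ i)]
    ring
  rw [h1, Finset.sum_comm]
  simp only [← Finset.mul_sum]
  rw [← Finset.add_sum_erase _ _ (Finset.mem_univ i), h2, mul_one, h3, Finset.sum_mul]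
  congr 1
  refine Finset.sum_congr rfl fun k hk => ?_
  rw [sum_drawWeight_first_mem hJ hJK]
  simpa using (Finset.ne_of_mem_erase hk).symm

theorem one_div_le_inclusionProb (hJ : 2 ≤ J) (hJK : J ≤ K) {p : EuclideanSpace ℝ (Fin K)}
    (hp : p ∈ simplex K) (i : Fin K) : 1 / (1 + gKJ K J) ≤ inclusionProb J p i := by
  have h1 : (2 : ℝ) ≤ J := by exact_mod_cast hJ
  have h2 : (J : ℝ) ≤ K := by exact_mod_cast hJK
  have h3 : ((J : ℝ) - 1) / ((K : ℝ) - 1) ≤ 1 := by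
    rw [div_le_one (by linarith)]; linarith
  rw [inclusionProb_eq hJ hJK hp, one_add_gKJ hJ, one_div_div]
  nlinarith [hp.1 i]

theorem inclusionProb_pos (hJ : 2 ≤ J) (hJK : J ≤ K) {p : EuclideanSpace ℝ (Fin K)}
    (hp : p ∈ simplex K) (i : Fin K) : 0 < inclusionProb J p i :=
  lt_of_lt_of_le (one_div_pos.mpr (by linarith [gKJ_nonneg hJ hJK]))
    (one_div_le_inclusionProb hJ hJK hp i)

theorem apply_le_one {p : EuclideanSpace ℝ (Fin K)} (hp : p ∈ simplex K) (i : Fin K) : p i ≤ 1 := by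
  rw [← hp.2]
  exact Finset.single_le_sum (fun k _ => hp.1 k) (Finset.mem_univ i)

theorem inclusionProb_le_one (hJ : 2 ≤ J) (hJK : J ≤ K) {p : EuclideanSpace ℝ (Fin K)}
    (hp : p ∈ simplex K) (i : Fin K) : inclusionProb J p i ≤ 1 := by
  have h1 : (2 : ℝ) ≤ J := by exact_mod_cast hJ
  have h2 : (J : ℝ) ≤ K := by exact_mod_cast hJK
  have h3 : ((J : ℝ) - 1) / ((K : ℝ) - 1) ≤ 1 := by
    rw [div_le_one (by linarith)]; linarith
  rw [inclusionProb_eq hJ hJK hp]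
  nlinarith [apply_le_one hp i]

/-- Importance weight `𝕀[i ∈ O] / ℙ[i ∈ O]` of the index `i`. -/
noncomputable def obsWeight (p : EuclideanSpace ℝ (Fin K)) (i : Fin K) (a : Fin J → Fin K) : ℝ :=
  if i ∈ sampled a then (inclusionProb J p i)⁻¹ else 0

theorem obsWeight_nonneg (hJ : 2 ≤ J) (hJK : J ≤ K) {p : EuclideanSpace ℝ (Fin K)}
    (hp : p ∈ simplex K) (i : Fin K) (a : Fin J → Fin K) : 0 ≤ obsWeight p i a := by
  rw [obsWeight]
  split_ifs
  · exact inv_nonneg.mpr (inclusionProb_pos hJ hJK hp i).le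
  · exact le_rfl

theorem inv_inclusionProb_le (hJ : 2 ≤ J) (hJK : J ≤ K) {p : EuclideanSpace ℝ (Fin K)}
    (hp : p ∈ simplex K) (i : Fin K) : (inclusionProb J p i)⁻¹ ≤ 1 + gKJ K J := by
  have hg := gKJ_nonneg hJ hJK
  rw [inv_le_comm₀ (inclusionProb_pos hJ hJK hp i) (by linarith), ← one_div]
  exact one_div_le_inclusionProb hJ hJK hp i

theorem obsWeight_le (hJ : 2 ≤ J) (hJK : J ≤ K) {p : EuclideanSpace ℝ (Fin K)}
    (hp : p ∈ simplex K) (i : Fin K) (a : Fin J → Fin K) : obsWeight p i a ≤ 1 + gKJ K J := by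
  rw [obsWeight]
  split_ifs
  · exact inv_inclusionProb_le hJ hJK hp i
  · linarith [gKJ_nonneg hJ hJK]

/-- The importance weights are unbiased. -/
theorem sum_sampleProb_mul_obsWeight (hJ : 2 ≤ J) (hJK : J ≤ K) {p : EuclideanSpace ℝ (Fin K)}
    (hp : p ∈ simplex K) (i : Fin K) :
    ∑ a : Fin J → Fin K, sampleProb p a * obsWeight p i a = 1 := by
  have : ∀ a : Fin J → Fin K, sampleProb p a * obsWeight p i a
      = (if i ∈ sampled a then sampleProb p a else 0) * (inclusionProb J p i)⁻¹ := by
    intro a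
    rw [obsWeight]
    split_ifs <;> simp
  rw [Finset.sum_congr rfl fun a _ => this a, ← Finset.sum_mul, ← Finset.sum_filter]
  exact mul_inv_cancel₀ (inclusionProb_pos hJ hJK hp i).ne'

theorem sum_sampleProb_mul_obsWeight_sq (hJ : 2 ≤ J) (hJK : J ≤ K) {p : EuclideanSpace ℝ (Fin K)}
    (hp : p ∈ simplex K) (i : Fin K) :
    ∑ a : Fin J → Fin K, sampleProb p a * obsWeight p i a ^ 2 = (inclusionProb J p i)⁻¹ := by
  have : ∀ a : Fin J → Fin K, sampleProb p a * obsWeight p i a ^ 2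
      = (sampleProb p a * obsWeight p i a) * (inclusionProb J p i)⁻¹ := by
    intro a
    rw [obsWeight]
    split_ifs <;> ring
  rw [Finset.sum_congr rfl fun a _ => this a, ← Finset.sum_mul,
    sum_sampleProb_mul_obsWeight hJ hJK hp, one_mul]

/-- The importance weights have variance at most `g`. -/
theorem sum_sampleProb_mul_obsWeight_sub_one_sq_le (hJ : 2 ≤ J) (hJK : J ≤ K)
    {p : EuclideanSpace ℝ (Fin K)} (hp : p ∈ simplex K) (i : Fin K) :
    ∑ a : Fin J → Fin K, sampleProb p a * (obsWeight p i a - 1) ^ 2 ≤ gKJ K J := by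
  have : ∀ a : Fin J → Fin K, sampleProb p a * (obsWeight p i a - 1) ^ 2
      = sampleProb p a * obsWeight p i a ^ 2 - 2 * (sampleProb p a * obsWeight p i a)
        + sampleProb p a := by
    intro a; ring
  rw [Finset.sum_congr rfl fun a _ => this a, Finset.sum_add_distrib, Finset.sum_sub_distrib,
    ← Finset.mul_sum, sum_sampleProb_mul_obsWeight hJ hJK hp,
    sum_sampleProb_mul_obsWeight_sq hJ hJK hp, sum_sampleProb hJK hp]
  linarith [inv_inclusionProb_le hJ hJK hp i]

theorem exists_injective_mem (hJK : J ≤ K) (i : Fin K) :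
    ∃ a : Fin J → Fin K, Function.Injective a ∧ i ∈ sampled a := by
  refine ⟨Equiv.swap (Fin.castLE hJK 0) i ∘ Fin.castLE hJK,
    (Equiv.injective _).comp (Fin.castLE_injective hJK), ?_⟩
  rw [sampled, Finset.mem_image]
  exact ⟨0, Finset.mem_univ _, by simp⟩

end Sampling

/-! ### Mirror descent steps -/

section EntropyStep

variable {K : ℕ}

theorem gradient_entropyReg (C : Fin K → ℝ) (η : ℝ) {p : EuclideanSpace ℝ (Fin K)}
    (hp : p ∈ posOrthant K) :
    gradient (entropyReg C η) p = WithLp.toLp 2 fun k => C k / η * (Real.log (p k) + 1) := by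
  apply HasGradientAt.gradient
  rw [hasGradientAt_iff_hasFDerivAt]
  have h : ∀ k ∈ Finset.univ, HasFDerivAt
      (fun q : EuclideanSpace ℝ (Fin K) => C k / η * (q k * Real.log (q k)))
      ((C k / η) • ((Real.log (p k) + 1) • (EuclideanSpace.proj k :
        EuclideanSpace ℝ (Fin K) →L[ℝ] ℝ))) p := by
    intro k _
    have h1 : HasFDerivAt (fun q : EuclideanSpace ℝ (Fin K) => q k)
        (EuclideanSpace.proj k : EuclideanSpace ℝ (Fin K) →L[ℝ] ℝ) p :=
      (EuclideanSpace.proj k : EuclideanSpace ℝ (Fin K) →L[ℝ] ℝ).hasFDerivAt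
    have h2 := (Real.hasDerivAt_mul_log (hp k).ne').comp_hasFDerivAt p h1
    exact h2.const_mul _
  have h3 := HasFDerivAt.fun_sum h
  refine h3.congr_fderiv ?_
  ext v
  simp [PiLp.inner_apply, mul_comm]
  exact Finset.sum_congr rfl fun k _ => by ring

theorem bregman_entropyReg (C : Fin K → ℝ) (η : ℝ) {q : EuclideanSpace ℝ (Fin K)}
    (hq : q ∈ posOrthant K) (z : EuclideanSpace ℝ (Fin K)) :
    bregman (entropyReg C η) z q = ∑ k, C k / η *
      (z k * Real.log (z k) - q k * Real.log (q k) - (Real.log (q k) + 1) * (z k - q k)) := by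
  rw [bregman, gradient_entropyReg C η hq, PiLp.inner_apply, entropyReg, entropyReg,
    ← Finset.sum_sub_distrib, ← Finset.sum_sub_distrib]
  refine Finset.sum_congr rfl fun k _ => ?_
  simp
  ring

theorem entropy_gap_nonneg {x y : ℝ} (hx : 0 ≤ x) (hy : 0 < y) :
    0 ≤ x * Real.log x - y * Real.log y - (Real.log y + 1) * (x - y) := by
  rcases hx.eq_or_lt with rfl | hx
  · simp; nlinarith
  · have := Real.log_le_sub_one_of_pos (div_pos hy hx)
    rw [Real.log_div hy.ne' hx.ne', le_sub_iff_add_le, le_div_iff₀ hx] at this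
    nlinarith

theorem eq_of_entropy_gap_eq_zero {x y : ℝ} (hx : 0 ≤ x) (hy : 0 < y)
    (h : x * Real.log x - y * Real.log y - (Real.log y + 1) * (x - y) = 0) : x = y := by
  rcases hx.eq_or_lt with rfl | hx
  · exfalso
    simp at h
    nlinarith
  · by_contra hne
    have h1 : y / x ≠ 1 := by
      rw [Ne, div_eq_one_iff_eq hx.ne']
      exact Ne.symm hne
    have := Real.log_lt_sub_one_of_pos (div_pos hy hx) h1
    rw [Real.log_div hy.ne' hx.ne', lt_sub_iff_add_lt, lt_div_iff₀ hx] at this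
    nlinarith

/-- One step of mirror descent with the weighted entropy on the simplex multiplies each coordinate
by `exp (η (ν - g_k) / C_k)`, where the multiplier `ν` of the constraint `∑ p_k = 1` normalizes the
result. -/
theorem mirrorStep_entropyReg {C : Fin K → ℝ} (hC : ∀ k, 0 < C k) {η : ℝ} (hη : 0 < η)
    {p : EuclideanSpace ℝ (Fin K)} (hp : p ∈ posOrthant K) (hps : p ∈ simplex K)
    (g : EuclideanSpace ℝ (Fin K)) :
    ∃ ν : ℝ, mirrorStep (entropyReg C η) (posOrthant K) (simplex K) p g ∈ simplex K ∧
      ∀ k, mirrorStep (entropyReg C η) (posOrthant K) (simplex K) p g k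
        = p k * Real.exp ((ν - g k) * η / C k) := by
  -- the total mass is at most one for `ν = -‖g‖` and at least one for `ν = ‖g‖`
  have hcont : Continuous fun ν : ℝ => ∑ k, p k * Real.exp ((ν - g k) * η / C k) := by fun_prop
  have hle : ∑ k, p k * Real.exp ((-‖g‖ - g k) * η / C k) ≤ 1 := by
    rw [← hps.2]
    refine Finset.sum_le_sum fun k _ => mul_le_of_le_one_right (hps.1 k) ?_
    rw [Real.exp_le_one_iff]
    have := abs_le.mp ((Real.norm_eq_abs _).symm.le.trans (PiLp.norm_apply_le g k))
    exact div_nonpos_of_nonpos_of_nonneg (mul_nonpos_of_nonpos_of_nonneg (by linarith) hη.le)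
      (hC k).le
  have hge : 1 ≤ ∑ k, p k * Real.exp ((‖g‖ - g k) * η / C k) := by
    rw [← hps.2]
    refine Finset.sum_le_sum fun k _ => le_mul_of_one_le_right (hps.1 k) ?_
    rw [Real.one_le_exp_iff]
    have := abs_le.mp ((Real.norm_eq_abs _).symm.le.trans (PiLp.norm_apply_le g k))
    exact div_nonneg (mul_nonneg (by linarith) hη.le) (hC k).le
  obtain ⟨ν, -, hν⟩ := intermediate_value_Icc (neg_le_self (norm_nonneg g)) hcont.continuousOn
    ⟨hle, hge⟩
  simp only at hν
  set q : EuclideanSpace ℝ (Fin K) := WithLp.toLp 2 fun k => p k * Real.exp ((ν - g k) * η / C k)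
    with hq
  have hqk : ∀ k, q k = p k * Real.exp ((ν - g k) * η / C k) := fun k => rfl
  have hqpos : q ∈ posOrthant K := fun k => mul_pos (hp k) (Real.exp_pos _)
  have hqs : q ∈ simplex K := ⟨fun k => (hqpos k).le, hν⟩
  -- the unnormalized point is the only one with the prescribed gradient
  have hub : ∀ ubar ∈ posOrthant K, gradient (entropyReg C η) ubar
      = gradient (entropyReg C η) p - g →
      ∀ k, Real.log (ubar k) = Real.log (q k) - ν * η / C k := by
    intro ubar hubar hgrad k
    rw [gradient_entropyReg C η hubar, gradient_entropyReg C η hp] at hgrad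
    have h1 := congrArg (fun v : EuclideanSpace ℝ (Fin K) => v k) hgrad
    simp only [PiLp.sub_apply] at h1
    rw [hqk, Real.log_mul (hp k).ne' (Real.exp_pos _).ne', Real.log_exp]
    have := hC k
    field_simp at h1 ⊢
    linarith
  -- `q` minimizes the Bregman divergence, by a three point identity
  have hdiff : ∀ ubar ∈ posOrthant K, gradient (entropyReg C η) ubar
      = gradient (entropyReg C η) p - g → ∀ z ∈ simplex K,
      bregman (entropyReg C η) z ubar - bregman (entropyReg C η) q ubar
        = ∑ k, C k / η * (z k * Real.log (z k) - q k * Real.log (q k)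
            - (Real.log (q k) + 1) * (z k - q k)) := by
    intro ubar hubar hgrad z hz
    have hlog := hub ubar hubar hgrad
    have hzero : ∑ k, ν * (z k - q k) = 0 := by
      rw [← Finset.mul_sum, Finset.sum_sub_distrib, hz.2, hqs.2]; ring
    rw [bregman_entropyReg C η hubar, bregman_entropyReg C η hubar, ← Finset.sum_sub_distrib,
      ← sub_eq_zero, ← Finset.sum_sub_distrib, ← hzero]
    refine Finset.sum_congr rfl fun k _ => ?_
    rw [hlog k]
    have := hC k
    field_simp
    ring
  have hgap : ∀ z ∈ simplex K, ∀ k, 0 ≤ C k / η * (z k * Real.log (z k) - q k * Real.log (q k)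
            - (Real.log (q k) + 1) * (z k - q k)) := fun z hz k =>
    mul_nonneg (div_pos (hC k) hη).le (entropy_gap_nonneg (hz.1 k) (hqpos k))
  have hstep : IsMirrorStep (entropyReg C η) (posOrthant K) (simplex K) p g q := by
    set ubar : EuclideanSpace ℝ (Fin K) := WithLp.toLp 2 fun k => p k * Real.exp (- g k * η / C k)
      with hubar
    have hpos : ubar ∈ posOrthant K := fun k => mul_pos (hp k) (Real.exp_pos _)
    have hgrad : gradient (entropyReg C η) ubar = gradient (entropyReg C η) p - g := by
      rw [gradient_entropyReg C η hpos, gradient_entropyReg C η hp]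
      ext k
      have : ubar k = p k * Real.exp (- g k * η / C k) := rfl
      simp only [PiLp.sub_apply]
      rw [this, Real.log_mul (hp k).ne' (Real.exp_pos _).ne', Real.log_exp]
      have := hC k
      field_simp
      ring
    refine ⟨ubar, hpos, hgrad, hqs, fun z hz => ?_⟩
    have := hdiff ubar hpos hgrad z hz
    have h0 := Finset.sum_nonneg fun k (_ : k ∈ Finset.univ) => hgap z hz k
    change bregman (entropyReg C η) q ubar ≤ bregman (entropyReg C η) z ubar
    linarith
  have heps : mirrorStep (entropyReg C η) (posOrthant K) (simplex K) p g = q := by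
    obtain ⟨ubar, hpos, hgrad, hs, hmin⟩ :=
      Classical.epsilon_spec (p := IsMirrorStep (entropyReg C η) (posOrthant K) (simplex K) p g)
        ⟨q, hstep⟩
    change mirrorStep (entropyReg C η) (posOrthant K) (simplex K) p g ∈ simplex K at hs
    set z := mirrorStep (entropyReg C η) (posOrthant K) (simplex K) p g with hz
    have h1 := hdiff ubar hpos hgrad z hs
    have h2 : bregman (entropyReg C η) z ubar ≤ bregman (entropyReg C η) q ubar := hmin hqs
    have h3 := Finset.sum_nonneg fun k (_ : k ∈ Finset.univ) => hgap z hs k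
    have h4 := (Finset.sum_eq_zero_iff_of_nonneg fun k _ => hgap z hs k).mp (le_antisymm
      (by linarith) h3)
    ext k
    refine eq_of_entropy_gap_eq_zero (hs.1 k) (hqpos k) ?_
    exact (mul_eq_zero.mp (h4 k (Finset.mem_univ k))).resolve_left (div_pos (hC k) hη).ne'
  rw [heps]
  exact ⟨ν, hqs, hqk⟩

/-- Bregman divergence of the weighted entropy from a point `p` of the simplex to its vertex `i`. -/
noncomputable def vertexDiv (C : Fin K → ℝ) (η : ℝ) (i : Fin K) (p : EuclideanSpace ℝ (Fin K)) :
    ℝ :=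
  C i / η * (-Real.log (p i) - 1) + ∑ k, C k / η * p k

theorem vertexDiv_nonneg {C : Fin K → ℝ} (hC : ∀ k, 0 < C k) {η : ℝ} (hη : 0 < η) (i : Fin K)
    {p : EuclideanSpace ℝ (Fin K)} (hp : p ∈ posOrthant K) : 0 ≤ vertexDiv C η i p := by
  have h1 : C i / η * p i ≤ ∑ k, C k / η * p k :=
    Finset.single_le_sum (f := fun k => C k / η * p k)
      (fun k _ => mul_nonneg (div_pos (hC k) hη).le (hp k).le) (Finset.mem_univ i)
  have h2 := Real.log_le_sub_one_of_pos (hp i)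
  have h3 : 0 ≤ C i / η * (-Real.log (p i) - 1 + p i) :=
    mul_nonneg (div_pos (hC i) hη).le (by linarith)
  rw [vertexDiv]
  linarith

theorem exp_neg_le {x : ℝ} (hx : 0 ≤ x) : Real.exp (-x) ≤ 1 - x + x ^ 2 / 2 := by
  rw [Real.exp_neg]
  refine inv_le_of_inv_le₀ (by nlinarith [sq_nonneg (x - 1)]) ?_
  refine le_trans ?_ (Real.quadratic_le_exp_of_nonneg hx)
  rw [inv_le_iff_one_le_mul₀ (by nlinarith [sq_nonneg (x - 1)])]
  nlinarith [sq_nonneg (x ^ 2)]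

/-- One step of mirror descent with the weighted entropy: the loss relative to the vertex `i` is
paid for by the decrease of the divergence, up to a second order term. -/
theorem mirrorStep_entropyReg_regret {C : Fin K → ℝ} (hC : ∀ k, 0 < C k) {η : ℝ} (hη : 0 < η)
    {p : EuclideanSpace ℝ (Fin K)} (hp : p ∈ posOrthant K) (hps : p ∈ simplex K)
    {g : EuclideanSpace ℝ (Fin K)} (hg : ∀ k, 0 ≤ g k) (i : Fin K) :
    ∑ k, p k * g k - g i ≤ vertexDiv C η i p
      - vertexDiv C η i (mirrorStep (entropyReg C η) (posOrthant K) (simplex K) p g)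
      + ∑ k, η / (2 * C k) * (p k * g k ^ 2) := by
  obtain ⟨ν, hqs, hq⟩ := mirrorStep_entropyReg hC hη hp hps g
  set q := mirrorStep (entropyReg C η) (posOrthant K) (simplex K) p g
  have hlog : Real.log (q i) = Real.log (p i) + (ν - g i) * η / C i := by
    rw [hq, Real.log_mul (hp i).ne' (Real.exp_pos _).ne', Real.log_exp]
  have hk : ∀ k, p k * g k ≤ C k / η * p k - C k / η * q k + ν * q k
      + η / (2 * C k) * (p k * g k ^ 2) := by
    intro k
    have hCk := hC k
    have hqk : 0 ≤ q k := hqs.1 k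
    -- the step before normalization, bounded below by tangents of the exponential
    have h1 : p k * Real.exp (-(g k * η / C k)) = q k * Real.exp (-(ν * η / C k)) := by
      rw [hq, mul_assoc, ← Real.exp_add]
      ring_nf
    have h2 := exp_neg_le (x := g k * η / C k) (by have := hg k; positivity)
    have h3 := Real.add_one_le_exp (-(ν * η / C k))
    have h4 : q k * (1 - ν * η / C k) ≤ p k * (1 - g k * η / C k + (g k * η / C k) ^ 2 / 2) :=
      calc q k * (1 - ν * η / C k) ≤ q k * Real.exp (-(ν * η / C k)) :=
            mul_le_mul_of_nonneg_left (by linarith) hqk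
        _ = p k * Real.exp (-(g k * η / C k)) := h1.symm
        _ ≤ _ := mul_le_mul_of_nonneg_left h2 (hp k).le
    have h5 := mul_le_mul_of_nonneg_left h4 (div_pos hCk hη).le
    have h6 : C k / η * (q k * (1 - ν * η / C k)) = C k / η * q k - ν * q k := by
      field_simp
    have h7 : C k / η * (p k * (1 - g k * η / C k + (g k * η / C k) ^ 2 / 2))
        = C k / η * p k - p k * g k + η / (2 * C k) * (p k * g k ^ 2) := by
      field_simp
    linarith
  have hsum := Finset.sum_le_sum fun k (_ : k ∈ Finset.univ) => hk k
  rw [Finset.sum_add_distrib, Finset.sum_add_distrib, Finset.sum_sub_distrib, ← Finset.mul_sum,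
    hqs.2] at hsum
  have h8 : C i / η * (Real.log (p i) + (ν - g i) * η / C i) = C i / η * Real.log (p i)
      + (ν - g i) := by
    have := hC i
    field_simp
  rw [vertexDiv, vertexDiv, hlog]
  linarith

end EntropyStep

section EuclideanStep

variable {d : ℕ}

theorem gradient_euclReg (l : ℝ) (w : EuclideanSpace ℝ (Fin d)) :
    gradient (euclReg l) w = l⁻¹ • w := by
  apply HasGradientAt.gradient
  rw [hasGradientAt_iff_hasFDerivAt]
  have h := ((hasStrictFDerivAt_norm_sq w).hasFDerivAt).const_mul (1 / (2 * l))
  refine h.congr_fderiv ?_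
  ext v
  simp only [smul_apply, innerSL_apply_apply, InnerProductSpace.toDual_apply_apply,
    inner_smul_left, smul_eq_mul, nsmul_eq_mul]
  simp
  ring

theorem bregman_euclReg (l : ℝ) (z w : EuclideanSpace ℝ (Fin d)) :
    bregman (euclReg l) z w = 1 / (2 * l) * ‖z - w‖ ^ 2 := by
  rw [bregman, gradient_euclReg, euclReg, euclReg, inner_smul_left, inner_sub_right,
    real_inner_self_eq_norm_sq, norm_sub_sq_real, real_inner_comm]
  simp
  ring

/-- One step of mirror descent with the Euclidean regularizer moves the iterate into the ball and,
being a projected gradient step, obeys the usual inequality with respect to any point of it. -/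
theorem mirrorStep_euclReg {l : ℝ} (hl : 0 < l) {U : ℝ} (hU : 0 ≤ U)
    (w g : EuclideanSpace ℝ (Fin d)) :
    mirrorStep (euclReg l) Set.univ (Metric.closedBall 0 U) w g ∈ Metric.closedBall 0 U ∧
      ∀ u ∈ Metric.closedBall (0 : EuclideanSpace ℝ (Fin d)) U,
        ‖mirrorStep (euclReg l) Set.univ (Metric.closedBall 0 U) w g - u‖ ^ 2
          ≤ ‖w - u‖ ^ 2 - 2 * l * inner ℝ g (w - u) + l ^ 2 * ‖g‖ ^ 2 := by
  have hex : ∃ z, IsMirrorStep (euclReg l) Set.univ (Metric.closedBall 0 U) w g z := by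
    obtain ⟨z, hz, hmin⟩ := (isCompact_closedBall (0 : EuclideanSpace ℝ (Fin d)) U).exists_isMinOn
      ⟨0, by simpa using hU⟩
      (f := fun z => bregman (euclReg l) z (w - l • g)) (by
        simp only [bregman_euclReg]
        fun_prop)
    refine ⟨z, w - l • g, trivial, ?_, hz, hmin⟩
    rw [gradient_euclReg, gradient_euclReg, smul_sub, inv_smul_smul₀ hl.ne']
  obtain ⟨ubar, -, hgrad, hs, hmin⟩ := Classical.epsilon_spec hex
  change mirrorStep (euclReg l) Set.univ (Metric.closedBall 0 U) w g ∈ Metric.closedBall 0 U at hs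
  set z := mirrorStep (euclReg l) Set.univ (Metric.closedBall 0 U) w g with hz
  have hmin' : ∀ x ∈ Metric.closedBall (0 : EuclideanSpace ℝ (Fin d)) U,
      ‖ubar - z‖ ≤ ‖ubar - x‖ := by
    intro x hx
    have h1 : bregman (euclReg l) z ubar ≤ bregman (euclReg l) x ubar := hmin hx
    rw [bregman_euclReg, bregman_euclReg] at h1
    have h2 := le_of_mul_le_mul_left h1 (by positivity)
    rw [norm_sub_rev, norm_sub_rev ubar x]
    exact le_of_sq_le_sq h2 (norm_nonneg _)
  have hubar : ubar = w - l • g := by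
    rw [gradient_euclReg, gradient_euclReg] at hgrad
    have := congrArg (fun v => l • v) hgrad
    simpa [smul_sub, smul_inv_smul₀ hl.ne'] using this
  refine ⟨hs, fun u hu => ?_⟩
  have hproj : inner ℝ (ubar - z) (u - z) ≤ 0 := by
    refine (norm_eq_iInf_iff_real_inner_le_zero (convex_closedBall _ _) hs).mp ?_ u hu
    have : Nonempty (Metric.closedBall (0 : EuclideanSpace ℝ (Fin d)) U) := ⟨⟨z, hs⟩⟩
    refine le_antisymm (le_ciInf fun x => hmin' x x.2) ?_
    exact ciInf_le (f := fun x : Metric.closedBall (0 : EuclideanSpace ℝ (Fin d)) U => ‖ubar - x‖)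
      ⟨0, by rintro _ ⟨x, rfl⟩; exact norm_nonneg _⟩ ⟨z, hs⟩
  have h1 : ‖ubar - u‖ ^ 2 = ‖ubar - z‖ ^ 2 - 2 * inner ℝ (ubar - z) (u - z) + ‖z - u‖ ^ 2 := by
    have : ubar - u = (ubar - z) - (u - z) := by abel
    rw [this, norm_sub_sq_real, norm_sub_rev u z]
  have h2 : ‖ubar - u‖ ^ 2 = ‖w - u‖ ^ 2 - 2 * l * inner ℝ g (w - u) + l ^ 2 * ‖g‖ ^ 2 := by
    have : ubar - u = (w - u) - l • g := by rw [hubar]; abel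
    rw [this, norm_sub_sq_real, inner_smul_right, norm_smul, Real.norm_of_nonneg hl.le,
      real_inner_comm]
    ring
  nlinarith [sq_nonneg ‖ubar - z‖]

end EuclideanStep

/-! ### States of the algorithm -/

section States

variable {K M J T : ℕ} {P : Problem K M} {C G : Fin K → ℝ}

/-- The standing assumptions on the parameters of the algorithm. -/
structure ValidParams (P : Problem K M) (J T : ℕ) (C G : Fin K → ℝ) : Prop where
  two_le : 2 ≤ J
  le_K : J ≤ K
  le_T : K ≤ T
  U_pos : ∀ i, 0 < P.U i
  C_pos : ∀ i, 0 < C i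
  G_pos : ∀ i, 0 < G i

/-- Integral of a function against the initial distribution. -/
theorem sum_initDist_mul (f : Fin K → ℝ) :
    ∑ i, initDist T C i * f i
      = (1 - √(K : ℝ) / √(T : ℝ)) * ((∑ i ∈ argminSet C, f i) / (argminSet C).card)
        + (∑ i, f i) / √((K : ℝ) * T) := by
  classical
  have h : ∀ i, initDist T C i * f i
      = (if i ∈ argminSet C then (1 - √(K : ℝ) / √(T : ℝ)) / ((argminSet C).card : ℝ) * f i else 0)
        + f i / √((K : ℝ) * T) := by
    intro i
    simp only [initDist]
    split_ifs <;> ring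
  rw [Finset.sum_congr rfl fun i _ => h i, Finset.sum_add_distrib, ← Finset.sum_filter,
    Finset.filter_mem_eq_inter, Finset.univ_inter, ← Finset.mul_sum, ← Finset.sum_div]
  ring

namespace ValidParams

variable (hv : ValidParams P J T C G)
include hv

theorem two_le_K : 2 ≤ K := hv.two_le.trans hv.le_K

theorem K_pos : (0 : ℝ) < K := by exact_mod_cast (show 0 < K by have := hv.two_le_K; omega)

theorem T_pos : (0 : ℝ) < T := by
  exact_mod_cast (show 0 < T by have := hv.two_le_K; have := hv.le_T; omega)

theorem g_nonneg : 0 ≤ gKJ K J := gKJ_nonneg hv.two_le hv.le_K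

theorem four_le : (4 : ℝ) ≤ K * T := by
  have h1 : (2 : ℝ) ≤ K := by exact_mod_cast hv.two_le_K
  have h2 : (2 : ℝ) ≤ T := by exact_mod_cast hv.two_le_K.trans hv.le_T
  nlinarith

theorem one_le_log : 1 ≤ Real.log (K * T) := by
  rw [Real.le_log_iff_exp_le (by linarith [hv.four_le])]
  linarith [Real.exp_one_lt_d9, hv.four_le]

theorem eta_pos : 0 < eta K J T := by
  have hT := hv.T_pos
  have hg := hv.g_nonneg
  have hL := hv.one_le_log
  have h1 : 0 < √(Real.log (K * T)) / (2 * √((1 + gKJ K J) * T)) := by positivity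
  have h2 : (2 : ℝ) ≤ J := by exact_mod_cast hv.two_le
  rw [eta]
  split_ifs with h
  · exact h1
  · have h3 : (J : ℝ) < K := by exact_mod_cast lt_of_le_of_ne hv.le_K h
    exact lt_min h1 (div_pos (by linarith) (by linarith))

theorem lam_pos (i : Fin K) (t : ℕ) : 0 < lam K J (P.U i) (G i) (t + 1) := by
  have hg := hv.g_nonneg
  have hU := hv.U_pos i
  have hG := hv.G_pos i
  have : (0 : ℝ) < max (gKJ K J ^ 2) ((t + 1 : ℕ) : ℝ) := lt_max_of_lt_right (by positivity)
  rw [lam]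
  positivity

theorem argminSet_nonempty : (argminSet C).Nonempty := by
  have : Nonempty (Fin K) := ⟨⟨0, by have := hv.two_le_K; omega⟩⟩
  obtain ⟨i, hi⟩ := Finite.exists_min C
  exact ⟨i, by simp [argminSet, hi]⟩

theorem sqrt_div_le_one : √(K : ℝ) / √(T : ℝ) ≤ 1 := by
  rw [div_le_one (Real.sqrt_pos.mpr hv.T_pos)]
  exact Real.sqrt_le_sqrt (by exact_mod_cast hv.le_T)

theorem initDist_ge (i : Fin K) : 1 / √((K : ℝ) * T) ≤ initDist T C i := by
  have h := hv.sqrt_div_le_one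
  simp only [initDist]
  split_ifs
  · exact le_add_of_nonneg_left (div_nonneg (by linarith) (Nat.cast_nonneg _))
  · exact le_rfl

theorem initDist_pos (i : Fin K) : 0 < initDist T C i :=
  lt_of_lt_of_le (one_div_pos.mpr (Real.sqrt_pos.mpr (by linarith [hv.four_le])))
    (hv.initDist_ge i)

theorem initDist_mem_simplex : initDist T C ∈ simplex K := by
  refine ⟨fun i => (hv.initDist_pos i).le, ?_⟩
  have h := sum_initDist_mul (K := K) (C := C) (T := T) (fun _ => 1)
  have hc : ((argminSet C).card : ℝ) ≠ 0 := by
    exact_mod_cast hv.argminSet_nonempty.card_pos.ne'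
  have hT := Real.sqrt_pos.mpr hv.T_pos
  have hK := Real.sqrt_pos.mpr hv.K_pos
  simp only [mul_one, Finset.sum_const, nsmul_eq_mul, Finset.card_univ, Fintype.card_fin] at h
  rw [h, div_self hc, Real.sqrt_mul hv.K_pos.le]
  have h2 : (K : ℝ) / (√(K : ℝ) * √(T : ℝ)) = √(K : ℝ) / √(T : ℝ) := by
    rw [div_eq_div_iff (by positivity) (by positivity)]
    nlinarith [Real.mul_self_sqrt hv.K_pos.le]
  rw [h2]
  ring

end ValidParams

variable [NeZero J]

theorem lossEst_apply (j : Fin M) (t : ℕ) (s : State P) (a : Fin J → Fin K) (i : Fin K) :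
    lossEst P j t s a i = obsWeight s.p i a * hypLoss P j t i (s.w i) := by
  simp only [lossEst, obsWeight]
  split_ifs
  · rw [div_eq_inv_mul]
  · rw [zero_mul]

theorem gradEst_eq (j : Fin M) (t : ℕ) (s : State P) (a : Fin J → Fin K) (i : Fin K) :
    gradEst P j t s a i = obsWeight s.p i a • hypGrad P j t i (s.w i) := by
  simp only [gradEst, obsWeight]
  split_ifs
  · rfl
  · rw [zero_smul]

namespace ValidParams

variable (hv : ValidParams P J T C G)
include hv

/-- The sampling distributions have full support, whatever the draws were. -/
theorem state_p_mem (j : Fin M) (h : ℕ → Fin J → Fin K) (t : ℕ) :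
    (state P J T C G j h t).p ∈ posOrthant K ∧ (state P J T C G j h t).p ∈ simplex K := by
  induction t with
  | zero => exact ⟨hv.initDist_pos, hv.initDist_mem_simplex⟩
  | succ t ih =>
    obtain ⟨ν, h1, h2⟩ := mirrorStep_entropyReg hv.C_pos hv.eta_pos ih.1 ih.2
      (lossEst P j t (state P J T C G j h t) (h t))
    refine ⟨fun k => ?_, h1⟩
    change 0 < (mirrorStep (entropyReg C (eta K J T)) (posOrthant K) (simplex K)
      (state P J T C G j h t).p (lossEst P j t (state P J T C G j h t) (h t))) k
    rw [h2 k]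
    exact mul_pos (ih.1 k) (Real.exp_pos _)

theorem state_w_mem (j : Fin M) (h : ℕ → Fin J → Fin K) (t : ℕ) (i : Fin K) :
    (state P J T C G j h t).w i ∈ Metric.closedBall 0 (P.U i) := by
  cases t with
  | zero => simpa [state] using (hv.U_pos i).le
  | succ t => exact (mirrorStep_euclReg (hv.lam_pos i t) (hv.U_pos i).le _ _).1

/-- The inequality of a projected gradient step for the hypothesis parameters. -/
theorem state_w_step (j : Fin M) (h : ℕ → Fin J → Fin K) (t : ℕ) (i : Fin K)
    {u : EuclideanSpace ℝ (Fin (P.dim i))} (hu : u ∈ Metric.closedBall 0 (P.U i)) :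
    ‖(state P J T C G j h (t + 1)).w i - u‖ ^ 2 ≤ ‖(state P J T C G j h t).w i - u‖ ^ 2
      - 2 * lam K J (P.U i) (G i) (t + 1) * (obsWeight (state P J T C G j h t).p i (h t)
        * inner ℝ (hypGrad P j t i ((state P J T C G j h t).w i))
          ((state P J T C G j h t).w i - u))
      + lam K J (P.U i) (G i) (t + 1) ^ 2 * (obsWeight (state P J T C G j h t).p i (h t) ^ 2
        * ‖hypGrad P j t i ((state P J T C G j h t).w i)‖ ^ 2) := by
  have := (mirrorStep_euclReg (hv.lam_pos i t) (hv.U_pos i).le ((state P J T C G j h t).w i)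
    (gradEst P j t (state P J T C G j h t) (h t) i)).2 u hu
  rw [gradEst_eq, inner_smul_left, norm_smul, mul_pow, Real.norm_eq_abs, sq_abs] at this
  rw [← gradEst_eq] at this
  exact this

end ValidParams

theorem state_congr (j : Fin M) {h h' : ℕ → Fin J → Fin K} {t : ℕ} (hh : ∀ τ < t, h τ = h' τ) :
    state P J T C G j h t = state P J T C G j h' t := by
  induction t with
  | zero => rfl
  | succ t ih =>
    have h1 := ih fun τ hτ => hh τ (hτ.trans (Nat.lt_succ_self t))
    simp only [state]
    rw [h1, hh t (Nat.lt_succ_self t)]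

end States

/-! ### The law of the draws -/

section Law

variable {K M J T : ℕ} {Ω : Type*} {A : ℕ → Fin M → Ω → Fin J → Fin K}

/-- A function of the whole sequence of draws that depends on the first `t` draws only. -/
def IsPrefix {α β : Type*} (t : ℕ) (F : (ℕ → α) → β) : Prop :=
  ∀ h h' : ℕ → α, (∀ τ < t, h τ = h' τ) → F h = F h'

/-- The successive draws of client `j`. -/
def draws (A : ℕ → Fin M → Ω → Fin J → Fin K) (j : Fin M) (ω : Ω) : ℕ → Fin J → Fin K :=
  fun τ => A τ j ω

theorem IsPrefix.stronglyMeasurable {t : ℕ} {F : (ℕ → Fin J → Fin K) → ℝ} (hF : IsPrefix t F)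
    (j : Fin M) : StronglyMeasurable[past A t] fun ω => F (draws A j ω) := by
  classical
  rcases isEmpty_or_nonempty Ω with hΩ | ⟨⟨ω₀⟩⟩
  · have : (fun ω => F (draws A j ω)) = fun _ => (0 : ℝ) := funext fun ω => (hΩ.false ω).elim
    rw [this]
    exact stronglyMeasurable_const
  · let r : Ω → (Fin t → Fin J → Fin K) := fun ω τ => A τ j ω
    let F' : (Fin t → Fin J → Fin K) → ℝ := fun x =>
      F fun τ => if hτ : τ < t then x ⟨τ, hτ⟩ else A τ j ω₀
    have hr : Measurable[past A t] r := by
      refine @measurable_pi_lambda _ _ _ (past A t) _ _ fun τ => ?_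
      refine Measurable.mono (comap_measurable (A τ j)) ?_ le_rfl
      exact le_trans (le_iSup (fun j => MeasurableSpace.comap (A τ j) inferInstance) j)
        (le_iSup₂ (f := fun (τ : ℕ) (_ : τ < t) =>
          ⨆ j : Fin M, MeasurableSpace.comap (A τ j) inferInstance) τ.1 τ.2)
    have hF' : Measurable F' := measurable_of_finite _
    have heq : (fun ω => F (draws A j ω)) = F' ∘ r := by
      funext ω
      refine hF _ _ fun τ hτ => ?_
      simp [draws, hτ, r]
    rw [heq]
    exact (hF'.comp hr).stronglyMeasurable

theorem IsPrefix.exists_bound {t : ℕ} {F : (ℕ → Fin J → Fin K) → ℝ} (hF : IsPrefix t F)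
    (j : Fin M) : ∃ B, ∀ ω, ‖F (draws A j ω)‖ ≤ B := by
  classical
  rcases isEmpty_or_nonempty Ω with hΩ | ⟨⟨ω₀⟩⟩
  · exact ⟨0, fun ω => (hΩ.false ω).elim⟩
  · let F' : (Fin t → Fin J → Fin K) → ℝ := fun x =>
      F fun τ => if hτ : τ < t then x ⟨τ, hτ⟩ else A τ j ω₀
    refine ⟨∑ x, ‖F' x‖, fun ω => ?_⟩
    have heq : F (draws A j ω) = F' fun τ => A τ j ω := by
      refine hF _ _ fun τ hτ => ?_
      simp [draws, hτ]
    rw [heq]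
    exact Finset.single_le_sum (f := fun x : Fin t → Fin J → Fin K => ‖F' x‖)
      (fun x _ => norm_nonneg _) (Finset.mem_univ fun τ : Fin t => A τ j ω)

variable [NeZero J] {P : Problem K M} {C G : Fin K → ℝ}

theorem run_eq (j : Fin M) (t : ℕ) (ω : Ω) :
    run P J T C G A j t ω = state P J T C G j (draws A j ω) t := rfl

variable [mΩ : MeasurableSpace Ω] {μ : Measure Ω}

theorem past_le (hA : IsSampling μ P J T C G A) (t : ℕ) : past A t ≤ mΩ :=
  iSup₂_le fun τ _ => iSup_le fun j => (hA.measurable τ j).comap_le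

variable [IsProbabilityMeasure μ]

theorem IsPrefix.integrable (hA : IsSampling μ P J T C G A) {t : ℕ}
    {F : (ℕ → Fin J → Fin K) → ℝ} (hF : IsPrefix t F) (j : Fin M) :
    Integrable (fun ω => F (draws A j ω)) μ := by
  obtain ⟨B, hB⟩ := hF.exists_bound (A := A) j
  exact Integrable.of_bound
    ((hF.stronglyMeasurable j).mono (past_le hA t)).aestronglyMeasurable B
    (Filter.Eventually.of_forall hB)

/-- Conditionally on the past, the draw of client `j` follows the distribution of its state. -/
theorem condExp_draw (hv : ValidParams P J T C G) (hA : IsSampling μ P J T C G A) {t : ℕ}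
    (ht : t < T) (j : Fin M) (a : Fin J → Fin K) :
    μ[Set.indicator {ω | A t j ω = a} (fun _ => (1 : ℝ)) | past A t] =ᵐ[μ]
      fun ω => sampleProb (state P J T C G j (draws A j ω) t).p a := by
  classical
  let S : Finset (Fin M → Fin J → Fin K) :=
    Fintype.piFinset fun j' => if j' = j then {a} else Finset.univ
  have hS : ∀ b, b ∈ S ↔ b j = a := by
    intro b
    simp only [S, Fintype.mem_piFinset]
    refine ⟨fun h => by simpa using h j, fun h j' => ?_⟩
    split_ifs with h'
    · rw [h', h]; simp
    · simp
  have h1 : Set.indicator {ω | A t j ω = a} (fun _ => (1 : ℝ))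
      = ∑ b ∈ S, Set.indicator {ω | ∀ j, A t j ω = b j} (fun _ => (1 : ℝ)) := by
    funext ω
    rw [Finset.sum_apply]
    simp only [Set.indicator_apply, Set.mem_ofPred_eq]
    have : ∀ b : Fin M → Fin J → Fin K, (∀ j, A t j ω = b j) ↔ (fun j => A t j ω) = b :=
      fun b => funext_iff.symm
    simp only [this, Finset.sum_ite_eq, hS]
  have hmeas : ∀ b : Fin M → Fin J → Fin K, MeasurableSet {ω | ∀ j, A t j ω = b j} := by
    intro b
    have : {ω | ∀ j, A t j ω = b j} = ⋂ j, (A t j) ⁻¹' {b j} := by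
      ext ω; simp
    rw [this]
    exact MeasurableSet.iInter fun j => hA.measurable t j (measurableSet_singleton _)
  rw [h1]
  refine (condExp_finsetSum (fun b _ => (integrable_const _).indicator (hmeas b)) _).trans ?_
  have h2 : ∀ᵐ ω ∂μ, ∀ b : Fin M → Fin J → Fin K,
      (μ[Set.indicator {ω | ∀ j, A t j ω = b j} (fun _ => (1 : ℝ)) | past A t]) ω
        = ∏ j, sampleProb (run P J T C G A j t ω).p (b j) :=
    ae_all_iff.mpr fun b => hA.law t ht b
  filter_upwards [h2] with ω hω
  rw [Finset.sum_apply, Finset.sum_congr rfl fun b _ => hω b, ← Finset.prod_univ_sum,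
    ← Finset.mul_prod_erase _ _ (Finset.mem_univ j), Finset.prod_eq_one]
  · simp [run_eq]
  · intro j' hj'
    rw [if_neg (Finset.ne_of_mem_erase hj')]
    exact sum_sampleProb hv.le_K (hv.state_p_mem _ _ _).2

/-- Expectation of a function of the first `t` draws of client `j` and of its next draw. -/
theorem integral_draw (hv : ValidParams P J T C G) (hA : IsSampling μ P J T C G A) {t : ℕ}
    (ht : t < T) (j : Fin M) (F : (ℕ → Fin J → Fin K) → (Fin J → Fin K) → ℝ) (hF : IsPrefix t F) :
    ∫ ω, F (draws A j ω) (A t j ω) ∂μ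
      = ∫ ω, ∑ a, sampleProb (state P J T C G j (draws A j ω) t).p a * F (draws A j ω) a ∂μ := by
  classical
  have hFa : ∀ a, IsPrefix t fun h : ℕ → Fin J → Fin K => F h a := fun a h h' hh => by
    simp only [hF h h' hh]
  have hind : ∀ a, Integrable (Set.indicator {ω | A t j ω = a} (fun _ => (1 : ℝ))) μ := fun a =>
    (integrable_const _).indicator (hA.measurable t j (measurableSet_singleton a))
  have hprod : ∀ a, Integrable
      ((fun ω => F (draws A j ω) a) * Set.indicator {ω | A t j ω = a} (fun _ => (1 : ℝ))) μ := by
    intro a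
    obtain ⟨B, hB⟩ := (hFa a).exists_bound (A := A) j
    exact (hind a).bdd_mul ((hFa a).integrable hA j).aestronglyMeasurable
      (Filter.Eventually.of_forall hB)
  have h1 : ∀ ω, F (draws A j ω) (A t j ω) = ∑ a, ((fun ω => F (draws A j ω) a)
      * Set.indicator {ω | A t j ω = a} (fun _ => (1 : ℝ))) ω := by
    intro ω
    simp only [Pi.mul_apply, Set.indicator_apply, Set.mem_ofPred_eq, mul_ite, mul_one, mul_zero,
      Finset.sum_ite_eq, Finset.mem_univ, if_true]
  have hpre : ∀ a, IsPrefix t fun h : ℕ → Fin J → Fin K =>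
      sampleProb (state P J T C G j h t).p a * F h a := fun a h h' hh => by
    simp only [hF h h' hh, state_congr j hh]
  rw [integral_congr_ae (Filter.Eventually.of_forall h1), integral_finsetSum _ fun a _ => hprod a,
    integral_finsetSum _ fun a _ => (hpre a).integrable hA j]
  refine Finset.sum_congr rfl fun a _ => ?_
  rw [← integral_condExp (past_le hA t)]
  refine integral_congr_ae ?_
  refine (condExp_mul_of_stronglyMeasurable_left ((hFa a).stronglyMeasurable j) (hprod a)
    (hind a)).trans ?_
  filter_upwards [condExp_draw hv hA ht j a] with ω hω
  rw [Pi.mul_apply, hω, mul_comm]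

/-- Every sequence of draws whose steps have positive probability does occur. -/
theorem exists_draws_eq (hv : ValidParams P J T C G) (hA : IsSampling μ P J T C G A) (j : Fin M)
    (h : ℕ → Fin J → Fin K) (hh : ∀ t < T, 0 < sampleProb (state P J T C G j h t).p (h t)) :
    ∃ ω, ∀ t < T, A t j ω = h t := by
  classical
  let I : ℕ → (ℕ → Fin J → Fin K) → ℝ := fun n h' => if ∀ t < n, h' t = h t then 1 else 0
  have hI : ∀ n, IsPrefix n (I n) := by
    intro n h₁ h₂ h12
    have : (∀ t < n, h₁ t = h t) ↔ ∀ t < n, h₂ t = h t :=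
      forall₂_congr fun t ht => by rw [h12 t ht]
    simp only [I, this]
  have key : ∀ n ≤ T, 0 < ∫ ω, I n (draws A j ω) ∂μ := by
    intro n
    induction n with
    | zero => intro _; simp [I]
    | succ n ih =>
      intro hn
      have h1 : ∀ ω, I (n + 1) (draws A j ω)
          = I n (draws A j ω) * (if draws A j ω n = h n then 1 else 0) := by
        intro ω
        by_cases h3 : draws A j ω n = h n
        · by_cases h4 : ∀ t < n, draws A j ω t = h t
          · have h5 : ∀ t < n + 1, draws A j ω t = h t := fun t ht => by
              rcases Nat.lt_succ_iff_lt_or_eq.mp ht with h' | rfl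
              exacts [h4 t h', h3]
            simp only [I]
            rw [if_pos h5, if_pos h4, if_pos h3, mul_one]
          · simp only [I]
            rw [if_neg h4, if_neg fun h' => h4 fun t ht => h' t (ht.trans n.lt_succ_self), zero_mul]
        · simp only [I]
          rw [if_neg h3, if_neg fun h' => h3 (h' n n.lt_succ_self), mul_zero]
      have h2 := integral_draw hv hA (Nat.lt_of_succ_le hn) j
        (fun h' a => I n h' * (if a = h n then 1 else 0)) (fun h₁ h₂ h12 => by
          simp only [hI n h₁ h₂ h12])
      have h12 := (integral_congr_ae (μ := μ) (Filter.Eventually.of_forall h1)).trans h2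
      rw [h12]
      have h3 : ∀ ω, ∑ a, sampleProb (state P J T C G j (draws A j ω) n).p a
          * (I n (draws A j ω) * (if a = h n then 1 else 0))
          = sampleProb (state P J T C G j h n).p (h n) * I n (draws A j ω) := by
        intro ω
        simp only [mul_ite, mul_one, mul_zero, Finset.sum_ite_eq', Finset.mem_univ, if_true]
        by_cases h4 : ∀ t < n, draws A j ω t = h t
        · rw [state_congr j h4]
        · simp [I, h4]
      rw [integral_congr_ae (Filter.Eventually.of_forall h3), integral_const_mul]
      exact mul_pos (hh n (Nat.lt_of_succ_le hn)) (ih (Nat.le_of_succ_le hn))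
  by_contra hne
  have h0 : ∀ ω, I T (draws A j ω) = 0 := fun ω => if_neg fun h' => hne ⟨ω, h'⟩
  have := key T le_rfl
  simp [h0] at this

end Law

/-! ### A concentration inequality -/

section Tail

variable {K M J T : ℕ} [NeZero J] {P : Problem K M} {C G : Fin K → ℝ}
  {Ω : Type*} [mΩ : MeasurableSpace Ω] {μ : Measure Ω} [IsProbabilityMeasure μ]
  {A : ℕ → Fin M → Ω → Fin J → Fin K}

theorem exp_le_one_add_add_sq {x : ℝ} (hx : x ≤ 1) : Real.exp x ≤ 1 + x + x ^ 2 := by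
  rcases le_or_gt (-1) x with h | h
  · have := Real.abs_exp_sub_one_sub_id_le (abs_le.mpr ⟨h, hx⟩)
    linarith [(abs_le.mp this).2]
  · have : Real.exp x ≤ 1 := Real.exp_le_one_iff.mpr (by linarith)
    nlinarith

/-- A Bernstein type bound for the moment generating function. -/
theorem sum_mul_exp_le {α : Type*} [Fintype α] {q X : α → ℝ} (hq : ∀ a, 0 ≤ q a)
    (hq1 : ∑ a, q a = 1) (hX : ∀ a, X a ≤ 1) :
    ∑ a, q a * Real.exp (X a) ≤ Real.exp (∑ a, q a * (X a + X a ^ 2)) :=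
  calc ∑ a, q a * Real.exp (X a) ≤ ∑ a, (q a + q a * (X a + X a ^ 2)) :=
        Finset.sum_le_sum fun a _ => by
          have := mul_le_mul_of_nonneg_left (exp_le_one_add_add_sq (hX a)) (hq a)
          linarith
    _ = (∑ a, q a * (X a + X a ^ 2)) + 1 := by rw [Finset.sum_add_distrib, hq1, add_comm]
    _ ≤ _ := Real.add_one_le_exp _

/-- Sums of terms `X_t ≤ 1` that depend on the draws of client `j` up to round `t` exceed the sum of
the conditional expectations of `X_t + X_t²` by `ln (1/ε)` with probability at most `ε`: the
exponential of the difference is a supermartingale. -/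
theorem tail_bound (hv : ValidParams P J T C G) (hA : IsSampling μ P J T C G A) (j : Fin M)
    (X : ℕ → (ℕ → Fin J → Fin K) → (Fin J → Fin K) → ℝ) (hX : ∀ t, IsPrefix t (X t))
    (hX1 : ∀ ω, ∀ t < T, ∀ a, X t (draws A j ω) a ≤ 1) {ε : ℝ} (hε : 0 < ε) :
    μ.real {ω | ¬ ∑ t ∈ Finset.range T, X t (draws A j ω) (A t j ω)
      ≤ ∑ t ∈ Finset.range T, ∑ a, sampleProb (state P J T C G j (draws A j ω) t).p a
          * (X t (draws A j ω) a + X t (draws A j ω) a ^ 2) + Real.log (1 / ε)} ≤ ε := by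
  let m : ℕ → (ℕ → Fin J → Fin K) → ℝ := fun t h =>
    ∑ a, sampleProb (state P J T C G j h t).p a * (X t h a + X t h a ^ 2)
  let W : ℕ → (ℕ → Fin J → Fin K) → ℝ := fun n h =>
    Real.exp (∑ t ∈ Finset.range n, (X t h (h t) - m t h))
  have hm : ∀ t, IsPrefix t (m t) := fun t h h' hh => by
    simp only [m, hX t h h' hh, state_congr j hh]
  have hW : ∀ n, IsPrefix n (W n) := fun n h h' hh => by
    simp only [W]
    congr 1
    refine Finset.sum_congr rfl fun t ht => ?_
    have htn := Finset.mem_range.mp ht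
    have hht : ∀ τ < t, h τ = h' τ := fun τ hτ => hh τ (hτ.trans htn)
    rw [hX t h h' hht, hm t h h' hht, hh t htn]
  have key : ∀ n ≤ T, ∫ ω, W n (draws A j ω) ∂μ ≤ 1 := by
    intro n
    induction n with
    | zero => intro _; simp [W]
    | succ n ih =>
      intro hn
      refine le_trans ?_ (ih (Nat.le_of_succ_le hn))
      have hnT := Nat.lt_of_succ_le hn
      have hF : IsPrefix n fun (h : ℕ → Fin J → Fin K) a =>
          W n h * Real.exp (X n h a - m n h) := by
        intro h h' hh
        funext a
        simp only
        rw [hX n h h' hh, hm n h h' hh, hW n h h' hh]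
      have h1 : ∀ ω, W (n + 1) (draws A j ω) = W n (draws A j ω)
          * Real.exp (X n (draws A j ω) (A n j ω) - m n (draws A j ω)) := by
        intro ω
        simp only [W]
        rw [Finset.sum_range_succ, Real.exp_add]
        rfl
      rw [integral_congr_ae (Filter.Eventually.of_forall h1), integral_draw hv hA hnT j _ hF]
      have hFm : IsPrefix n fun h : ℕ → Fin J → Fin K =>
          ∑ a, sampleProb (state P J T C G j h n).p a * (W n h * Real.exp (X n h a - m n h)) := by
        intro h h' hh
        simp only [hX n h h' hh, hm n h h' hh, hW n h h' hh, state_congr j hh]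
      refine integral_mono (hFm.integrable hA j) ((hW n).integrable hA j) fun ω => ?_
      set h := draws A j ω with hdef
      have hp := (hv.state_p_mem j h n).2
      have h2 := sum_mul_exp_le (fun a => sampleProb_nonneg hp a) (sum_sampleProb hv.le_K hp)
        (hX1 ω n hnT)
      have h3 : ∑ a, sampleProb (state P J T C G j h n).p a * (W n h * Real.exp (X n h a - m n h))
          = W n h * Real.exp (-m n h)
            * ∑ a, sampleProb (state P J T C G j h n).p a * Real.exp (X n h a) := by
        rw [Finset.mul_sum]
        refine Finset.sum_congr rfl fun a _ => ?_
        rw [sub_eq_add_neg, Real.exp_add]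
        ring
      change ∑ a, sampleProb (state P J T C G j h n).p a * (W n h * Real.exp (X n h a - m n h))
        ≤ W n h
      rw [h3]
      calc W n h * Real.exp (-m n h)
            * ∑ a, sampleProb (state P J T C G j h n).p a * Real.exp (X n h a)
          ≤ W n h * Real.exp (-m n h) * Real.exp (m n h) :=
            mul_le_mul_of_nonneg_left h2
              (mul_nonneg (Real.exp_pos _).le (Real.exp_pos _).le)
        _ = W n h := by rw [mul_assoc, ← Real.exp_add, neg_add_cancel, Real.exp_zero, mul_one]
  have hmarkov := mul_meas_ge_le_integral_of_nonneg
    (Filter.Eventually.of_forall fun ω => (Real.exp_pos _).le)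
    ((hW T).integrable hA j) (1 / ε)
  have hsub : {ω | ¬ ∑ t ∈ Finset.range T, X t (draws A j ω) (A t j ω)
      ≤ ∑ t ∈ Finset.range T, m t (draws A j ω) + Real.log (1 / ε)}
      ⊆ {ω | 1 / ε ≤ W T (draws A j ω)} := by
    intro ω hω
    simp only [Set.mem_ofPred_eq, not_le] at hω ⊢
    rw [← Real.exp_log (one_div_pos.mpr hε)]
    refine Real.exp_le_exp.mpr ?_
    rw [Finset.sum_sub_distrib]
    have : ∑ t ∈ Finset.range T, X t (draws A j ω) (draws A j ω t)
      = ∑ t ∈ Finset.range T, X t (draws A j ω) (A t j ω) := rfl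
    linarith
  have h4 := (measureReal_mono (μ := μ) hsub)
  have h5 : 1 / ε * μ.real {ω | 1 / ε ≤ W T (draws A j ω)} ≤ 1 := hmarkov.trans (key T le_rfl)
  rw [one_div, inv_mul_le_iff₀ hε, mul_one] at h5
  exact h4.trans (by simpa using h5)

end Tail

/-! ### Pathwise inequalities -/

section Pathwise

variable {K M J T : ℕ} [NeZero J] {P : Problem K M} {C G : Fin K → ℝ}

/-- Loss `c_{t,i}` of the `i`-th hypothesis of client `j` when its draws are `h`. -/
noncomputable def cost (P : Problem K M) (J T : ℕ) [NeZero J] (C G : Fin K → ℝ) (j : Fin M)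
    (h : ℕ → Fin J → Fin K) (t : ℕ) (i : Fin K) : ℝ :=
  hypLoss P j t i ((state P J T C G j h t).w i)

/-- The parameters of the `i`-th hypothesis of client `j` when its draws are `h`. -/
noncomputable def param (P : Problem K M) (J T : ℕ) [NeZero J] (C G : Fin K → ℝ) (j : Fin M)
    (h : ℕ → Fin J → Fin K) (t : ℕ) (i : Fin K) : EuclideanSpace ℝ (Fin (P.dim i)) :=
  (state P J T C G j h t).w i

/-- Importance weight of the `i`-th hypothesis of client `j` when its draws are `h`. -/
noncomputable def weight (P : Problem K M) (J T : ℕ) [NeZero J] (C G : Fin K → ℝ) (j : Fin M)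
    (h : ℕ → Fin J → Fin K) (t : ℕ) (i : Fin K) : ℝ :=
  obsWeight (state P J T C G j h t).p i (h t)

/-- Expected loss `⟨p_t, c_t⟩` of the prediction of client `j` when its draws are `h`. -/
noncomputable def meanCost (P : Problem K M) (J T : ℕ) [NeZero J] (C G : Fin K → ℝ) (j : Fin M)
    (h : ℕ → Fin J → Fin K) (t : ℕ) : ℝ :=
  ∑ k, (state P J T C G j h t).p k * cost P J T C G j h t k

/-- Estimate of `meanCost` with importance weighted losses. -/
noncomputable def meanCostEst (P : Problem K M) (J T : ℕ) [NeZero J] (C G : Fin K → ℝ) (j : Fin M)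
    (h : ℕ → Fin J → Fin K) (t : ℕ) : ℝ :=
  ∑ k, (state P J T C G j h t).p k * (weight P J T C G j h t k * cost P J T C G j h t k)

/-- Along the draws `h`, the constants `C` and `G` bound the losses and gradients. -/
def BoundedAlong (P : Problem K M) (J T : ℕ) [NeZero J] (C G : Fin K → ℝ) (j : Fin M)
    (h : ℕ → Fin J → Fin K) : Prop :=
  ∀ t < T, ∀ i, 0 ≤ cost P J T C G j h t i ∧ cost P J T C G j h t i ≤ C i ∧
    ‖hypGrad P j t i (param P J T C G j h t i)‖ ≤ G i

theorem hypLoss_sub_le (hsub : IsSubgradient P.loss P.dloss) (j : Fin M) (t : ℕ) (i : Fin K)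
    (w u : EuclideanSpace ℝ (Fin (P.dim i))) :
    hypLoss P j t i w - hypLoss P j t i u ≤ inner ℝ (hypGrad P j t i w) (w - u) := by
  have := hsub (inner ℝ w (P.φ i (P.x j t))) (inner ℝ u (P.φ i (P.x j t))) (P.y j t)
  rw [hypLoss, hypLoss, hypGrad, inner_smul_left, inner_sub_right, real_inner_comm w,
    real_inner_comm u]
  simp only [conj_trivial]
  linarith

namespace ValidParams

variable (hv : ValidParams P J T C G)
include hv

omit [NeZero J] in
theorem lam_antitone (i : Fin K) {s t : ℕ} (hst : s ≤ t) :
    lam K J (P.U i) (G i) (t + 1) ≤ lam K J (P.U i) (G i) (s + 1) := by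
  have hg := hv.g_nonneg
  have hU := hv.U_pos i
  have hG := hv.G_pos i
  have h1 : (0 : ℝ) < max (gKJ K J ^ 2) ((s + 1 : ℕ) : ℝ) := lt_max_of_lt_right (by positivity)
  have h2 : ((s + 1 : ℕ) : ℝ) ≤ ((t + 1 : ℕ) : ℝ) := by exact_mod_cast Nat.succ_le_succ hst
  rw [lam, lam]
  gcongr

theorem weight_nonneg (j : Fin M) (h : ℕ → Fin J → Fin K) (t : ℕ) (i : Fin K) :
    0 ≤ weight P J T C G j h t i :=
  obsWeight_nonneg hv.two_le hv.le_K (hv.state_p_mem j h t).2 i _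

theorem weight_le (j : Fin M) (h : ℕ → Fin J → Fin K) (t : ℕ) (i : Fin K) :
    weight P J T C G j h t i ≤ 1 + gKJ K J :=
  obsWeight_le hv.two_le hv.le_K (hv.state_p_mem j h t).2 i _

/-- Regret of mirror descent with the weighted entropy on the estimated losses. As the weights are
at most `1 + g`, the second order term is a multiple of the estimated loss itself. -/
theorem sum_meanCostEst_le (j : Fin M) {h : ℕ → Fin J → Fin K}
    (hb : BoundedAlong P J T C G j h) (i : Fin K) :
    ∑ t ∈ Finset.range T, meanCostEst P J T C G j h t
      ≤ ∑ t ∈ Finset.range T, weight P J T C G j h t i * cost P J T C G j h t i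
        + vertexDiv C (eta K J T) i (initDist T C)
        + eta K J T * (1 + gKJ K J) / 2 * ∑ t ∈ Finset.range T, meanCostEst P J T C G j h t := by
  have hη := hv.eta_pos
  have key : ∀ n ≤ T, ∑ t ∈ Finset.range n, meanCostEst P J T C G j h t
      ≤ ∑ t ∈ Finset.range n, weight P J T C G j h t i * cost P J T C G j h t i
        + (vertexDiv C (eta K J T) i (initDist T C)
          - vertexDiv C (eta K J T) i (state P J T C G j h n).p)
        + eta K J T * (1 + gKJ K J) / 2 * ∑ t ∈ Finset.range n, meanCostEst P J T C G j h t := by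
    intro n
    induction n with
    | zero => intro _; simp [state]
    | succ n ih =>
      intro hn
      have h1 := ih (Nat.le_of_succ_le hn)
      have hbn := hb n (Nat.lt_of_succ_le hn)
      have hp := hv.state_p_mem j h n
      have hg : ∀ k, lossEst P j n (state P J T C G j h n) (h n) k
          = weight P J T C G j h n k * cost P J T C G j h n k := fun k => lossEst_apply _ _ _ _ _
      have h2 := mirrorStep_entropyReg_regret hv.C_pos hη hp.1 hp.2
        (g := lossEst P j n (state P J T C G j h n) (h n)) (fun k => by
          rw [hg]; exact mul_nonneg (hv.weight_nonneg j h n k) (hbn k).1) i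
      have h3 : ∑ k, eta K J T / (2 * C k) * ((state P J T C G j h n).p k
          * lossEst P j n (state P J T C G j h n) (h n) k ^ 2)
          ≤ eta K J T * (1 + gKJ K J) / 2 * meanCostEst P J T C G j h n := by
        rw [meanCostEst, Finset.mul_sum]
        refine Finset.sum_le_sum fun k _ => ?_
        have hCk := hv.C_pos k
        rw [hg]
        have hc := hbn k
        have hw0 := hv.weight_nonneg j h n k
        have hw := hv.weight_le j h n k
        have h4 : weight P J T C G j h n k * cost P J T C G j h n k ≤ (1 + gKJ K J) * C k :=
          mul_le_mul hw hc.2.1 hc.1 (hw0.trans hw)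
        have h5 : 0 ≤ eta K J T / (2 * C k) * ((state P J T C G j h n).p k
            * (weight P J T C G j h n k * cost P J T C G j h n k)) :=
          mul_nonneg (by positivity) (mul_nonneg (hp.1 k).le (mul_nonneg hw0 hc.1))
        calc eta K J T / (2 * C k) * ((state P J T C G j h n).p k
              * (weight P J T C G j h n k * cost P J T C G j h n k) ^ 2)
            = eta K J T / (2 * C k) * ((state P J T C G j h n).p k
              * (weight P J T C G j h n k * cost P J T C G j h n k))
              * (weight P J T C G j h n k * cost P J T C G j h n k) := by ring
          _ ≤ eta K J T / (2 * C k) * ((state P J T C G j h n).p k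
              * (weight P J T C G j h n k * cost P J T C G j h n k))
              * ((1 + gKJ K J) * C k) := mul_le_mul_of_nonneg_left h4 h5
          _ = _ := by field_simp
      have h6 : ∑ k, (state P J T C G j h n).p k
          * lossEst P j n (state P J T C G j h n) (h n) k = meanCostEst P J T C G j h n := by
        rw [meanCostEst]
        exact Finset.sum_congr rfl fun k _ => by rw [hg]
      rw [h6, hg] at h2
      rw [Finset.sum_range_succ, Finset.sum_range_succ, mul_add]
      have h7 : (state P J T C G j h (n + 1)).p = mirrorStep (entropyReg C (eta K J T))
        (posOrthant K) (simplex K) (state P J T C G j h n).p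
        (lossEst P j n (state P J T C G j h n) (h n)) := rfl
      rw [h7]
      linarith
  have h1 := key T le_rfl
  have h2 := vertexDiv_nonneg hv.C_pos hη i (hv.state_p_mem j h T).1
  linarith

theorem norm_param_le (j : Fin M) (h : ℕ → Fin J → Fin K) (t : ℕ) (i : Fin K) :
    ‖param P J T C G j h t i‖ ≤ P.U i := by
  simpa [param] using hv.state_w_mem j h t i

theorem param_step (j : Fin M) {h : ℕ → Fin J → Fin K} (hb : BoundedAlong P J T C G j h) {t : ℕ}
    (ht : t < T) (i : Fin K) {u : EuclideanSpace ℝ (Fin (P.dim i))} (hu : ‖u‖ ≤ P.U i) :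
    ‖param P J T C G j h (t + 1) i - u‖ ^ 2 ≤ ‖param P J T C G j h t i - u‖ ^ 2
      - 2 * lam K J (P.U i) (G i) (t + 1) * (weight P J T C G j h t i
        * inner ℝ (hypGrad P j t i (param P J T C G j h t i)) (param P J T C G j h t i - u))
      + (lam K J (P.U i) (G i) (t + 1) * weight P J T C G j h t i * G i) ^ 2 := by
  have h1 := hv.state_w_step j h t i (u := u) (by simpa using hu)
  have h2 : ‖hypGrad P j t i (param P J T C G j h t i)‖ ^ 2 ≤ G i ^ 2 :=
    pow_le_pow_left₀ (norm_nonneg _) (hb t ht i).2.2 2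
  have h3 : lam K J (P.U i) (G i) (t + 1) ^ 2 * (weight P J T C G j h t i ^ 2
        * ‖hypGrad P j t i (param P J T C G j h t i)‖ ^ 2)
      ≤ (lam K J (P.U i) (G i) (t + 1) * weight P J T C G j h t i * G i) ^ 2 := by
    rw [mul_pow, mul_pow, mul_assoc]
    gcongr
  exact h1.trans (by simp only [param, weight] at h3 ⊢; linarith)

/-- Regret of the projected gradient steps with respect to a comparator `v_t` that moves: the
movements of the comparator are charged at the final learning rate. -/
theorem sum_weight_inner_le (j : Fin M) {h : ℕ → Fin J → Fin K}
    (hb : BoundedAlong P J T C G j h) (i : Fin K) (v : ℕ → EuclideanSpace ℝ (Fin (P.dim i)))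
    (hvU : ∀ t, ‖v t‖ ≤ P.U i) :
    ∑ t ∈ Finset.range T, weight P J T C G j h t i * inner ℝ
        (hypGrad P j t i (param P J T C G j h t i)) (param P J T C G j h t i - v t)
      ≤ (2 * P.U i ^ 2 + 2 * P.U i * ∑ t ∈ Finset.range T, ‖v (t + 1) - v t‖)
          / lam K J (P.U i) (G i) (T + 1)
        + G i ^ 2 / 2 * ∑ t ∈ Finset.range T,
          lam K J (P.U i) (G i) (t + 1) * weight P J T C G j h t i ^ 2 := by
  have hU := hv.U_pos i
  set r : ℕ → ℝ := fun t => 1 / (2 * lam K J (P.U i) (G i) (t + 1)) with hr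
  have hl := hv.lam_pos i
  have hrpos : ∀ t, 0 < r t := fun t => by have := hl t; positivity
  have hmono : ∀ s t, s ≤ t → r s ≤ r t := fun s t hst => by
    have h1 := hl t
    have h2 := hl s
    have := hv.lam_antitone i hst
    simp only [hr]
    gcongr
  set d : ℕ → ℝ := fun t => ‖param P J T C G j h t i - v t‖ ^ 2 with hd
  have hdle : ∀ t, d t ≤ (2 * P.U i) ^ 2 := fun t => by
    refine pow_le_pow_left₀ (norm_nonneg _) ?_ 2
    linarith [norm_sub_le (param P J T C G j h t i) (v t), hv.norm_param_le j h t i, hvU t]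
  have key : ∀ n ≤ T, ∑ t ∈ Finset.range n, weight P J T C G j h t i * inner ℝ
        (hypGrad P j t i (param P J T C G j h t i)) (param P J T C G j h t i - v t)
      ≤ r n * ((2 * P.U i) ^ 2 - d n)
        + r n * (4 * P.U i * ∑ t ∈ Finset.range n, ‖v (t + 1) - v t‖)
        + G i ^ 2 / 2 * ∑ t ∈ Finset.range n,
          lam K J (P.U i) (G i) (t + 1) * weight P J T C G j h t i ^ 2 := by
    intro n
    induction n with
    | zero =>
      intro _
      have := mul_nonneg (hrpos 0).le (sub_nonneg.mpr (hdle 0))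
      simpa using this
    | succ n ih =>
      intro hn
      have h1 := ih (Nat.le_of_succ_le hn)
      have h2 := hv.param_step j hb (Nat.lt_of_succ_le hn) i (hvU n)
      have h3 := hl n
      -- moving the comparator changes the squared distance by at most `4 U ‖v (n + 1) - v n‖`
      have h4 : d (n + 1) ≤ ‖param P J T C G j h (n + 1) i - v n‖ ^ 2
          + 4 * P.U i * ‖v (n + 1) - v n‖ := by
        have e1 : ‖param P J T C G j h (n + 1) i - v (n + 1)‖
            ≤ ‖param P J T C G j h (n + 1) i - v n‖ + ‖v (n + 1) - v n‖ := by
          have : param P J T C G j h (n + 1) i - v (n + 1)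
            = (param P J T C G j h (n + 1) i - v n) - (v (n + 1) - v n) := by abel
          rw [this]
          exact norm_sub_le _ _
        have e2 : ‖param P J T C G j h (n + 1) i - v (n + 1)‖ ≤ 2 * P.U i := by
          linarith [norm_sub_le (param P J T C G j h (n + 1) i) (v (n + 1)),
            hv.norm_param_le j h (n + 1) i, hvU (n + 1)]
        have e3 : ‖param P J T C G j h (n + 1) i - v n‖ ≤ 2 * P.U i := by
          linarith [norm_sub_le (param P J T C G j h (n + 1) i) (v n),
            hv.norm_param_le j h (n + 1) i, hvU n]
        simp only [hd]
        nlinarith [norm_nonneg (param P J T C G j h (n + 1) i - v (n + 1)),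
          norm_nonneg (param P J T C G j h (n + 1) i - v n), norm_nonneg (v (n + 1) - v n)]
      have h5 : weight P J T C G j h n i * inner ℝ
          (hypGrad P j n i (param P J T C G j h n i)) (param P J T C G j h n i - v n)
          ≤ r n * (d n - d (n + 1)) + r n * (4 * P.U i * ‖v (n + 1) - v n‖)
            + G i ^ 2 / 2 * (lam K J (P.U i) (G i) (n + 1) * weight P J T C G j h n i ^ 2) := by
        have h6 : weight P J T C G j h n i * inner ℝ
            (hypGrad P j n i (param P J T C G j h n i)) (param P J T C G j h n i - v n)
            = r n * (2 * lam K J (P.U i) (G i) (n + 1) * (weight P J T C G j h n i * inner ℝ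
            (hypGrad P j n i (param P J T C G j h n i)) (param P J T C G j h n i - v n))) := by
          simp only [hr]
          field_simp
        have h7 : G i ^ 2 / 2 * (lam K J (P.U i) (G i) (n + 1) * weight P J T C G j h n i ^ 2)
            = r n * (lam K J (P.U i) (G i) (n + 1) * weight P J T C G j h n i * G i) ^ 2 := by
          simp only [hr]
          field_simp
        rw [h6, h7, ← mul_add, ← mul_add]
        refine mul_le_mul_of_nonneg_left ?_ (hrpos n).le
        simp only [hd] at h4 ⊢
        linarith
      have h8 : r n * ((2 * P.U i) ^ 2 - d (n + 1)) ≤ r (n + 1) * ((2 * P.U i) ^ 2 - d (n + 1)) :=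
        mul_le_mul_of_nonneg_right (hmono _ _ n.le_succ) (sub_nonneg.mpr (hdle _))
      have h9 : r n * (4 * P.U i * ∑ t ∈ Finset.range (n + 1), ‖v (t + 1) - v t‖)
          ≤ r (n + 1) * (4 * P.U i * ∑ t ∈ Finset.range (n + 1), ‖v (t + 1) - v t‖) :=
        mul_le_mul_of_nonneg_right (hmono _ _ n.le_succ) (mul_nonneg (by positivity)
          (Finset.sum_nonneg fun _ _ => norm_nonneg _))
      rw [Finset.sum_range_succ] at h9
      rw [Finset.sum_range_succ, Finset.sum_range_succ (fun t => ‖v (t + 1) - v t‖),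
        Finset.sum_range_succ (fun t => lam K J (P.U i) (G i) (t + 1) * _)]
      nlinarith [h1, h5, h8, h9]
  refine (key T le_rfl).trans ?_
  have h1 : 0 ≤ r T * d T := mul_nonneg (hrpos T).le (sq_nonneg _)
  have h2 : (2 * P.U i ^ 2 + 2 * P.U i * ∑ t ∈ Finset.range T, ‖v (t + 1) - v t‖)
          / lam K J (P.U i) (G i) (T + 1) = r T * (2 * P.U i) ^ 2
        + r T * (4 * P.U i * ∑ t ∈ Finset.range T, ‖v (t + 1) - v t‖) := by
    have := hl T
    simp only [hr]
    field_simp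
    ring
  rw [h2]
  linarith

end ValidParams

/-! ### A comparator path -/

/-- Any rule that chooses the draws of a round from the state at its beginning can be followed. -/
theorem exists_draws_of_rule (j : Fin M) (f : ℕ → State P → Fin J → Fin K) :
    ∃ h : ℕ → Fin J → Fin K, ∀ t, h t = f t (state P J T C G j h t) := by
  let s : ℕ → ℕ → Fin J → Fin K := fun n => Nat.rec (fun τ => f τ ⟨initDist T C, fun _ => 0⟩)
    (fun n hn => Function.update hn n (f n (state P J T C G j hn n))) n
  have hs : ∀ n, s (n + 1) = Function.update (s n) n (f n (state P J T C G j (s n) n)) :=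
    fun n => rfl
  have h1 : ∀ n τ, τ < n → s n τ = s (τ + 1) τ := by
    intro n
    induction n with
    | zero => intro τ hτ; omega
    | succ n ih =>
      intro τ hτ
      rcases Nat.lt_succ_iff_lt_or_eq.mp hτ with h | rfl
      · rw [hs, Function.update_of_ne h.ne, ih τ h]
      · rfl
  refine ⟨fun τ => s (τ + 1) τ, fun t => ?_⟩
  have h2 : state P J T C G j (fun τ => s (τ + 1) τ) t = state P J T C G j (s t) t :=
    state_congr j fun τ hτ => (h1 t τ hτ).symm
  simp only [hs t, Function.update_self, h2]

/-- If the hypothesis `i` is observed exactly when its loss exceeds `a_t` by more than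
`max θ (λ_t (1 + g) G²)`, then every observation decreases the squared distance to `u`
substantially, which bounds the excess loss and the length of the path of the parameters. -/
theorem path_of_threshold_rule (hv : ValidParams P J T C G) (j : Fin M)
    {h : ℕ → Fin J → Fin K} (hb : BoundedAlong P J T C G j h) (i : Fin K)
    {u : EuclideanSpace ℝ (Fin (P.dim i))} (hu : ‖u‖ ≤ P.U i) (a : ℕ → ℝ)
    (ha : ∀ t < T, cost P J T C G j h t i - a t ≤ inner ℝ
      (hypGrad P j t i (param P J T C G j h t i)) (param P J T C G j h t i - u))
    {θ : ℝ} (hθ : 0 < θ)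
    (hrule : ∀ t < T, i ∈ sampled (h t) ↔
      a t + max θ (lam K J (P.U i) (G i) (t + 1) * (1 + gKJ K J) * G i ^ 2)
        < cost P J T C G j h t i) :
    ∑ t ∈ Finset.range T, max (cost P J T C G j h t i - a t) 0
      ≤ ∑ t ∈ Finset.range T, max θ (lam K J (P.U i) (G i) (t + 1) * (1 + gKJ K J) * G i ^ 2)
        + P.U i ^ 2 / lam K J (P.U i) (G i) (T + 1) ∧
    ∑ t ∈ Finset.range T, ‖param P J T C G j h (t + 1) i - param P J T C G j h t i‖
      ≤ P.U i ^ 2 * G i / θ := by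
  have hG := hv.G_pos i
  have hlT := hv.lam_pos i T
  have hg := hv.g_nonneg
  set w := fun t => param P J T C G j h t i with hw
  set drop : ℕ → ℝ := fun t => ‖w t - u‖ ^ 2 - ‖w (t + 1) - u‖ ^ 2 with hdrop
  have hstep : ∀ t < T, max (cost P J T C G j h t i - a t) 0
      ≤ max θ (lam K J (P.U i) (G i) (t + 1) * (1 + gKJ K J) * G i ^ 2)
        + drop t * (1 / lam K J (P.U i) (G i) (T + 1)) ∧ ‖w (t + 1) - w t‖ ≤ drop t * (G i / θ) := by
    intro t ht
    have hl := hv.lam_pos i t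
    have h1 := hv.param_step j hb ht i hu
    have h2 := hv.param_step j hb ht i (hv.norm_param_le j h t i)
    rw [sub_self, norm_zero, inner_zero_right] at h2
    set l := lam K J (P.U i) (G i) (t + 1) with hldef
    have hll : lam K J (P.U i) (G i) (T + 1) ≤ l := hv.lam_antitone i ht.le
    set b := weight P J T C G j h t i with hbdef
    have hmax0 : 0 ≤ max θ (l * (1 + gKJ K J) * G i ^ 2) := hθ.le.trans (le_max_left _ _)
    by_cases hobs : i ∈ sampled (h t)
    · have hb1 : 1 ≤ b := by
        rw [hbdef, weight, obsWeight, if_pos hobs]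
        have hp := (hv.state_p_mem j h t).2
        exact (one_le_inv₀ (inclusionProb_pos hv.two_le hv.le_K hp i)).mpr
          (inclusionProb_le_one hv.two_le hv.le_K hp i)
      have hbg : b ≤ 1 + gKJ K J := hv.weight_le j h t i
      have hz := (hrule t ht).mp hobs
      have hcz := ha t ht
      set z : ℝ := inner ℝ (hypGrad P j t i (param P J T C G j h t i))
        (param P J T C G j h t i - u) with hzdef
      set x := cost P J T C G j h t i - a t with hx
      have hxθ : max θ (l * (1 + gKJ K J) * G i ^ 2) ≤ x := by rw [hx]; linarith
      have hx1 : θ ≤ x := (le_max_left _ _).trans hxθ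
      have hx2 : l * (1 + gKJ K J) * G i ^ 2 ≤ x := (le_max_right _ _).trans hxθ
      have hlb : 0 < l * b := mul_pos hl (by linarith)
      -- the gradient step gains `2 λ b x` and loses at most `λ b x`
      have hd : l * b * x ≤ drop t := by
        have e1 : l * b * x ≤ l * b * z := mul_le_mul_of_nonneg_left hcz hlb.le
        have e2 : (l * b * G i) ^ 2 ≤ l * b * x := by
          have : l * b * G i ^ 2 ≤ x := le_trans (by gcongr) hx2
          calc (l * b * G i) ^ 2 = l * b * (l * b * G i ^ 2) := by ring
            _ ≤ _ := mul_le_mul_of_nonneg_left this hlb.le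
        simp only [hdrop, hw]
        nlinarith
      have hx0 : 0 < x := hθ.trans_le hx1
      constructor
      · rw [max_eq_left hx0.le]
        have : x ≤ drop t * (1 / lam K J (P.U i) (G i) (T + 1)) := by
          rw [mul_one_div, le_div_iff₀ hlT]
          refine le_trans ?_ hd
          have : lam K J (P.U i) (G i) (T + 1) ≤ l * b := hll.trans (le_mul_of_one_le_right hl.le hb1)
          nlinarith
        linarith
      · have e3 : ‖w (t + 1) - w t‖ ≤ l * b * G i := by
          refine le_of_sq_le_sq ?_ (by positivity)
          simp only [hw]
          linarith
        refine e3.trans ?_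
        rw [mul_div_assoc', le_div_iff₀ hθ]
        have : l * b * θ ≤ drop t := le_trans (by gcongr) hd
        nlinarith
    · have hb0 : b = 0 := by rw [hbdef, weight, obsWeight, if_neg hobs]
      rw [hb0] at h2
      have e1 : w (t + 1) = w t := by
        have : ‖w (t + 1) - w t‖ ^ 2 ≤ 0 := by simpa [hw] using h2
        have := pow_eq_zero_iff (two_ne_zero) |>.mp (le_antisymm this (sq_nonneg _))
        exact sub_eq_zero.mp (norm_eq_zero.mp this)
      have e2 : drop t = 0 := by simp only [hdrop, e1, sub_self]
      have e3 := mt (hrule t ht).mpr hobs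
      rw [e2, e1, sub_self, norm_zero, zero_mul, zero_mul, add_zero]
      exact ⟨max_le (by linarith) hmax0, le_rfl⟩
  have htel : ∑ t ∈ Finset.range T, drop t ≤ P.U i ^ 2 := by
    rw [Finset.sum_range_sub']
    have h0 : w 0 = 0 := rfl
    rw [h0, zero_sub, norm_neg]
    have := pow_le_pow_left₀ (norm_nonneg _) hu 2
    nlinarith [sq_nonneg ‖w T - u‖]
  constructor
  · calc _ ≤ ∑ t ∈ Finset.range T, (max θ (lam K J (P.U i) (G i) (t + 1) * (1 + gKJ K J) * G i ^ 2)
          + drop t * (1 / lam K J (P.U i) (G i) (T + 1))) :=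
          Finset.sum_le_sum fun t ht => (hstep t (Finset.mem_range.mp ht)).1
      _ ≤ _ := by
        rw [Finset.sum_add_distrib, ← Finset.sum_mul, mul_one_div]
        gcongr
  · calc _ ≤ ∑ t ∈ Finset.range T, drop t * (G i / θ) :=
          Finset.sum_le_sum fun t ht => (hstep t (Finset.mem_range.mp ht)).2
      _ ≤ P.U i ^ 2 * (G i / θ) := by
        rw [← Finset.sum_mul]
        gcongr
      _ = _ := by ring

variable {Ω : Type*} [mΩ : MeasurableSpace Ω] {μ : Measure Ω} [IsProbabilityMeasure μ]
  {A : ℕ → Fin M → Ω → Fin J → Fin K}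

/-- When some index is left out in every round, the rule of `path_of_threshold_rule` is followed
with positive probability, so that the losses on the resulting path obey the bounds assumed for the
run of the algorithm. -/
theorem exists_path (hv : ValidParams P J T C G) (hA : IsSampling μ P J T C G A) (hJK : J < K)
    (j : Fin M) (hb : ∀ ω, BoundedAlong P J T C G j (draws A j ω)) (i : Fin K)
    {u : EuclideanSpace ℝ (Fin (P.dim i))} (hu : ‖u‖ ≤ P.U i) (a : ℕ → ℝ)
    (ha : ∀ ω, ∀ t < T, cost P J T C G j (draws A j ω) t i - a t ≤ inner ℝ
      (hypGrad P j t i (param P J T C G j (draws A j ω) t i))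
      (param P J T C G j (draws A j ω) t i - u))
    {θ : ℝ} (hθ : 0 < θ) :
    ∃ ω, ∑ t ∈ Finset.range T, max (cost P J T C G j (draws A j ω) t i - a t) 0
      ≤ ∑ t ∈ Finset.range T, max θ (lam K J (P.U i) (G i) (t + 1) * (1 + gKJ K J) * G i ^ 2)
        + P.U i ^ 2 / lam K J (P.U i) (G i) (T + 1) ∧
      ∑ t ∈ Finset.range T,
        ‖param P J T C G j (draws A j ω) (t + 1) i - param P J T C G j (draws A j ω) t i‖
      ≤ P.U i ^ 2 * G i / θ := by
  classical
  obtain ⟨a₁, hinj₁, hmem₁⟩ := exists_injective_mem hv.le_K i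
  obtain ⟨a₀, hinj₀, hmem₀⟩ := exists_injective_notMem hJK i
  obtain ⟨h, hh⟩ := exists_draws_of_rule (P := P) (J := J) (T := T) (C := C) (G := G) j
    (fun t s => if a t + max θ (lam K J (P.U i) (G i) (t + 1) * (1 + gKJ K J) * G i ^ 2)
        < hypLoss P j t i (s.w i) then a₁ else a₀)
  obtain ⟨ω, hω⟩ := exists_draws_eq hv hA j h fun t _ => by
    have hinj : Function.Injective (h t) := by
      rw [hh t]
      split_ifs
      exacts [hinj₁, hinj₀]
    exact mul_pos ((hv.state_p_mem j h t).1 _) (drawWeight_pos hv.le_K hinj)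
  refine ⟨ω, path_of_threshold_rule hv j (hb ω) i hu a (ha ω) hθ fun t ht => ?_⟩
  have h1 : draws A j ω t = h t := hω t ht
  have h2 : state P J T C G j (draws A j ω) t = state P J T C G j h t :=
    state_congr j fun τ hτ => hω τ (hτ.trans ht)
  rw [h1, cost, h2, hh t]
  split_ifs with h3
  · simp only [hmem₁, true_iff]; exact h3
  · simp only [hmem₀, false_iff]; exact h3

end Pathwise

/-! ### Deviations of the importance weighted quantities -/

section Deviations

variable {K M J T : ℕ} [NeZero J] {P : Problem K M} {C G : Fin K → ℝ}
  {Ω : Type*} [mΩ : MeasurableSpace Ω] {μ : Measure Ω} [IsProbabilityMeasure μ]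
  {A : ℕ → Fin M → Ω → Fin J → Fin K}

/-- `tail_bound` with a bound on the conditional first and second moments. -/
theorem tail_bound_of_moments (hv : ValidParams P J T C G) (hA : IsSampling μ P J T C G A)
    (j : Fin M) (X : ℕ → (ℕ → Fin J → Fin K) → (Fin J → Fin K) → ℝ) (hX : ∀ t, IsPrefix t (X t))
    (hX1 : ∀ ω, ∀ t < T, ∀ a, X t (draws A j ω) a ≤ 1) (m : ℕ → (ℕ → Fin J → Fin K) → ℝ)
    (hm : ∀ ω, ∀ t < T, ∑ a, sampleProb (state P J T C G j (draws A j ω) t).p a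
          * (X t (draws A j ω) a + X t (draws A j ω) a ^ 2) ≤ m t (draws A j ω))
    {ε : ℝ} (hε : 0 < ε) :
    μ.real {ω | ¬ ∑ t ∈ Finset.range T, X t (draws A j ω) (draws A j ω t)
      ≤ ∑ t ∈ Finset.range T, m t (draws A j ω) + Real.log (1 / ε)} ≤ ε := by
  refine le_trans (measureReal_mono ?_) (tail_bound hv hA j X hX hX1 hε)
  intro ω hω h
  refine hω (h.trans ?_)
  gcongr with t ht
  exact hm ω t (Finset.mem_range.mp ht)

theorem abs_obsWeight_sub_one_le (hJ : 2 ≤ J) (hJK : J ≤ K) {p : EuclideanSpace ℝ (Fin K)}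
    (hp : p ∈ simplex K) (i : Fin K) (a : Fin J → Fin K) :
    |obsWeight p i a - 1| ≤ max 1 (gKJ K J) := by
  have h1 := obsWeight_nonneg hJ hJK hp i a
  have h2 := obsWeight_le hJ hJK hp i a
  rw [abs_le]
  constructor
  · linarith [le_max_left 1 (gKJ K J)]
  · linarith [le_max_right 1 (gKJ K J)]

/-- Deviation of the importance weights against deterministic coefficients. -/
theorem tail_weight_sub_one (hv : ValidParams P J T C G) (hA : IsSampling μ P J T C G A)
    (j : Fin M) (i : Fin K) (v : ℕ → ℝ) {γ V : ℝ} (hγ : 0 ≤ γ) (hV : ∀ t < T, |v t| ≤ V)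
    (hγV : γ * (V * max 1 (gKJ K J)) ≤ 1) {ε : ℝ} (hε : 0 < ε) :
    μ.real {ω | ¬ γ * ∑ t ∈ Finset.range T, v t * (weight P J T C G j (draws A j ω) t i - 1)
      ≤ γ ^ 2 * gKJ K J * ∑ t ∈ Finset.range T, v t ^ 2 + Real.log (1 / ε)} ≤ ε := by
  have h := tail_bound_of_moments hv hA j
    (fun t h a => γ * (v t * (obsWeight (state P J T C G j h t).p i a - 1)))
    (fun t h h' hh => by simp only [state_congr j hh])
    (fun ω t ht a => by
      have hp := (hv.state_p_mem j (draws A j ω) t).2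
      refine le_trans (mul_le_mul_of_nonneg_left ?_ hγ) hγV
      refine (le_abs_self _).trans ?_
      rw [abs_mul]
      exact mul_le_mul (hV t ht) (abs_obsWeight_sub_one_le hv.two_le hv.le_K hp i a)
        (abs_nonneg _) ((abs_nonneg _).trans (hV t ht)))
    (fun t _ => γ ^ 2 * gKJ K J * v t ^ 2)
    (fun ω t _ => by
      have hp := (hv.state_p_mem j (draws A j ω) t).2
      set p := (state P J T C G j (draws A j ω) t).p
      have h1 : ∀ a : Fin J → Fin K, sampleProb p a * (γ * (v t * (obsWeight p i a - 1))
          + (γ * (v t * (obsWeight p i a - 1))) ^ 2)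
          = γ * v t * (sampleProb p a * obsWeight p i a - sampleProb p a)
            + γ ^ 2 * v t ^ 2 * (sampleProb p a * (obsWeight p i a - 1) ^ 2) := fun a => by ring
      rw [Finset.sum_congr rfl fun a _ => h1 a, Finset.sum_add_distrib, ← Finset.mul_sum,
        ← Finset.mul_sum, Finset.sum_sub_distrib, sum_sampleProb_mul_obsWeight hv.two_le hv.le_K hp,
        sum_sampleProb hv.le_K hp, sub_self, mul_zero, zero_add]
      have := mul_le_mul_of_nonneg_left
        (sum_sampleProb_mul_obsWeight_sub_one_sq_le hv.two_le hv.le_K hp i)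
        (mul_nonneg (sq_nonneg γ) (sq_nonneg (v t)))
      linarith) hε
  simp only [← Finset.mul_sum] at h
  exact h

/-- Upper deviation of a sum of nonnegative terms, at the cost of a factor two. -/
theorem tail_nonneg (hv : ValidParams P J T C G) (hA : IsSampling μ P J T C G A) (j : Fin M)
    (X : ℕ → (ℕ → Fin J → Fin K) → (Fin J → Fin K) → ℝ) (hX : ∀ t, IsPrefix t (X t))
    (hX0 : ∀ ω, ∀ t < T, ∀ a, 0 ≤ X t (draws A j ω) a)
    (hX1 : ∀ ω, ∀ t < T, ∀ a, X t (draws A j ω) a ≤ 1) (m : ℕ → ℝ)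
    (hm : ∀ ω, ∀ t < T, ∑ a, sampleProb (state P J T C G j (draws A j ω) t).p a
          * X t (draws A j ω) a ≤ m t)
    {ε : ℝ} (hε : 0 < ε) :
    μ.real {ω | ¬ ∑ t ∈ Finset.range T, X t (draws A j ω) (draws A j ω t)
      ≤ 2 * ∑ t ∈ Finset.range T, m t + Real.log (1 / ε)} ≤ ε := by
  rw [Finset.mul_sum]
  refine tail_bound_of_moments hv hA j X hX hX1 (fun t _ => 2 * m t) (fun ω t ht => ?_) hε
  have hp := (hv.state_p_mem j (draws A j ω) t).2
  refine le_trans ?_ (mul_le_mul_of_nonneg_left (hm ω t ht) zero_le_two)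
  rw [Finset.mul_sum]
  refine Finset.sum_le_sum fun a _ => ?_
  have h0 := hX0 ω t ht a
  have h1 := hX1 ω t ht a
  have : X t (draws A j ω) a + X t (draws A j ω) a ^ 2 ≤ 2 * X t (draws A j ω) a := by nlinarith
  calc _ ≤ sampleProb (state P J T C G j (draws A j ω) t).p a * (2 * X t (draws A j ω) a) :=
        mul_le_mul_of_nonneg_left this (sampleProb_nonneg hp a)
    _ = _ := by ring

theorem tail_weight_sq (hv : ValidParams P J T C G) (hA : IsSampling μ P J T C G A)
    (j : Fin M) (i : Fin K) {γ : ℝ} (hγ : 0 ≤ γ)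
    (hγ1 : γ * (lam K J (P.U i) (G i) 1 * (1 + gKJ K J) ^ 2) ≤ 1) {ε : ℝ} (hε : 0 < ε) :
    μ.real {ω | ¬ γ * ∑ t ∈ Finset.range T,
        lam K J (P.U i) (G i) (t + 1) * weight P J T C G j (draws A j ω) t i ^ 2
      ≤ 2 * (γ * (1 + gKJ K J) * ∑ t ∈ Finset.range T, lam K J (P.U i) (G i) (t + 1))
        + Real.log (1 / ε)} ≤ ε := by
  have h := tail_nonneg hv hA j
    (fun t h a => γ * (lam K J (P.U i) (G i) (t + 1) * obsWeight (state P J T C G j h t).p i a ^ 2))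
    (fun t h h' hh => by simp only [state_congr j hh])
    (fun ω t _ a => mul_nonneg hγ (mul_nonneg (hv.lam_pos i t).le (sq_nonneg _)))
    (fun ω t _ a => by
      have hp := (hv.state_p_mem j (draws A j ω) t).2
      refine le_trans (mul_le_mul_of_nonneg_left ?_ hγ) hγ1
      refine mul_le_mul (hv.lam_antitone i (Nat.zero_le t)) ?_ (sq_nonneg _) (hv.lam_pos i 0).le
      exact pow_le_pow_left₀ (obsWeight_nonneg hv.two_le hv.le_K hp i a)
        (obsWeight_le hv.two_le hv.le_K hp i a) 2)
    (fun t => γ * (1 + gKJ K J) * lam K J (P.U i) (G i) (t + 1))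
    (fun ω t _ => by
      have hp := (hv.state_p_mem j (draws A j ω) t).2
      have h1 : ∀ a : Fin J → Fin K, sampleProb (state P J T C G j (draws A j ω) t).p a
          * (γ * (lam K J (P.U i) (G i) (t + 1)
            * obsWeight (state P J T C G j (draws A j ω) t).p i a ^ 2))
          = γ * lam K J (P.U i) (G i) (t + 1) * (sampleProb (state P J T C G j (draws A j ω) t).p a
            * obsWeight (state P J T C G j (draws A j ω) t).p i a ^ 2) := fun a => by ring
      rw [Finset.sum_congr rfl fun a _ => h1 a, ← Finset.mul_sum,
        sum_sampleProb_mul_obsWeight_sq hv.two_le hv.le_K hp]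
      have := mul_le_mul_of_nonneg_left (inv_inclusionProb_le hv.two_le hv.le_K hp i)
        (mul_nonneg hγ (hv.lam_pos i t).le)
      linarith) hε
  simp only [← Finset.mul_sum] at h
  exact h

theorem tail_weight_mul_cost (hv : ValidParams P J T C G) (hA : IsSampling μ P J T C G A)
    (j : Fin M) (hb : ∀ ω, BoundedAlong P J T C G j (draws A j ω)) (i : Fin K) {γ : ℝ} (hγ : 0 ≤ γ)
    (hγ1 : γ * ((1 + gKJ K J) * C i) ≤ 1) {ε : ℝ} (hε : 0 < ε) :
    μ.real {ω | ¬ γ * ∑ t ∈ Finset.range T,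
        weight P J T C G j (draws A j ω) t i * cost P J T C G j (draws A j ω) t i
      ≤ 2 * (γ * (T * C i)) + Real.log (1 / ε)} ≤ ε := by
  have h := tail_nonneg hv hA j
    (fun t h a => γ * (obsWeight (state P J T C G j h t).p i a * cost P J T C G j h t i))
    (fun t h h' hh => by simp only [cost, state_congr j hh])
    (fun ω t ht a => by
      have hp := (hv.state_p_mem j (draws A j ω) t).2
      exact mul_nonneg hγ (mul_nonneg (obsWeight_nonneg hv.two_le hv.le_K hp i a) (hb ω t ht i).1))
    (fun ω t ht a => by
      have hp := (hv.state_p_mem j (draws A j ω) t).2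
      refine le_trans (mul_le_mul_of_nonneg_left ?_ hγ) hγ1
      exact mul_le_mul (obsWeight_le hv.two_le hv.le_K hp i a) (hb ω t ht i).2.1 (hb ω t ht i).1
        (by linarith [hv.g_nonneg]))
    (fun _ => γ * C i)
    (fun ω t ht => by
      have hp := (hv.state_p_mem j (draws A j ω) t).2
      have h1 : ∀ a : Fin J → Fin K, sampleProb (state P J T C G j (draws A j ω) t).p a
          * (γ * (obsWeight (state P J T C G j (draws A j ω) t).p i a
            * cost P J T C G j (draws A j ω) t i))
          = γ * cost P J T C G j (draws A j ω) t i
            * (sampleProb (state P J T C G j (draws A j ω) t).p a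
            * obsWeight (state P J T C G j (draws A j ω) t).p i a) := fun a => by ring
      rw [Finset.sum_congr rfl fun a _ => h1 a, ← Finset.mul_sum,
        sum_sampleProb_mul_obsWeight hv.two_le hv.le_K hp, mul_one]
      exact mul_le_mul_of_nonneg_left (hb ω t ht i).2.1 hγ) hε
  simp only [← Finset.mul_sum, Finset.sum_const, Finset.card_range, nsmul_eq_mul] at h
  exact h

theorem meanCost_mem (hv : ValidParams P J T C G) (j : Fin M) {h : ℕ → Fin J → Fin K}
    (hb : BoundedAlong P J T C G j h) {Cm : ℝ} (hC : ∀ k, C k ≤ Cm) {t : ℕ} (ht : t < T) :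
    0 ≤ meanCost P J T C G j h t ∧ meanCost P J T C G j h t ≤ Cm := by
  have hp := (hv.state_p_mem j h t).2
  constructor
  · exact Finset.sum_nonneg fun k _ => mul_nonneg (hp.1 k) (hb t ht k).1
  · calc meanCost P J T C G j h t ≤ ∑ k, (state P J T C G j h t).p k * Cm :=
          Finset.sum_le_sum fun k _ =>
            mul_le_mul_of_nonneg_left ((hb t ht k).2.1.trans (hC k)) (hp.1 k)
      _ = Cm := by rw [← Finset.sum_mul, hp.2, one_mul]

/-- Deviation of the losses of the predictions from their conditional means; the variance is at most
the maximal loss times the mean. -/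
theorem tail_prediction (hv : ValidParams P J T C G) (hA : IsSampling μ P J T C G A)
    (j : Fin M) (hb : ∀ ω, BoundedAlong P J T C G j (draws A j ω)) {Cm : ℝ} (hC : ∀ k, C k ≤ Cm)
    {γ : ℝ} (hγ : 0 ≤ γ) (hγ1 : γ * Cm ≤ 1) {ε : ℝ} (hε : 0 < ε) :
    μ.real {ω | ¬ γ * (∑ t ∈ Finset.range T,
        cost P J T C G j (draws A j ω) t (draws A j ω t 0)
        - ∑ t ∈ Finset.range T, meanCost P J T C G j (draws A j ω) t)
      ≤ γ ^ 2 * Cm * ∑ t ∈ Finset.range T, meanCost P J T C G j (draws A j ω) t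
        + Real.log (1 / ε)} ≤ ε := by
  have h := tail_bound_of_moments hv hA j
    (fun t h a => γ * (cost P J T C G j h t (a 0) - meanCost P J T C G j h t))
    (fun t h h' hh => by simp only [meanCost, cost, state_congr j hh])
    (fun ω t ht a => by
      refine le_trans (mul_le_mul_of_nonneg_left ?_ hγ) hγ1
      have h1 := (hb ω t ht (a 0)).2.1.trans (hC _)
      have h2 := (meanCost_mem hv j (hb ω) hC ht).1
      linarith)
    (fun t h => γ ^ 2 * Cm * meanCost P J T C G j h t)
    (fun ω t ht => by
      have hp := (hv.state_p_mem j (draws A j ω) t).2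
      set h := draws A j ω
      set p := (state P J T C G j h t).p with hpdef
      set m := meanCost P J T C G j h t with hm
      have h0 : 0 ≤ m := (meanCost_mem hv j (hb ω) hC ht).1
      rw [sum_sampleProb_mul_first hv.le_K p fun k => γ * (cost P J T C G j h t k - m)
        + (γ * (cost P J T C G j h t k - m)) ^ 2]
      have h1 : ∀ k, p k * (γ * (cost P J T C G j h t k - m)
          + (γ * (cost P J T C G j h t k - m)) ^ 2)
          ≤ (γ + γ ^ 2 * Cm - 2 * γ ^ 2 * m) * (p k * cost P J T C G j h t k)
            + (γ ^ 2 * m ^ 2 - γ * m) * p k := by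
        intro k
        have h2 := hb ω t ht k
        have h3 : cost P J T C G j h t k ^ 2 ≤ Cm * cost P J T C G j h t k := by
          nlinarith [h2.1, h2.2.1.trans (hC k)]
        have h4 := mul_le_mul_of_nonneg_left h3 (mul_nonneg (sq_nonneg γ) (hp.1 k))
        nlinarith
      refine (Finset.sum_le_sum fun k _ => h1 k).trans ?_
      rw [Finset.sum_add_distrib, ← Finset.mul_sum, ← Finset.mul_sum, hp.2]
      have h5 : ∑ k, p k * cost P J T C G j h t k = m := rfl
      rw [h5]
      nlinarith [mul_nonneg (sq_nonneg γ) (sq_nonneg m)]) hε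
  simp only [← Finset.mul_sum, Finset.sum_sub_distrib] at h
  exact h

/-- Lower deviation of the estimates of the mean losses; by convexity the variance is at most `g`
times the maximal loss times the mean. -/
theorem tail_meanCostEst (hv : ValidParams P J T C G) (hA : IsSampling μ P J T C G A)
    (j : Fin M) (hb : ∀ ω, BoundedAlong P J T C G j (draws A j ω)) {Cm : ℝ} (hC : ∀ k, C k ≤ Cm)
    {γ : ℝ} (hγ : 0 ≤ γ) (hγ1 : γ * Cm ≤ 1) {ε : ℝ} (hε : 0 < ε) :
    μ.real {ω | ¬ γ * (∑ t ∈ Finset.range T, meanCost P J T C G j (draws A j ω) t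
        - ∑ t ∈ Finset.range T, meanCostEst P J T C G j (draws A j ω) t)
      ≤ γ ^ 2 * (gKJ K J * Cm) * ∑ t ∈ Finset.range T, meanCost P J T C G j (draws A j ω) t
        + Real.log (1 / ε)} ≤ ε := by
  have h := tail_bound_of_moments hv hA j
    (fun t h a => γ * (meanCost P J T C G j h t - ∑ k, (state P J T C G j h t).p k
      * (obsWeight (state P J T C G j h t).p k a * cost P J T C G j h t k)))
    (fun t h h' hh => by simp only [meanCost, cost, state_congr j hh])
    (fun ω t ht a => by
      have hp := (hv.state_p_mem j (draws A j ω) t).2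
      refine le_trans (mul_le_mul_of_nonneg_left ?_ hγ) hγ1
      have h1 := (meanCost_mem hv j (hb ω) hC ht).2
      have h2 : 0 ≤ ∑ k, (state P J T C G j (draws A j ω) t).p k
          * (obsWeight (state P J T C G j (draws A j ω) t).p k a
            * cost P J T C G j (draws A j ω) t k) :=
        Finset.sum_nonneg fun k _ => mul_nonneg (hp.1 k)
          (mul_nonneg (obsWeight_nonneg hv.two_le hv.le_K hp k a) (hb ω t ht k).1)
      linarith)
    (fun t h => γ ^ 2 * (gKJ K J * Cm) * meanCost P J T C G j h t)
    (fun ω t ht => by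
      have hp := (hv.state_p_mem j (draws A j ω) t).2
      set h := draws A j ω
      set p := (state P J T C G j h t).p with hpdef
      set c := cost P J T C G j h t with hc
      have hdiff : ∀ a : Fin J → Fin K, meanCost P J T C G j h t
          - ∑ k, p k * (obsWeight p k a * c k) = ∑ k, p k * (c k * (1 - obsWeight p k a)) := by
        intro a
        rw [meanCost, ← Finset.sum_sub_distrib]
        exact Finset.sum_congr rfl fun k _ => by ring
      -- Jensen's inequality for the square
      have hjensen : ∀ a : Fin J → Fin K, (∑ k, p k * (c k * (1 - obsWeight p k a))) ^ 2
          ≤ ∑ k, p k * (c k * (1 - obsWeight p k a)) ^ 2 := by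
        intro a
        have := (convexOn_pow 2).map_sum_le (t := Finset.univ) (w := fun k => p k)
          (p := fun k => |c k * (1 - obsWeight p k a)|) (fun k _ => hp.1 k) hp.2
          (fun k _ => Set.mem_Ici.mpr (abs_nonneg _))
        simp only [smul_eq_mul, sq_abs] at this
        refine le_trans ?_ this
        rw [← sq_abs (∑ k, p k * (c k * (1 - obsWeight p k a)))]
        refine pow_le_pow_left₀ (abs_nonneg _) ((Finset.abs_sum_le_sum_abs _ _).trans ?_) 2
        refine Finset.sum_le_sum fun k _ => ?_
        rw [abs_mul, abs_of_nonneg (hp.1 k)]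
      have h1 : ∀ a : Fin J → Fin K, sampleProb p a * (γ * (∑ k, p k * (c k * (1 - obsWeight p k a)))
          + (γ * ∑ k, p k * (c k * (1 - obsWeight p k a))) ^ 2)
          ≤ ∑ k, (γ * p k * c k * (sampleProb p a - sampleProb p a * obsWeight p k a)
            + γ ^ 2 * p k * c k ^ 2 * (sampleProb p a * (obsWeight p k a - 1) ^ 2)) := by
        intro a
        have hq := sampleProb_nonneg hp a
        have := mul_le_mul_of_nonneg_left (hjensen a) (mul_nonneg hq (sq_nonneg γ))
        rw [Finset.sum_add_distrib]
        have e1 : sampleProb p a * (γ * (∑ k, p k * (c k * (1 - obsWeight p k a))))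
            = ∑ k, γ * p k * c k * (sampleProb p a - sampleProb p a * obsWeight p k a) := by
          rw [Finset.mul_sum, Finset.mul_sum]
          exact Finset.sum_congr rfl fun k _ => by ring
        have e2 : sampleProb p a * γ ^ 2 * ∑ k, p k * (c k * (1 - obsWeight p k a)) ^ 2
            = ∑ k, γ ^ 2 * p k * c k ^ 2 * (sampleProb p a * (obsWeight p k a - 1) ^ 2) := by
          rw [Finset.mul_sum]
          exact Finset.sum_congr rfl fun k _ => by ring
        rw [← e1, ← e2]
        linarith
      simp only [hdiff]
      refine (Finset.sum_le_sum fun a _ => h1 a).trans ?_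
      rw [Finset.sum_comm, meanCost, Finset.mul_sum]
      refine Finset.sum_le_sum fun k _ => ?_
      rw [Finset.sum_add_distrib, ← Finset.mul_sum, ← Finset.mul_sum, Finset.sum_sub_distrib,
        sum_sampleProb_mul_obsWeight hv.two_le hv.le_K hp, sum_sampleProb hv.le_K hp, sub_self,
        mul_zero, zero_add]
      have h2 := hb ω t ht k
      have h3 : c k ^ 2 ≤ Cm * c k := by
        have := h2.1; have := h2.2.1.trans (hC k); nlinarith
      have h4 := sum_sampleProb_mul_obsWeight_sub_one_sq_le hv.two_le hv.le_K hp k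
      have h5 : 0 ≤ γ ^ 2 * p k := mul_nonneg (sq_nonneg _) (hp.1 k)
      calc _ ≤ γ ^ 2 * p k * c k ^ 2 * gKJ K J :=
            mul_le_mul_of_nonneg_left h4 (mul_nonneg h5 (sq_nonneg _))
        _ ≤ γ ^ 2 * p k * (Cm * c k) * gKJ K J :=
            mul_le_mul_of_nonneg_right (mul_le_mul_of_nonneg_left h3 h5) hv.g_nonneg
        _ = _ := by ring) hε
  simp only [← Finset.mul_sum, Finset.sum_sub_distrib] at h
  exact h

end Deviations

/-! ### Numerical estimates -/

section Numerics

/-! The letters stand for `τ = T ^ (1 / 8)`, `L = ln (K T)` and `l = ln (1 / δ)`, and `ρ ≥ 1` for a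
constant such that `κ ρ² ≥ 1`, so that the conditions with `κ` hold with `ρ²` on the other side. -/

variable {g T ρ τ L l : ℝ}

theorem sqrt_one_add_le (hgT : g ^ 2 ≤ ρ ^ 2 * T) (hT : T = τ ^ 8) (hτ : 1 ≤ τ) (hρ : 1 ≤ ρ) :
    √(1 + g) ≤ 2 * ρ * τ ^ 2 := by
  refine Real.sqrt_le_iff.mpr ⟨by positivity, ?_⟩
  have h1 : g ≤ ρ * τ ^ 4 := le_of_sq_le_sq (by rw [hT] at hgT; linarith [hgT]) (by positivity)
  have h2 : 1 ≤ τ ^ 4 := one_le_pow₀ hτ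
  have h3 : 1 ≤ ρ * τ ^ 4 := by nlinarith
  have h4 : 2 * (ρ * τ ^ 4) ≤ (2 * ρ * τ ^ 2) ^ 2 := by
    have : (2 * ρ * τ ^ 2) ^ 2 = 4 * ρ * (ρ * τ ^ 4) := by ring
    rw [this]
    nlinarith
  linarith

theorem sqrt_one_add_mul (hg : 0 ≤ g) (hT : T = τ ^ 8) (hτ : 1 ≤ τ) :
    √((1 + g) * T) = √(1 + g) * τ ^ 4 := by
  rw [Real.sqrt_mul (by linarith), hT, show τ ^ 8 = (τ ^ 4) ^ 2 by ring,
    Real.sqrt_sq (by positivity)]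

theorem one_le_sqrt_one_add (hg : 0 ≤ g) : 1 ≤ √(1 + g) := Real.one_le_sqrt.mpr (by linarith)

theorem one_add_mul_log_le (hg : 0 ≤ g) (hgT : g ^ 2 ≤ ρ ^ 2 * T) (hT : T = τ ^ 8) (hτ : 1 ≤ τ)
    (hρ : 1 ≤ ρ) (hL0 : 0 ≤ L) (hL : L ≤ 16 * τ) :
    (1 + g) * L ≤ 32 * ρ * √((1 + g) * T) := by
  have h1 := sqrt_one_add_le hgT hT hτ hρ
  have h2 := one_le_sqrt_one_add hg
  rw [sqrt_one_add_mul hg hT hτ]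
  have h3 : √(1 + g) * L ≤ 2 * ρ * τ ^ 2 * (16 * τ) := mul_le_mul h1 hL hL0 (by positivity)
  have h4 : τ ^ 3 ≤ τ ^ 4 := pow_le_pow_right₀ hτ (by norm_num)
  calc (1 + g) * L = √(1 + g) * (√(1 + g) * L) := by
        rw [← mul_assoc, Real.mul_self_sqrt (by linarith)]
    _ ≤ √(1 + g) * (2 * ρ * τ ^ 2 * (16 * τ)) := mul_le_mul_of_nonneg_left h3 (by linarith)
    _ = √(1 + g) * (32 * ρ * τ ^ 3) := by ring
    _ ≤ √(1 + g) * (32 * ρ * τ ^ 4) := by gcongr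
    _ = _ := by ring

theorem max_one_le (hg : 0 ≤ g) : max 1 g ≤ 1 + g := max_le (by linarith) (by linarith)

theorem max_mul_log_add_le (hg : 0 ≤ g) (hgT : g ^ 2 ≤ ρ ^ 2 * T) (hT : T = τ ^ 8) (hτ : 1 ≤ τ)
    (hρ : 1 ≤ ρ) (hL0 : 0 ≤ L) (hL : L ≤ 16 * τ) (hl : 0 ≤ l)
    (halt : 1 ≤ ρ ^ 2 * g ∨ l ≤ ρ ^ 2 * L) :
    max 1 g * (L + l) ≤ 64 * ρ ^ 3 * (√((1 + g) * T) + g * l) := by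
  have h1 := one_add_mul_log_le hg hgT hT hτ hρ hL0 hL
  set R := √((1 + g) * T) with hR
  have hR0 : 0 ≤ R := Real.sqrt_nonneg _
  have hgl : 0 ≤ g * l := mul_nonneg hg hl
  have hρ2 : 1 ≤ ρ ^ 2 := one_le_pow₀ hρ
  have hρ3 : ρ ^ 2 ≤ ρ ^ 3 := pow_le_pow_right₀ hρ (by norm_num)
  have hρ4 : ρ ≤ ρ ^ 3 := le_self_pow₀ hρ (by norm_num)
  have h2 : max 1 g * L ≤ 32 * ρ ^ 3 * R :=
    calc max 1 g * L ≤ (1 + g) * L := mul_le_mul_of_nonneg_right (max_one_le hg) hL0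
      _ ≤ 32 * ρ * R := h1
      _ ≤ _ := by gcongr
  have h3 : max 1 g * l ≤ 32 * ρ ^ 3 * (R + g * l) := by
    rcases halt with h | h
    · have : max 1 g ≤ ρ ^ 2 * g := max_le h (le_mul_of_one_le_left hg hρ2)
      calc max 1 g * l ≤ ρ ^ 2 * g * l := mul_le_mul_of_nonneg_right this hl
        _ = ρ ^ 2 * (g * l) := by ring
        _ ≤ 32 * ρ ^ 3 * (g * l) := by gcongr; linarith
        _ ≤ _ := by gcongr; linarith
    · have e1 : max 1 g * l ≤ l + g * l := by
        have := mul_le_mul_of_nonneg_right (max_one_le hg) hl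
        linarith
      have e2 : ρ ^ 2 * L ≤ ρ ^ 2 * (32 * ρ * R) := by
        gcongr
        nlinarith
      have e3 : g * l ≤ 32 * ρ ^ 3 * (g * l) := le_mul_of_one_le_left hgl (by linarith)
      nlinarith
  nlinarith

theorem mul_max_mul_le {C Ci : ℝ} (hC : 0 ≤ C) (hCi : 0 ≤ Ci) (hg : 0 ≤ g) (hT : T = τ ^ 8)
    (hτ : 1 ≤ τ) (hρ : 1 ≤ ρ) (hL1 : 1 ≤ L) (hL : L ≤ 16 * τ) (hl : 0 ≤ l)
    (halt : 1 ≤ ρ ^ 2 * g ∨ C * l ≤ ρ ^ 2 * (Ci * L)) :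
    C * max 1 g * l ≤ 16 * ρ ^ 2 * (C * g * l + Ci * √L * √((1 + g) * T)) := by
  have h0 : 0 ≤ C * g * l := by positivity
  have hρ2 : 1 ≤ ρ ^ 2 := one_le_pow₀ hρ
  have h0' : 0 ≤ Ci * √L * √((1 + g) * T) := by positivity
  rcases halt with h | h
  · have : max 1 g ≤ ρ ^ 2 * g := max_le h (le_mul_of_one_le_left hg hρ2)
    calc C * max 1 g * l ≤ C * (ρ ^ 2 * g) * l := by gcongr
      _ = ρ ^ 2 * (C * g * l) := by ring
      _ ≤ _ := by nlinarith
  · have e1 : C * max 1 g * l ≤ C * l + C * g * l := by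
      have := mul_le_mul_of_nonneg_left (max_one_le hg) (mul_nonneg hC hl)
      nlinarith
    have e2 : L ≤ 16 * (√L * √((1 + g) * T)) := by
      have e3 : √L ≤ 16 * √((1 + g) * T) := by
        have h1 := one_le_sqrt_one_add hg
        rw [sqrt_one_add_mul hg hT hτ]
        have h2 : √L ≤ L := Real.sqrt_le_iff.mpr ⟨by linarith, by nlinarith⟩
        have h3 : τ ≤ τ ^ 4 := le_self_pow₀ hτ (by norm_num)
        nlinarith
      calc L = √L * √L := (Real.mul_self_sqrt (by linarith)).symm
        _ ≤ √L * (16 * √((1 + g) * T)) := mul_le_mul_of_nonneg_left e3 (Real.sqrt_nonneg _)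
        _ = _ := by ring
    have e4 : ρ ^ 2 * (Ci * L) ≤ ρ ^ 2 * (Ci * (16 * (√L * √((1 + g) * T)))) := by gcongr
    nlinarith

theorem sqrt_variance_le {C Ci D : ℝ} (hC : 0 ≤ C) (hCi : 0 ≤ Ci) (hg : 0 ≤ g) (hT : 0 ≤ T)
    (hρ : 1 ≤ ρ) (hL : 0 ≤ L) (hl : 0 ≤ l) (hD : D ≤ 2 * ρ * Ci)
    (halt : 1 ≤ ρ ^ 2 * g ∨ C * l ≤ ρ ^ 2 * (Ci * L)) :
    √(C * D * T * l) ≤ 2 * ρ ^ 2 * (√(C * Ci) * √(g * T * l) + Ci * √L * √((1 + g) * T)) := by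
  have h1 : 0 ≤ √(C * Ci) * √(g * T * l) := by positivity
  have h2 : 0 ≤ Ci * √L * √((1 + g) * T) := by positivity
  have hρ3 : ρ ^ 3 ≤ ρ ^ 4 := pow_le_pow_right₀ hρ (by norm_num)
  rcases halt with h | h
  · have e1 : C * D * T * l ≤ (2 * ρ ^ 2 * (√(C * Ci) * √(g * T * l))) ^ 2 := by
      rw [show (2 * ρ ^ 2 * (√(C * Ci) * √(g * T * l))) ^ 2
        = 4 * ρ ^ 4 * (√(C * Ci) ^ 2 * √(g * T * l) ^ 2) by ring, Real.sq_sqrt (by positivity),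
        Real.sq_sqrt (by positivity)]
      calc C * D * T * l ≤ C * (2 * ρ * Ci) * T * l := by gcongr
        _ = 2 * ρ * (C * Ci * T * l) * 1 := by ring
        _ ≤ 2 * ρ * (C * Ci * T * l) * (ρ ^ 2 * g) := by gcongr
        _ = 2 * ρ ^ 3 * (C * Ci * T * l * g) := by ring
        _ ≤ 4 * ρ ^ 4 * (C * Ci * T * l * g) := by gcongr; linarith [pow_nonneg (by linarith : 0 ≤ ρ) 4]
        _ = _ := by ring
    calc √(C * D * T * l) ≤ 2 * ρ ^ 2 * (√(C * Ci) * √(g * T * l)) :=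
          Real.sqrt_le_iff.mpr ⟨by positivity, e1⟩
      _ ≤ _ := by gcongr; linarith
  · have e1 : C * D * T * l ≤ (2 * ρ ^ 2 * (Ci * √L * √((1 + g) * T))) ^ 2 := by
      rw [show (2 * ρ ^ 2 * (Ci * √L * √((1 + g) * T))) ^ 2
        = 4 * ρ ^ 4 * (Ci ^ 2 * √L ^ 2 * √((1 + g) * T) ^ 2) by ring, Real.sq_sqrt hL,
        Real.sq_sqrt (by positivity)]
      calc C * D * T * l ≤ C * (2 * ρ * Ci) * T * l := by gcongr
        _ = 2 * ρ * Ci * T * (C * l) := by ring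
        _ ≤ 2 * ρ * Ci * T * (ρ ^ 2 * (Ci * L)) := by gcongr
        _ = 2 * ρ ^ 3 * (Ci ^ 2 * L * T) := by ring
        _ ≤ 4 * ρ ^ 4 * (Ci ^ 2 * L * T) := by gcongr; linarith [pow_nonneg (by linarith : 0 ≤ ρ) 4]
        _ ≤ 4 * ρ ^ 4 * (Ci ^ 2 * L * ((1 + g) * T)) := by
          gcongr
          nlinarith
        _ = _ := by ring
    calc √(C * D * T * l) ≤ 2 * ρ ^ 2 * (Ci * √L * √((1 + g) * T)) :=
          Real.sqrt_le_iff.mpr ⟨by positivity, e1⟩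
      _ ≤ _ := by gcongr; linarith

theorem sqrt_variance_mul_le {C Ci D : ℝ} (hC : 0 ≤ C) (hCi : 0 ≤ Ci) (hg : 0 ≤ g) (hT : 0 ≤ T)
    (hρ : 1 ≤ ρ) (hl : 0 ≤ l) (hD : D ≤ 2 * ρ * Ci) :
    √(g * C * D * T * l) ≤ 2 * ρ * (√(C * Ci) * √(g * T * l)) := by
  refine Real.sqrt_le_iff.mpr ⟨by positivity, ?_⟩
  rw [show (2 * ρ * (√(C * Ci) * √(g * T * l))) ^ 2
    = (2 * ρ) ^ 2 * (√(C * Ci) ^ 2 * √(g * T * l) ^ 2) by ring, Real.sq_sqrt (by positivity),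
    Real.sq_sqrt (by positivity)]
  calc g * C * D * T * l ≤ g * C * (2 * ρ * Ci) * T * l := by gcongr
    _ = 2 * ρ * (C * Ci * (g * T * l)) := by ring
    _ ≤ (2 * ρ) ^ 2 * (C * Ci * (g * T * l)) := by
      gcongr
      nlinarith

/-- Optimizing a tail bound: with `γ = 1 / (V + √(W / l))` a bound `γ x ≤ γ² W + l` yields the
Bernstein form. -/
theorem le_of_mul_le_sq {x V W : ℝ} (hV : 0 < V) (hW : 0 ≤ W) (hl : 0 < l)
    (h : 1 / (V + √(W / l)) * x ≤ (1 / (V + √(W / l))) ^ 2 * W + l) :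
    x ≤ V * l + 2 * √(W * l) := by
  set s := √(W / l) with hs
  have hs0 : 0 ≤ s := Real.sqrt_nonneg _
  have hs2 : s ^ 2 * l = W := by rw [hs, Real.sq_sqrt (by positivity)]; field_simp
  have hsl : √(W * l) = s * l := by
    rw [← hs2, show s ^ 2 * l * l = (s * l) ^ 2 by ring, Real.sqrt_sq (by positivity)]
  have hpos : 0 < V + s := by linarith
  have h1 : x ≤ 1 / (V + s) * W + l * (V + s) := by
    have := mul_le_mul_of_nonneg_left h hpos.le
    have e1 : (V + s) * (1 / (V + s) * x) = x := by field_simp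
    have e2 : (V + s) * ((1 / (V + s)) ^ 2 * W + l) = 1 / (V + s) * W + l * (V + s) := by
      field_simp
    rw [e1, e2] at this
    exact this
  have h2 : 1 / (V + s) * W ≤ s * l := by
    rw [one_div_mul_eq_div, div_le_iff₀ hpos, ← hs2]
    nlinarith [mul_nonneg hs0 hl.le, mul_nonneg (mul_nonneg hs0 hl.le) hV.le]
  rw [hsl]
  linarith

/-- Combination of the bounds for the predictions. Here `X` is the total loss of the predictions,
`Y` its conditional mean, `Z` the estimate of `Y`, and `B` the estimated total loss of the
comparison hypothesis. -/
theorem prediction_sub_le {X Y Z B D₀ α C Ci D q n : ℝ} (hC : 0 < C) (hD : Ci ≤ D)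
    (hCi : 0 ≤ Ci) (hg : 0 ≤ g) (hT : 0 ≤ T) (hl : 0 < l) (hn1 : 1 ≤ n) (hng : g ≤ n)
    (hq : 0 ≤ q) (hY0 : 0 ≤ Y) (hZ0 : 0 ≤ Z) (hD0 : 0 ≤ D₀) (hα0 : 0 ≤ α)
    (hα : α ≤ 1 / 2)
    (h1 : 1 / (2 * C + √(C * D * T / l)) * (X - Y)
      ≤ (1 / (2 * C + √(C * D * T / l))) ^ 2 * C * Y + l)
    (h2 : 1 / (2 * C * n + √(g * C * D * T / l)) * (Y - Z)
      ≤ (1 / (2 * C * n + √(g * C * D * T / l))) ^ 2 * (g * C) * Y + l)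
    (h3 : Z ≤ B + D₀ + α * Z) (h4 : B ≤ 2 * (T * Ci) + 2 * (Ci * q)) :
    X - B ≤ 5 * √(C * D * T * l) + 15 * √(g * C * D * T * l) + 10 * (Ci * q) + 6 * D₀
      + 8 * (C * n * l) + 4 * (α * (T * Ci)) := by
  have hD' : 0 ≤ D := hCi.trans hD
  have hsqrt : ∀ W : ℝ, 0 ≤ W → √(W / l) ^ 2 * l = W ∧ √(W * l) = √(W / l) * l := by
    intro W hW
    have e : √(W / l) ^ 2 * l = W := by rw [Real.sq_sqrt (by positivity)]; field_simp
    refine ⟨e, ?_⟩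
    conv_lhs => rw [← e]
    rw [show √(W / l) ^ 2 * l * l = (√(W / l) * l) ^ 2 by ring, Real.sqrt_sq (by positivity)]
  obtain ⟨hs₁, hs₁'⟩ := hsqrt (C * D * T) (by positivity)
  obtain ⟨hs₂, hs₂'⟩ := hsqrt (g * C * D * T) (by positivity)
  rw [hs₁', hs₂']
  set s₁ := √(C * D * T / l)
  set s₂ := √(g * C * D * T / l)
  have hs₁0 : 0 ≤ s₁ := Real.sqrt_nonneg _
  have hs₂0 : 0 ≤ s₂ := Real.sqrt_nonneg _
  have hp₁ : 0 < 2 * C + s₁ := by positivity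
  have hp₂ : 0 < 2 * C * n + s₂ := by positivity
  set γ₁ := 1 / (2 * C + s₁) with hγ₁
  set γ₂ := 1 / (2 * C * n + s₂) with hγ₂
  have hγ₁0 : 0 < γ₁ := by positivity
  have hγ₂0 : 0 < γ₂ := by positivity
  have hm₁ : γ₁ * (2 * C + s₁) = 1 := by rw [hγ₁]; field_simp
  have hm₂ : γ₂ * (2 * C * n + s₂) = 1 := by rw [hγ₂]; field_simp
  have hm₁' : 2 * (γ₁ * C) + γ₁ * s₁ = 1 := by rw [← hm₁]; ring
  have hm₂' : 2 * (γ₂ * (C * n)) + γ₂ * s₂ = 1 := by rw [← hm₂]; ring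
  have hγs₁ : 0 ≤ γ₁ * s₁ := mul_nonneg hγ₁0.le hs₁0
  have hγs₂ : 0 ≤ γ₂ * s₂ := mul_nonneg hγ₂0.le hs₂0
  have hγC₁ : 0 ≤ γ₁ * C := mul_nonneg hγ₁0.le hC.le
  have hγC₂ : 0 ≤ γ₂ * (C * n) := by positivity
  have hCn : C ≤ C * n := le_mul_of_one_le_right hC.le hn1
  have hCl : C * l ≤ C * n * l := mul_le_mul_of_nonneg_right hCn hl.le
  -- products of `γ₁`, `γ₂` with the quantities they were chosen for
  have ha₁ : γ₁ * C ≤ 1 / 2 := by linarith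
  have hb₁ : γ₁ * C * (T * Ci) ≤ s₁ * l := by
    have e1 : γ₁ * s₁ ≤ 1 := by linarith
    calc γ₁ * C * (T * Ci) ≤ γ₁ * C * (T * D) := by gcongr
      _ = γ₁ * s₁ * (s₁ * l) := by
        have : γ₁ * s₁ * (s₁ * l) = γ₁ * (s₁ ^ 2 * l) := by ring
        rw [this, hs₁]; ring
      _ ≤ _ := mul_le_of_le_one_left (by positivity) e1
  have ha₂ : γ₂ * (g * C) ≤ 1 / 2 := by
    have : g * C ≤ C * n := by
      rw [mul_comm]
      exact mul_le_mul_of_nonneg_left hng hC.le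
    linarith [mul_le_mul_of_nonneg_left this hγ₂0.le]
  have ha₂0 : 0 ≤ γ₂ * (g * C) := by positivity
  have hb₂ : γ₂ * (g * C) * (T * Ci) ≤ s₂ * l := by
    have e1 : γ₂ * s₂ ≤ 1 := by linarith
    calc γ₂ * (g * C) * (T * Ci) ≤ γ₂ * (g * C) * (T * D) := by gcongr
      _ = γ₂ * s₂ * (s₂ * l) := by
        have : γ₂ * s₂ * (s₂ * l) = γ₂ * (s₂ ^ 2 * l) := by ring
        rw [this, hs₂]; ring
      _ ≤ _ := mul_le_of_le_one_left (by positivity) e1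
  have h1' : X - Y ≤ γ₁ * C * Y + (2 * C * l + s₁ * l) := by
    have := mul_le_mul_of_nonneg_left h1 hp₁.le
    have e1 : (2 * C + s₁) * (γ₁ * (X - Y)) = γ₁ * (2 * C + s₁) * (X - Y) := by ring
    have e2 : (2 * C + s₁) * (γ₁ ^ 2 * C * Y + l)
      = γ₁ * (2 * C + s₁) * (γ₁ * C * Y) + (2 * C * l + s₁ * l) := by ring
    rw [e1, e2, hm₁, one_mul, one_mul] at this
    exact this
  have h2' : Y - Z ≤ γ₂ * (g * C) * Y + (2 * (C * n * l) + s₂ * l) := by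
    have := mul_le_mul_of_nonneg_left h2 hp₂.le
    have e1 : (2 * C * n + s₂) * (γ₂ * (Y - Z)) = γ₂ * (2 * C * n + s₂) * (Y - Z) := by ring
    have e2 : (2 * C * n + s₂) * (γ₂ ^ 2 * (g * C) * Y + l)
      = γ₂ * (2 * C * n + s₂) * (γ₂ * (g * C) * Y) + (2 * (C * n * l) + s₂ * l) := by ring
    rw [e1, e2, hm₂, one_mul, one_mul] at this
    exact this
  have hαZ : α * Z ≤ 1 / 2 * Z := mul_le_mul_of_nonneg_right hα hZ0
  have hZ : Z ≤ 2 * (B + D₀) := by linarith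
  have hqCi : 0 ≤ Ci * q := by positivity
  have hTCi : 0 ≤ T * Ci := by positivity
  have hZB : Z - B ≤ 2 * D₀ + 4 * (α * (T * Ci)) + 2 * (Ci * q) := by
    have e1 : α * Z ≤ α * (2 * (B + D₀)) := mul_le_mul_of_nonneg_left hZ hα0
    have e2 : α * D₀ ≤ 1 / 2 * D₀ := mul_le_mul_of_nonneg_right hα hD0
    have e3 : α * B ≤ α * (2 * (T * Ci) + 2 * (Ci * q)) := mul_le_mul_of_nonneg_left h4 hα0
    have e4 : α * (Ci * q) ≤ 1 / 2 * (Ci * q) := mul_le_mul_of_nonneg_right hα hqCi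
    linarith
  have hYZ : Y - Z ≤ 10 * (s₂ * l) + 4 * (Ci * q) + 2 * D₀ + 4 * (C * n * l) := by
    have e1 : γ₂ * (g * C) * Y ≤ 1 / 2 * Y := mul_le_mul_of_nonneg_right ha₂ hY0
    have e2 : Y ≤ 2 * Z + 2 * (2 * (C * n * l) + s₂ * l) := by linarith
    have e3 : γ₂ * (g * C) * Y ≤ γ₂ * (g * C) * (2 * Z + 2 * (2 * (C * n * l) + s₂ * l)) :=
      mul_le_mul_of_nonneg_left e2 ha₂0
    have hnn : 0 ≤ 2 * (C * n * l) + s₂ * l := by positivity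
    have e4 : γ₂ * (g * C) * (2 * (C * n * l) + s₂ * l) ≤ 1 / 2 * (2 * (C * n * l) + s₂ * l) :=
      mul_le_mul_of_nonneg_right ha₂ hnn
    have e5 : γ₂ * (g * C) * Z ≤ γ₂ * (g * C) * (4 * (T * Ci) + 4 * (Ci * q) + 2 * D₀) :=
      mul_le_mul_of_nonneg_left (by linarith) ha₂0
    have e6 : γ₂ * (g * C) * (4 * (Ci * q) + 2 * D₀) ≤ 1 / 2 * (4 * (Ci * q) + 2 * D₀) :=
      mul_le_mul_of_nonneg_right ha₂ (by positivity)
    linarith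
  have hXY : X - Y ≤ 5 * (s₁ * l) + 5 * (s₂ * l) + 4 * (Ci * q) + 2 * D₀ + 4 * (C * n * l) := by
    have hnn : 0 ≤ 8 * (Ci * q) + 4 * D₀ + 10 * (s₂ * l) + 4 * (C * n * l) := by positivity
    have e1 : γ₁ * C * Y ≤ γ₁ * C * (4 * (T * Ci)
        + (8 * (Ci * q) + 4 * D₀ + 10 * (s₂ * l) + 4 * (C * n * l))) :=
      mul_le_mul_of_nonneg_left (by linarith) (by positivity)
    have e2 := mul_le_mul_of_nonneg_right ha₁ hnn
    linarith
  linarith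

end Numerics

/-! ### The parameters of the algorithm -/

section Parameters

variable {K M J T : ℕ} {P : Problem K M} {C G : Fin K → ℝ}

theorem sum_inv_sqrt_le (n : ℕ) :
    ∑ t ∈ Finset.range n, 1 / √((t + 1 : ℕ) : ℝ) ≤ 2 * √(n : ℝ) := by
  induction n with
  | zero => simp
  | succ n ih =>
    rw [Finset.sum_range_succ]
    have h1 : 0 < √((n + 1 : ℕ) : ℝ) := Real.sqrt_pos.mpr (by positivity)
    have h2 := Real.sq_sqrt (Nat.cast_nonneg (α := ℝ) (n + 1))
    have h3 := Real.sq_sqrt (Nat.cast_nonneg (α := ℝ) n)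
    have h4 : 1 / √((n + 1 : ℕ) : ℝ) ≤ 2 * √((n + 1 : ℕ) : ℝ) - 2 * √(n : ℝ) := by
      rw [div_le_iff₀ h1]
      push_cast at h2 ⊢
      nlinarith [sq_nonneg (√((n : ℝ) + 1) - √(n : ℝ))]
    linarith

theorem eta_le : eta K J T ≤ √(Real.log (K * T)) / (2 * √((1 + gKJ K J) * T)) := by
  rw [eta]
  split_ifs
  · exact le_rfl
  · exact min_le_left _ _

namespace ValidParams

variable (hv : ValidParams P J T C G)
include hv

theorem log_le_two_mul_log : Real.log (K * T) ≤ 2 * Real.log T := by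
  have h1 : (K : ℝ) ≤ T := by exact_mod_cast hv.le_T
  rw [Real.log_mul hv.K_pos.ne' hv.T_pos.ne']
  linarith [Real.log_le_log hv.K_pos h1]

/-- The eighth root of the horizon, a convenient scale: the logarithm of `K T` is of lower order. -/
theorem exists_eighth_root : ∃ τ : ℝ, 1 ≤ τ ∧ (T : ℝ) = τ ^ 8 ∧ Real.log (K * T) ≤ 16 * τ := by
  have hT := hv.T_pos
  have hT1 : (1 : ℝ) ≤ T := by exact_mod_cast Nat.one_le_iff_ne_zero.mpr (by
    rintro rfl; simp at hT)
  refine ⟨(T : ℝ) ^ (1 / 8 : ℝ), Real.one_le_rpow hT1 (by norm_num), ?_, ?_⟩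
  · rw [← Real.rpow_natCast, ← Real.rpow_mul hT.le]
    norm_num
  · have h1 := Real.log_le_sub_one_of_pos (Real.rpow_pos_of_pos hT (1 / 8 : ℝ))
    rw [Real.log_rpow hT] at h1
    linarith [hv.log_le_two_mul_log]

theorem U_div_lam_le {ρ : ℝ} (hρ : 1 ≤ ρ) (hgT : gKJ K J ^ 2 ≤ ρ ^ 2 * T) (i : Fin K) :
    P.U i / lam K J (P.U i) (G i) (T + 1) ≤ 4 * ρ * G i * √((1 + gKJ K J) * T) := by
  have hg := hv.g_nonneg
  have hU := hv.U_pos i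
  have hG := hv.G_pos i
  have hT1 : (1 : ℝ) ≤ T := by
    have := hv.T_pos
    exact_mod_cast Nat.one_le_iff_ne_zero.mpr (by rintro rfl; simp at this)
  have h1 : √((1 + gKJ K J) * max (gKJ K J ^ 2) ((T + 1 : ℕ) : ℝ))
      ≤ 2 * ρ * √((1 + gKJ K J) * T) := by
    refine Real.sqrt_le_iff.mpr ⟨by positivity, ?_⟩
    rw [mul_pow, Real.sq_sqrt (by positivity)]
    have h2 : max (gKJ K J ^ 2) ((T + 1 : ℕ) : ℝ) ≤ (2 * ρ) ^ 2 * T := by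
      push_cast
      have h3 : (T : ℝ) ≤ ρ ^ 2 * T := le_mul_of_one_le_left (by linarith) (one_le_pow₀ hρ)
      exact max_le (by linarith) (by linarith)
    calc (1 + gKJ K J) * max (gKJ K J ^ 2) ((T + 1 : ℕ) : ℝ)
        ≤ (1 + gKJ K J) * ((2 * ρ) ^ 2 * T) := by gcongr
      _ = _ := by ring
  rw [lam, div_div_eq_mul_div, mul_comm (P.U i), mul_div_assoc, div_self hU.ne', mul_one]
  calc 2 * G i * √((1 + gKJ K J) * max (gKJ K J ^ 2) ((T + 1 : ℕ) : ℝ))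
      ≤ 2 * G i * (2 * ρ * √((1 + gKJ K J) * T)) := by gcongr
    _ = _ := by ring

theorem sum_lam_le (i : Fin K) :
    (1 + gKJ K J) * G i * ∑ t ∈ Finset.range T, lam K J (P.U i) (G i) (t + 1)
      ≤ P.U i * √((1 + gKJ K J) * T) := by
  have hg := hv.g_nonneg
  have hU := hv.U_pos i
  have hG := hv.G_pos i
  have hs : 0 < √(1 + gKJ K J) := Real.sqrt_pos.mpr (by linarith)
  have h1 : ∀ t : ℕ, (1 + gKJ K J) * G i * lam K J (P.U i) (G i) (t + 1)
      ≤ P.U i * √(1 + gKJ K J) / 2 * (1 / √((t + 1 : ℕ) : ℝ)) := by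
    intro t
    have ht : (0 : ℝ) < ((t + 1 : ℕ) : ℝ) := by positivity
    have hst : 0 < √((t + 1 : ℕ) : ℝ) := Real.sqrt_pos.mpr ht
    have h2 : √(1 + gKJ K J) * √((t + 1 : ℕ) : ℝ)
        ≤ √((1 + gKJ K J) * max (gKJ K J ^ 2) ((t + 1 : ℕ) : ℝ)) := by
      rw [← Real.sqrt_mul (by linarith)]
      exact Real.sqrt_le_sqrt (by gcongr; exact le_max_right _ _)
    calc (1 + gKJ K J) * G i * lam K J (P.U i) (G i) (t + 1)
        ≤ (1 + gKJ K J) * G i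
          * (P.U i / (2 * G i * (√(1 + gKJ K J) * √((t + 1 : ℕ) : ℝ)))) := by
          rw [lam]; gcongr
      _ = _ := by
        field_simp
        rw [Real.sq_sqrt (by linarith)]
  rw [Finset.mul_sum]
  refine (Finset.sum_le_sum fun t _ => h1 t).trans ?_
  rw [← Finset.mul_sum, Real.sqrt_mul (by linarith)]
  calc _ ≤ P.U i * √(1 + gKJ K J) / 2 * (2 * √(T : ℝ)) :=
        mul_le_mul_of_nonneg_left (sum_inv_sqrt_le T) (by positivity)
    _ = _ := by ring

theorem lam_one_le (i : Fin K) :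
    lam K J (P.U i) (G i) 1 * (1 + gKJ K J) ^ 2 * G i ≤ 2 * (P.U i * max 1 (gKJ K J)) := by
  have hg := hv.g_nonneg
  have hU := hv.U_pos i
  have hG := hv.G_pos i
  set n := max 1 (gKJ K J) with hn
  have hn1 : 1 ≤ n := le_max_left _ _
  have hng : gKJ K J ≤ n := le_max_right _ _
  have h1 : n ≤ √((1 + gKJ K J) * max (gKJ K J ^ 2) ((1 : ℕ) : ℝ)) := by
    refine Real.le_sqrt_of_sq_le ?_
    have h2 : n ^ 2 ≤ max (gKJ K J ^ 2) ((1 : ℕ) : ℝ) := by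
      rcases max_cases 1 (gKJ K J) with ⟨h, -⟩ | ⟨h, -⟩
      · rw [hn, h]; simp
      · rw [hn, h]; exact le_max_left _ _
    exact h2.trans (le_mul_of_one_le_left ((sq_nonneg n).trans h2) (by linarith))
  calc lam K J (P.U i) (G i) 1 * (1 + gKJ K J) ^ 2 * G i
      ≤ P.U i / (2 * G i * n) * (2 * n) ^ 2 * G i := by
        rw [lam]
        gcongr
        linarith
    _ = _ := by field_simp

theorem inv_eta_le : (eta K J T)⁻¹
    ≤ 2 * √((1 + gKJ K J) * T) / √(Real.log (K * T)) + 2 * gKJ K J := by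
  have hg := hv.g_nonneg
  have hT := hv.T_pos
  have hL := hv.one_le_log
  rw [eta]
  split_ifs with h
  · rw [inv_div]
    linarith
  · have h2 : (2 : ℝ) ≤ J := by exact_mod_cast hv.two_le
    have h3 : (J : ℝ) < K := by exact_mod_cast lt_of_le_of_ne hv.le_K h
    have h4 : (((J : ℝ) - 1) / (2 * ((K : ℝ) - J)))⁻¹ = 2 * gKJ K J := by
      rw [inv_div, gKJ]; ring
    rcases min_cases (√(Real.log (K * T)) / (2 * √((1 + gKJ K J) * T)))
      (((J : ℝ) - 1) / (2 * ((K : ℝ) - J))) with ⟨h5, -⟩ | ⟨h5, -⟩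
    · rw [h5, inv_div]; linarith
    · rw [h5, h4]
      have : 0 ≤ 2 * √((1 + gKJ K J) * T) / √(Real.log (K * T)) := by positivity
      linarith

theorem eta_mul_le_half : eta K J T * (1 + gKJ K J) / 2 ≤ 1 / 2 := by
  have hg := hv.g_nonneg
  have hT := hv.T_pos
  have hη := hv.eta_pos
  rcases le_or_gt (gKJ K J) 1 with h | h
  · have hR : 0 < √((1 + gKJ K J) * T) := Real.sqrt_pos.mpr (by positivity)
    have h1 : √(Real.log (K * T)) * (1 + gKJ K J) ≤ 2 * √((1 + gKJ K J) * T) := by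
      refine le_of_sq_le_sq ?_ (by positivity)
      rw [mul_pow, mul_pow, Real.sq_sqrt (by linarith [hv.one_le_log]), Real.sq_sqrt (by positivity)]
      have h2 : Real.log (K * T) ≤ 2 * T := by
        linarith [hv.log_le_two_mul_log, Real.log_le_sub_one_of_pos hT]
      calc Real.log (K * T) * (1 + gKJ K J) ^ 2 ≤ 2 * T * (1 + gKJ K J) ^ 2 := by gcongr
        _ = 2 * T * (1 + gKJ K J) * (1 + gKJ K J) := by ring
        _ ≤ 2 * T * (1 + gKJ K J) * 2 := by gcongr; linarith
        _ = _ := by ring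
    have h3 := mul_le_mul_of_nonneg_right (eta_le (K := K) (J := J) (T := T))
      (by linarith : 0 ≤ 1 + gKJ K J)
    have h4 : √(Real.log (K * T)) / (2 * √((1 + gKJ K J) * T)) * (1 + gKJ K J) ≤ 1 := by
      rw [div_mul_eq_mul_div, div_le_one (by positivity)]
      exact h1
    linarith
  · have hne : J ≠ K := by
      rintro rfl
      simp [gKJ] at h
      linarith
    have h2 : (2 : ℝ) ≤ J := by exact_mod_cast hv.two_le
    have h3 : (J : ℝ) < K := by exact_mod_cast lt_of_le_of_ne hv.le_K hne
    have h4 : eta K J T ≤ 1 / (2 * gKJ K J) := by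
      rw [eta, if_neg hne]
      refine (min_le_right _ _).trans (le_of_eq ?_)
      rw [gKJ]
      field_simp
    have h5 : eta K J T * (2 * gKJ K J) ≤ 1 := by
      rwa [le_div_iff₀ (by linarith)] at h4
    nlinarith

theorem eta_mul_T_le :
    4 * (eta K J T * (1 + gKJ K J) / 2 * T)
      ≤ √(Real.log (K * T)) * √((1 + gKJ K J) * T) := by
  have hg := hv.g_nonneg
  have hT := hv.T_pos
  have hR : 0 < √((1 + gKJ K J) * T) := Real.sqrt_pos.mpr (by positivity)
  have hR2 := Real.mul_self_sqrt (show 0 ≤ (1 + gKJ K J) * T by positivity)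
  have hη : eta K J T ≤ √(Real.log (K * T)) / (2 * √((1 + gKJ K J) * T)) := eta_le
  set R := √((1 + gKJ K J) * T)
  calc 4 * (eta K J T * (1 + gKJ K J) / 2 * T)
      = 2 * ((1 + gKJ K J) * T) * eta K J T := by ring
    _ ≤ 2 * ((1 + gKJ K J) * T) * (√(Real.log (K * T)) / (2 * R)) := by gcongr
    _ = _ := by
      rw [← hR2]
      field_simp

/-- The initial distribution is close to the vertex `i` in the weighted divergence: it charges every
index at least `1 / √(K T)`, and its mean of `C` is comparable to `C i`. -/
theorem vertexDiv_initDist_le {ρ Cm : ℝ} (hρ : 1 ≤ ρ) (hCm : ∀ k, C k ≤ Cm) (i : Fin K)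
    (hCT : K * Cm ^ 2 ≤ ρ ^ 2 * (C i ^ 2 * T)) :
    vertexDiv C (eta K J T) i (initDist T C)
      ≤ 3 * ρ * (C i * √(Real.log (K * T)) * √((1 + gKJ K J) * T)
        + C i * (gKJ K J * Real.log (K * T))) := by
  have hη := hv.eta_pos
  have hC := hv.C_pos i
  have hL := hv.one_le_log
  have hK := hv.K_pos
  have hT := hv.T_pos
  have hg := hv.g_nonneg
  have hKT : (0 : ℝ) < K * T := by positivity
  set L := Real.log (K * T) with hLdef
  have hsq : 0 < √((K : ℝ) * T) := Real.sqrt_pos.mpr hKT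
  have hlog : -Real.log (initDist T C i) ≤ L / 2 := by
    have h1 := Real.log_le_log (one_div_pos.mpr hsq) (hv.initDist_ge i)
    rw [one_div, Real.log_inv, Real.log_sqrt hKT.le] at h1
    linarith
  have hmean : ∑ k, initDist T C k * C k ≤ C i + ρ * C i := by
    rw [sum_initDist_mul]
    have hcard : (0 : ℝ) < (argminSet C).card := by
      exact_mod_cast hv.argminSet_nonempty.card_pos
    have h1 : (∑ k ∈ argminSet C, C k) / (argminSet C).card ≤ C i := by
      rw [div_le_iff₀ hcard, mul_comm, ← nsmul_eq_mul, ← Finset.sum_const]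
      refine Finset.sum_le_sum fun k hk => ?_
      simp only [argminSet, Finset.mem_filter, Finset.mem_univ, true_and] at hk
      exact hk i
    have h2 : 0 ≤ (∑ k ∈ argminSet C, C k) / (argminSet C).card :=
      div_nonneg (Finset.sum_nonneg fun k _ => (hv.C_pos k).le) hcard.le
    have h3 : 0 ≤ √(K : ℝ) / √(T : ℝ) := by positivity
    have h4 : (1 - √(K : ℝ) / √(T : ℝ)) * ((∑ k ∈ argminSet C, C k) / (argminSet C).card)
        ≤ C i := by nlinarith
    have h5 : (∑ k, C k) / √((K : ℝ) * T) ≤ ρ * C i := by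
      rw [div_le_iff₀ hsq]
      have h6 : ∑ k, C k ≤ K * Cm := by
        have := Finset.sum_le_sum fun k (_ : k ∈ Finset.univ) => hCm k
        simpa using this
      refine h6.trans (le_of_sq_le_sq ?_ (by positivity))
      rw [mul_pow, mul_pow, Real.sq_sqrt hKT.le]
      calc (K : ℝ) ^ 2 * Cm ^ 2 = K * (K * Cm ^ 2) := by ring
        _ ≤ K * (ρ ^ 2 * (C i ^ 2 * T)) := by gcongr
        _ = _ := by ring
    linarith
  have h1 : ∑ k, C k / eta K J T * initDist T C k = (eta K J T)⁻¹ * ∑ k, initDist T C k * C k := by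
    rw [Finset.mul_sum]
    exact Finset.sum_congr rfl fun k _ => by ring
  have hη' : 0 < (eta K J T)⁻¹ := inv_pos.mpr hη
  have h2 : vertexDiv C (eta K J T) i (initDist T C) ≤ (eta K J T)⁻¹ * (3 / 2 * ρ * (C i * L)) := by
    rw [vertexDiv, h1]
    have e1 : C i / eta K J T * (-Real.log (initDist T C i) - 1)
        ≤ (eta K J T)⁻¹ * (C i * (L / 2 - 1)) := by
      rw [div_eq_inv_mul, mul_assoc]
      gcongr
    have e2 := mul_le_mul_of_nonneg_left hmean hη'.le
    have e3 : C i * (L / 2 - 1) + (C i + ρ * C i) ≤ 3 / 2 * ρ * (C i * L) := by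
      have : C i ≤ C i * L := le_mul_of_one_le_right hC.le hL
      nlinarith [mul_le_mul_of_nonneg_left this (by linarith : 0 ≤ ρ),
        mul_le_mul_of_nonneg_right hρ (mul_nonneg hC.le (by linarith : 0 ≤ L))]
    have e4 := mul_le_mul_of_nonneg_left e3 hη'.le
    linarith
  refine h2.trans ?_
  have h3 := mul_le_mul_of_nonneg_right hv.inv_eta_le
    (by positivity : 0 ≤ 3 / 2 * ρ * (C i * L))
  refine h3.trans (le_of_eq ?_)
  have hsL : 0 < √L := Real.sqrt_pos.mpr (by linarith)
  have hLL : L / √L = √L := Real.div_sqrt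
  rw [← hLdef]
  calc (2 * √((1 + gKJ K J) * T) / √L + 2 * gKJ K J) * (3 / 2 * ρ * (C i * L))
      = 3 * ρ * (C i * (L / √L) * √((1 + gKJ K J) * T) + C i * (gKJ K J * L)) := by ring
    _ = _ := by rw [hLL]

/-- The excess terms of the comparator path are of lower order than `T`. -/
theorem path_excess_le {ρ τ : ℝ} (hρ : 1 ≤ ρ)
    (hτ : 1 ≤ τ) (hT : (T : ℝ) = τ ^ 8) (hgT : gKJ K J ^ 2 ≤ ρ ^ 2 * T) (i : Fin K) {Δ : ℝ}
    (hΔ : Δ ≤ P.U i ^ 2 * G i / (P.U i * G i / τ)) :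
    ∑ t ∈ Finset.range T, max (P.U i * G i / τ)
        (lam K J (P.U i) (G i) (t + 1) * (1 + gKJ K J) * G i ^ 2)
      + P.U i ^ 2 / lam K J (P.U i) (G i) (T + 1)
      + 2 * P.U i * Δ / lam K J (P.U i) (G i) (T + 1)
      ≤ 27 * ρ ^ 2 * (P.U i * G i) * τ ^ 7 := by
  have hg := hv.g_nonneg
  have hU := hv.U_pos i
  have hG := hv.G_pos i
  have hl := hv.lam_pos i
  have hUl := hv.U_div_lam_le hρ hgT i
  have hR : √((1 + gKJ K J) * T) ≤ 2 * ρ * τ ^ 6 := by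
    rw [sqrt_one_add_mul hg hT hτ]
    calc √(1 + gKJ K J) * τ ^ 4 ≤ 2 * ρ * τ ^ 2 * τ ^ 4 := by
          gcongr
          exact sqrt_one_add_le hgT hT hτ hρ
      _ = _ := by ring
  set R := √((1 + gKJ K J) * T) with hRdef
  have hR0 : 0 ≤ R := Real.sqrt_nonneg _
  have h1 : ∑ t ∈ Finset.range T, max (P.U i * G i / τ)
        (lam K J (P.U i) (G i) (t + 1) * (1 + gKJ K J) * G i ^ 2)
      ≤ P.U i * G i * τ ^ 7 + P.U i * G i * R := by
    calc _ ≤ ∑ t ∈ Finset.range T, (P.U i * G i / τ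
            + lam K J (P.U i) (G i) (t + 1) * (1 + gKJ K J) * G i ^ 2) := by
          refine Finset.sum_le_sum fun t _ => max_le_add_of_nonneg (by positivity) ?_
          have := hl t
          positivity
      _ = P.U i * G i * τ ^ 7 + G i * ((1 + gKJ K J) * G i
            * ∑ t ∈ Finset.range T, lam K J (P.U i) (G i) (t + 1)) := by
          rw [Finset.sum_add_distrib, Finset.sum_const, Finset.card_range, nsmul_eq_mul, hT,
            ← Finset.sum_mul, ← Finset.sum_mul]
          field_simp
      _ ≤ P.U i * G i * τ ^ 7 + G i * (P.U i * R) := by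
          exact add_le_add le_rfl (mul_le_mul_of_nonneg_left (hv.sum_lam_le i) hG.le)
      _ = _ := by ring
  have h2 : P.U i ^ 2 / lam K J (P.U i) (G i) (T + 1) ≤ 4 * ρ * (P.U i * G i) * R := by
    calc P.U i ^ 2 / lam K J (P.U i) (G i) (T + 1)
        = P.U i * (P.U i / lam K J (P.U i) (G i) (T + 1)) := by ring
      _ ≤ P.U i * (4 * ρ * G i * R) := by gcongr
      _ = _ := by ring
  have hΔ' : Δ ≤ P.U i * τ := by
    refine hΔ.trans (le_of_eq ?_)
    field_simp
  have h3 : 2 * P.U i * Δ / lam K J (P.U i) (G i) (T + 1) ≤ 8 * ρ * (P.U i * G i) * (R * τ) := by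
    have h4 := hl T
    calc 2 * P.U i * Δ / lam K J (P.U i) (G i) (T + 1)
        ≤ 2 * P.U i * (P.U i * τ) / lam K J (P.U i) (G i) (T + 1) := by gcongr
      _ = 2 * P.U i * τ * (P.U i / lam K J (P.U i) (G i) (T + 1)) := by ring
      _ ≤ 2 * P.U i * τ * (4 * ρ * G i * R) := by gcongr
      _ = _ := by ring
  have h5 : R * τ ≤ 2 * ρ * τ ^ 7 := by
    calc R * τ ≤ 2 * ρ * τ ^ 6 * τ := by gcongr
      _ = _ := by ring
  have h6 : R ≤ 2 * ρ * τ ^ 7 := (le_mul_of_one_le_right hR0 hτ).trans h5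
  have hUG : 0 < P.U i * G i := mul_pos hU hG
  set x := P.U i * G i
  have hτ7 : 0 ≤ τ ^ 7 := by positivity
  have h7 : x * R ≤ 2 * ρ ^ 2 * x * τ ^ 7 :=
    calc x * R ≤ x * (2 * ρ * τ ^ 7) := by gcongr
      _ = 2 * ρ * x * τ ^ 7 := by ring
      _ ≤ _ := by gcongr; nlinarith
  have h8 : 4 * ρ * x * R ≤ 8 * ρ ^ 2 * x * τ ^ 7 :=
    calc 4 * ρ * x * R ≤ 4 * ρ * x * (2 * ρ * τ ^ 7) := by gcongr
      _ = _ := by ring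
  have h9 : 8 * ρ * x * (R * τ) ≤ 16 * ρ ^ 2 * x * τ ^ 7 :=
    calc 8 * ρ * x * (R * τ) ≤ 8 * ρ * x * (2 * ρ * τ ^ 7) := by gcongr
      _ = _ := by ring
  have h10 : x * τ ^ 7 ≤ ρ ^ 2 * x * τ ^ 7 := by
    gcongr
    exact le_mul_of_one_le_left hUG.le (one_le_pow₀ hρ)
  linarith

end ValidParams

end Parameters

/-! ### Deterministic comparator values -/

section Comparator

variable {K M J T : ℕ} [NeZero J] {P : Problem K M} {C G : Fin K → ℝ}
  {Ω : Type*} [mΩ : MeasurableSpace Ω] {μ : Measure Ω} [IsProbabilityMeasure μ]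
  {A : ℕ → Fin M → Ω → Fin J → Fin K}

/-- Every comparator `u` can be replaced by deterministic values `v_t` with `∑ v_t² = O(C_i² T)` up
to terms of lower order. Truncating the losses of `u` at `C_i + 2 U_i G_i` gives such values unless the
losses of `u` exceed `C_i` by much; in that case the losses on the path of `exists_path`, which
never exceed `C_i`, are so much smaller than those of `u` that the difference pays for the motion
of the path. -/
theorem exists_comparator (hv : ValidParams P J T C G) (hA : IsSampling μ P J T C G A)
    (hsub : IsSubgradient P.loss P.dloss) (j : Fin M)
    (hb : ∀ ω, BoundedAlong P J T C G j (draws A j ω)) (i : Fin K)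
    {u : EuclideanSpace ℝ (Fin (P.dim i))} (hu : ‖u‖ ≤ P.U i) {ρ τ : ℝ} (hρ : 1 ≤ ρ)
    (hτ : 1 ≤ τ) (hT : (T : ℝ) = τ ^ 8) (hgT : gKJ K J ^ 2 ≤ ρ ^ 2 * T) :
    ∃ v : ℕ → ℝ, (∀ t < T, |v t| ≤ C i + 2 * (P.U i * G i)) ∧
      gKJ K J * ∑ t ∈ Finset.range T, v t ^ 2 ≤ gKJ K J * (2 * (C i ^ 2 * T)
        + 8 * (P.U i * G i) * min (27 * ρ ^ 2 * (P.U i * G i) * τ ^ 7) (P.U i * G i * T)) ∧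
      ∀ ω, ∑ t ∈ Finset.range T, weight P J T C G j (draws A j ω) t i
          * (cost P J T C G j (draws A j ω) t i - v t)
        + ∑ t ∈ Finset.range T, (v t - hypLoss P j t i u)
        ≤ 2 * P.U i ^ 2 / lam K J (P.U i) (G i) (T + 1)
          + G i ^ 2 / 2 * ∑ t ∈ Finset.range T,
            lam K J (P.U i) (G i) (t + 1) * weight P J T C G j (draws A j ω) t i ^ 2 := by
  have hU := hv.U_pos i
  have hG := hv.G_pos i
  have hC := hv.C_pos i
  have hg := hv.g_nonneg
  have hUG : 0 < P.U i * G i := mul_pos hU hG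
  have hTpos := hv.T_pos
  set x := P.U i * G i with hx
  set â : ℕ → ℝ := fun t => min (hypLoss P j t i u) (C i + 2 * x) with hâ
  have hinner : ∀ ω, ∀ t < T, |inner ℝ (hypGrad P j t i (param P J T C G j (draws A j ω) t i))
      (param P J T C G j (draws A j ω) t i - u)| ≤ 2 * x := by
    intro ω t ht
    refine (abs_real_inner_le_norm _ _).trans ?_
    have h1 := (hb ω t ht i).2.2
    have h2 := norm_sub_le (param P J T C G j (draws A j ω) t i) u
    have h3 := hv.norm_param_le j (draws A j ω) t i
    calc _ ≤ G i * (2 * P.U i) := mul_le_mul h1 (by linarith) (norm_nonneg _) hG.le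
      _ = 2 * x := by rw [hx]; ring
  have ha : ∀ ω, ∀ t < T, cost P J T C G j (draws A j ω) t i - â t ≤ inner ℝ
      (hypGrad P j t i (param P J T C G j (draws A j ω) t i))
      (param P J T C G j (draws A j ω) t i - u) := by
    intro ω t ht
    have h1 := hypLoss_sub_le hsub j t i (param P J T C G j (draws A j ω) t i) u
    have h2 := (abs_le.mp (hinner ω t ht)).1
    have h3 := (hb ω t ht i).2.1
    simp only [hâ]
    rcases min_cases (hypLoss P j t i u) (C i + 2 * x) with ⟨h, -⟩ | ⟨h, -⟩
    · rw [h]; exact h1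
    · rw [h]; linarith
  obtain ⟨ω₁⟩ : Nonempty Ω := nonempty_of_isProbabilityMeasure μ
  have hlow : ∀ t < T, -(2 * x) ≤ â t := by
    intro t ht
    have h1 := ha ω₁ t ht
    have h2 := (abs_le.mp (hinner ω₁ t ht)).2
    have h3 := (hb ω₁ t ht i).1
    linarith
  have hupp : ∀ t, â t ≤ C i + 2 * x := fun t => min_le_right _ _
  have habs : ∀ t < T, |â t| ≤ C i + 2 * x := fun t ht =>
    abs_le.mpr ⟨by linarith [hlow t ht], hupp t⟩
  -- squares of the truncated losses, in terms of the excess outside `[0, C_i]`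
  have hsq : ∀ t < T, â t ^ 2 ≤ 2 * C i ^ 2 + 4 * x * (max (â t - C i) 0 + max (-â t) 0) := by
    intro t ht
    have h1 := hlow t ht
    have h2 := hupp t
    rcases le_or_gt (â t) 0 with h | h
    · rw [max_eq_right (by linarith), max_eq_left (by linarith)]
      nlinarith
    · rcases le_or_gt (â t) (C i) with h' | h'
      · rw [max_eq_right (by linarith), max_eq_right (by linarith)]
        nlinarith
      · rw [max_eq_left (by linarith), max_eq_right (by linarith)]
        nlinarith [sq_nonneg (C i - (â t - C i))]
  have hexc : ∀ t < T, max (â t - C i) 0 + max (-â t) 0 ≤ 2 * x := by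
    intro t ht
    have h1 := hlow t ht
    have h2 := hupp t
    rcases le_or_gt (â t) 0 with h | h
    · rw [max_eq_right (by linarith), max_eq_left (by linarith)]
      linarith
    · rw [max_eq_right (by linarith : -â t ≤ 0), add_zero]
      exact max_le (by linarith) (by linarith)
  have hsum : ∑ t ∈ Finset.range T, â t ^ 2 ≤ 2 * (C i ^ 2 * T)
      + 4 * x * (∑ t ∈ Finset.range T, max (â t - C i) 0 + ∑ t ∈ Finset.range T, max (-â t) 0) := by
    refine (Finset.sum_le_sum fun t ht => hsq t (Finset.mem_range.mp ht)).trans (le_of_eq ?_)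
    simp only [mul_add, Finset.sum_add_distrib, ← Finset.mul_sum, Finset.sum_const,
      Finset.card_range, nsmul_eq_mul]
    ring
  have hsumexc : ∑ t ∈ Finset.range T, max (â t - C i) 0 + ∑ t ∈ Finset.range T, max (-â t) 0
      ≤ 2 * (x * T) := by
    rw [← Finset.sum_add_distrib]
    refine (Finset.sum_le_sum fun t ht => hexc t (Finset.mem_range.mp ht)).trans (le_of_eq ?_)
    rw [Finset.sum_const, Finset.card_range, nsmul_eq_mul]
    ring
  -- the gradient steps compete with the fixed comparator
  have hstatic : ∀ ω, ∑ t ∈ Finset.range T, weight P J T C G j (draws A j ω) t i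
          * (cost P J T C G j (draws A j ω) t i - â t)
        + ∑ t ∈ Finset.range T, (â t - hypLoss P j t i u)
        ≤ 2 * P.U i ^ 2 / lam K J (P.U i) (G i) (T + 1)
          + G i ^ 2 / 2 * ∑ t ∈ Finset.range T,
            lam K J (P.U i) (G i) (t + 1) * weight P J T C G j (draws A j ω) t i ^ 2 := by
    intro ω
    have h1 := hv.sum_weight_inner_le j (hb ω) i (fun _ => u) (fun _ => hu)
    have h2 : ∑ t ∈ Finset.range T, (â t - hypLoss P j t i u) ≤ 0 :=
      Finset.sum_nonpos fun t _ => sub_nonpos.mpr (min_le_left _ _)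
    have h3 : ∑ t ∈ Finset.range T, weight P J T C G j (draws A j ω) t i
          * (cost P J T C G j (draws A j ω) t i - â t)
        ≤ ∑ t ∈ Finset.range T, weight P J T C G j (draws A j ω) t i * inner ℝ
          (hypGrad P j t i (param P J T C G j (draws A j ω) t i))
          (param P J T C G j (draws A j ω) t i - u) :=
      Finset.sum_le_sum fun t ht => mul_le_mul_of_nonneg_left (ha ω t (Finset.mem_range.mp ht))
        (hv.weight_nonneg _ _ _ _)
    simp only [sub_self, norm_zero, Finset.sum_const_zero, mul_zero, add_zero] at h1
    linarith
  rcases hv.le_K.eq_or_lt with hJK | hJK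
  · have hg0 : gKJ K J = 0 := by rw [gKJ, hJK]; simp
    exact ⟨â, habs, by rw [hg0, zero_mul, zero_mul], hstatic⟩
  · obtain ⟨ω₀, hpath, hlen⟩ := exists_path hv hA hJK j hb i hu â ha
      (θ := x / τ) (by positivity)
    set Q := 27 * ρ ^ 2 * x * τ ^ 7 with hQ
    have hQbound := hv.path_excess_le hρ hτ hT hgT i hlen
    set Δ := ∑ t ∈ Finset.range T,
      ‖param P J T C G j (draws A j ω₀) (t + 1) i - param P J T C G j (draws A j ω₀) t i‖
    have hlT := hv.lam_pos i T
    have hΔ0 : 0 ≤ 2 * P.U i * Δ / lam K J (P.U i) (G i) (T + 1) := by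
      have : 0 ≤ Δ := Finset.sum_nonneg fun _ _ => norm_nonneg _
      positivity
    have hc₀ := fun t ht => hb ω₀ t ht i
    have hneg : ∑ t ∈ Finset.range T, max (-â t) 0
        ≤ ∑ t ∈ Finset.range T, max (cost P J T C G j (draws A j ω₀) t i - â t) 0 :=
      Finset.sum_le_sum fun t ht => by
        have := (hc₀ t (Finset.mem_range.mp ht)).1
        gcongr
        linarith
    rcases lt_or_ge (∑ t ∈ Finset.range T, max (â t - C i) 0) Q with hcase | hcase
    · refine ⟨â, habs, mul_le_mul_of_nonneg_left (hsum.trans ?_) hg, hstatic⟩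
      have h1 : ∑ t ∈ Finset.range T, max (â t - C i) 0 + ∑ t ∈ Finset.range T, max (-â t) 0
          ≤ 2 * min Q (x * T) := by
        rcases min_cases Q (x * T) with ⟨h, -⟩ | ⟨h, -⟩
        · rw [h]; linarith
        · rw [h]; exact hsumexc
      have := mul_le_mul_of_nonneg_left h1 (by positivity : 0 ≤ 4 * x)
      linarith
    · refine ⟨fun t => cost P J T C G j (draws A j ω₀) t i, fun t ht => ?_, ?_, fun ω => ?_⟩
      · rw [abs_of_nonneg (hc₀ t ht).1]
        linarith [(hc₀ t ht).2.1]
      · refine mul_le_mul_of_nonneg_left ?_ hg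
        have h1 : ∑ t ∈ Finset.range T, cost P J T C G j (draws A j ω₀) t i ^ 2
            ≤ ∑ t ∈ Finset.range T, C i ^ 2 := Finset.sum_le_sum fun t ht =>
          pow_le_pow_left₀ (hc₀ t (Finset.mem_range.mp ht)).1 (hc₀ t (Finset.mem_range.mp ht)).2.1 2
        rw [Finset.sum_const, Finset.card_range, nsmul_eq_mul] at h1
        have h2 : 0 ≤ 8 * x * min Q (x * T) := by
          have : 0 ≤ min Q (x * T) := le_min (by positivity) (by positivity)
          positivity
        have h3 : 0 ≤ C i ^ 2 * T := by positivity
        linarith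
      · have h1 := hv.sum_weight_inner_le j (hb ω) i
          (fun t => param P J T C G j (draws A j ω₀) t i) (fun t => hv.norm_param_le j _ t i)
        have h2 : ∑ t ∈ Finset.range T, weight P J T C G j (draws A j ω) t i
              * (cost P J T C G j (draws A j ω) t i - cost P J T C G j (draws A j ω₀) t i)
            ≤ ∑ t ∈ Finset.range T, weight P J T C G j (draws A j ω) t i * inner ℝ
              (hypGrad P j t i (param P J T C G j (draws A j ω) t i))
              (param P J T C G j (draws A j ω) t i - param P J T C G j (draws A j ω₀) t i) :=
          Finset.sum_le_sum fun t _ => mul_le_mul_of_nonneg_left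
            (hypLoss_sub_le hsub j t i _ _) (hv.weight_nonneg _ _ _ _)
        have h3 : ∑ t ∈ Finset.range T, (cost P J T C G j (draws A j ω₀) t i - hypLoss P j t i u)
            ≤ ∑ t ∈ Finset.range T, max (cost P J T C G j (draws A j ω₀) t i - â t) 0
              - ∑ t ∈ Finset.range T, max (â t - C i) 0 := by
          rw [← Finset.sum_sub_distrib]
          refine Finset.sum_le_sum fun t ht => ?_
          have e1 := (hc₀ t (Finset.mem_range.mp ht)).2.1
          have e2 : â t ≤ hypLoss P j t i u := min_le_left _ _
          rcases le_or_gt (â t) (C i) with h | h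
          · rw [max_eq_right (by linarith : â t - C i ≤ 0)]
            linarith [le_max_left (cost P J T C G j (draws A j ω₀) t i - â t) 0]
          · rw [max_eq_left (by linarith : 0 ≤ â t - C i)]
            linarith [le_max_right (cost P J T C G j (draws A j ω₀) t i - â t) 0]
        rw [add_div] at h1
        linarith

end Comparator

/-! ### The regret in terms of the deviations -/

section Combination

variable {g T ρ τ L l : ℝ}

theorem sqrt_comparator_variance_le {W Ci x l' : ℝ} (hg : 0 ≤ g) (hT : T = τ ^ 8) (hτ : 1 ≤ τ)
    (hρ : 1 ≤ ρ) (hL0 : 0 ≤ L) (hL : L ≤ 16 * τ) (hl : 0 ≤ l) (hCi : 0 ≤ Ci) (hx : 0 ≤ x)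
    (hl' : l' ≤ L + l) (hl0 : 0 ≤ l')
    (hW : W ≤ g * (2 * (Ci ^ 2 * T) + 8 * x * min (27 * ρ ^ 2 * x * τ ^ 7) (x * T))) :
    √(W * l') ≤ 2 * (Ci * √L * √((1 + g) * T)) + 2 * (Ci * √(g * T * l))
      + 59 * (ρ * (x * √((1 + g) * T))) + 3 * (x * √(g * T * l)) := by
  have hT0 : 0 ≤ T := by rw [hT]; positivity
  have hR2 : √((1 + g) * T) ^ 2 = (1 + g) * T := Real.sq_sqrt (by positivity)
  have hs2 : √(g * T * l) ^ 2 = g * T * l := Real.sq_sqrt (by positivity)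
  have hL2 : √L ^ 2 = L := Real.sq_sqrt hL0
  have hm0 : 0 ≤ min (27 * ρ ^ 2 * x * τ ^ 7) (x * T) := le_min (by positivity) (by positivity)
  have e1 : min (27 * ρ ^ 2 * x * τ ^ 7) (x * T) * L ≤ 432 * ρ ^ 2 * x * T :=
    calc min (27 * ρ ^ 2 * x * τ ^ 7) (x * T) * L ≤ 27 * ρ ^ 2 * x * τ ^ 7 * (16 * τ) :=
          mul_le_mul (min_le_left _ _) hL hL0 (by positivity)
      _ = _ := by rw [hT]; ring
  have e2 : min (27 * ρ ^ 2 * x * τ ^ 7) (x * T) * l ≤ x * T * l :=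
    mul_le_mul_of_nonneg_right (min_le_right _ _) hl
  have e3 : W * l' ≤ g * (2 * (Ci ^ 2 * T) * (L + l)
      + 8 * x * (432 * ρ ^ 2 * x * T + x * T * l)) := by
    calc W * l' ≤ g * (2 * (Ci ^ 2 * T) + 8 * x * min (27 * ρ ^ 2 * x * τ ^ 7) (x * T)) * l' :=
          mul_le_mul_of_nonneg_right hW hl0
      _ ≤ g * (2 * (Ci ^ 2 * T) + 8 * x * min (27 * ρ ^ 2 * x * τ ^ 7) (x * T)) * (L + l) :=
          mul_le_mul_of_nonneg_left hl' (by positivity)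
      _ = g * (2 * (Ci ^ 2 * T) * (L + l) + 8 * x * (min (27 * ρ ^ 2 * x * τ ^ 7) (x * T) * L
          + min (27 * ρ ^ 2 * x * τ ^ 7) (x * T) * l)) := by ring
      _ ≤ _ := by gcongr
  set R := √((1 + g) * T)
  set s := √(g * T * l)
  have hR0 : 0 ≤ R := Real.sqrt_nonneg _
  have hs0 : 0 ≤ s := Real.sqrt_nonneg _
  have hgT : g * T ≤ R ^ 2 := by rw [hR2]; linarith
  set a := 2 * (Ci * √L * R) with ha
  set b := 2 * (Ci * s) with hb
  set c := 59 * (ρ * (x * R)) with hc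
  set d := 3 * (x * s) with hd
  have ha0 : 0 ≤ a := by positivity
  have hb0 : 0 ≤ b := by positivity
  have hc0 : 0 ≤ c := by positivity
  have hd0 : 0 ≤ d := by positivity
  refine Real.sqrt_le_iff.mpr ⟨by positivity, e3.trans ?_⟩
  have h1 : g * (2 * (Ci ^ 2 * T) * L) ≤ a ^ 2 := by
    have : a ^ 2 = 4 * (Ci ^ 2 * L * R ^ 2) := by
      have : a ^ 2 = 4 * (Ci ^ 2 * √L ^ 2 * R ^ 2) := by rw [ha]; ring
      rw [this, hL2]
    rw [this]
    have := mul_le_mul_of_nonneg_left hgT (by positivity : 0 ≤ Ci ^ 2 * L)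
    have h0 : 0 ≤ Ci ^ 2 * L * (g * T) := by positivity
    linarith
  have h2 : g * (2 * (Ci ^ 2 * T) * l) ≤ b ^ 2 := by
    have : b ^ 2 = 4 * (Ci ^ 2 * s ^ 2) := by rw [hb]; ring
    rw [this, hs2]
    have h0 : 0 ≤ Ci ^ 2 * (g * T * l) := by positivity
    linarith
  have h3 : g * (8 * x * (432 * ρ ^ 2 * x * T)) ≤ c ^ 2 := by
    have : c ^ 2 = 3481 * (ρ ^ 2 * x ^ 2 * R ^ 2) := by rw [hc]; ring
    rw [this]
    have := mul_le_mul_of_nonneg_left hgT (by positivity : 0 ≤ ρ ^ 2 * x ^ 2)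
    have h0 : 0 ≤ ρ ^ 2 * x ^ 2 * (g * T) := by positivity
    linarith
  have h4 : g * (8 * x * (x * T * l)) ≤ d ^ 2 := by
    have : d ^ 2 = 9 * (x ^ 2 * s ^ 2) := by rw [hd]; ring
    rw [this, hs2]
    have h0 : 0 ≤ x ^ 2 * (g * T * l) := by positivity
    linarith
  have h5 : a ^ 2 + b ^ 2 + c ^ 2 + d ^ 2 ≤ (a + b + c + d) ^ 2 := by
    have := mul_nonneg ha0 hb0
    have := mul_nonneg ha0 hc0
    have := mul_nonneg ha0 hd0
    have := mul_nonneg hb0 hc0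
    have := mul_nonneg hb0 hd0
    have := mul_nonneg hc0 hd0
    linarith
  linarith

set_option maxHeartbeats 1000000 in
/-- The regret of one client against the hypothesis `i`, from the deviation bounds. Here `X` is the
total loss of the predictions, `Y` its conditional mean, `Z` the estimate of `Y`, `B` the estimated
total loss of the hypothesis `i` and `A` the total loss of the comparator; `x = U_i G_i`, and `W`
and `S` are the variance and the deviation that belong to the deterministic comparator values. -/
theorem regret_le_of_deviations {X Y Z B A D₀ α C Ci D W S Q x l' : ℝ} (hC : Ci ≤ C)
    (hCi : 0 < Ci) (hx : 0 < x) (hD : Ci ≤ D) (hD2 : D ≤ 2 * ρ * Ci) (hg : 0 ≤ g)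
    (hgT : g ^ 2 ≤ ρ ^ 2 * T) (hT : T = τ ^ 8) (hτ : 1 ≤ τ) (hρ : 1 ≤ ρ) (hL1 : 1 ≤ L)
    (hL : L ≤ 16 * τ) (hl : 0 < l) (hl0 : 0 < l') (hl' : l' ≤ L + l)
    (halt : 1 ≤ ρ ^ 2 * g ∨ C * l ≤ ρ ^ 2 * (Ci * L))
    (hY0 : 0 ≤ Y) (hZ0 : 0 ≤ Z) (hD0 : 0 ≤ D₀) (hα0 : 0 ≤ α) (hα : α ≤ 1 / 2)
    (h1 : 1 / (2 * C + √(C * D * T / l)) * (X - Y)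
      ≤ (1 / (2 * C + √(C * D * T / l))) ^ 2 * C * Y + l)
    (h2 : 1 / (2 * C * max 1 g + √(g * C * D * T / l)) * (Y - Z)
      ≤ (1 / (2 * C * max 1 g + √(g * C * D * T / l))) ^ 2 * (g * C) * Y + l)
    (h3 : Z ≤ B + D₀ + α * Z) (h4 : B ≤ 2 * (T * Ci) + 2 * (Ci * (max 1 g * l')))
    (hD₀ : D₀ ≤ 3 * ρ * (Ci * √L * √((1 + g) * T) + Ci * (g * L)))
    (hαT : 4 * (α * T) ≤ √L * √((1 + g) * T))
    (h5 : B - A ≤ 8 * (ρ * (x * √((1 + g) * T))) + Q + S)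
    (hQ : Q ≤ x * √((1 + g) * T) + x * (max 1 g * l'))
    (hW0 : 0 ≤ W)
    (hW : W ≤ g * (2 * (Ci ^ 2 * T) + 8 * x * min (27 * ρ ^ 2 * x * τ ^ 7) (x * T)))
    (hS : 1 / ((Ci + 2 * x) * max 1 g + √(W / l')) * S
      ≤ (1 / ((Ci + 2 * x) * max 1 g + √(W / l'))) ^ 2 * W + l') :
    X - A ≤ 25600 * ρ ^ 4 * ((x + Ci * √L) * √((1 + g) * T) + (C + x) * g * l
      + (x + √(C * Ci)) * √(g * T * l)) := by
  have hC0 : 0 < C := hCi.trans_le hC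
  have hT0 : 0 ≤ T := by rw [hT]; positivity
  have hL0 : 0 ≤ L := by linarith
  have hn1 : 1 ≤ max 1 g := le_max_left _ _
  have hng : g ≤ max 1 g := le_max_right _ _
  set n := max 1 g with hn
  have hn0 : 0 ≤ n := by linarith
  set q := n * (L + l) with hq
  have hq0 : 0 ≤ q := by positivity
  have hnl : n * l' ≤ q := mul_le_mul_of_nonneg_left hl' hn0
  have hlL : 1 ≤ ρ ^ 2 * g ∨ l ≤ ρ ^ 2 * L := by
    refine halt.imp_right fun h => le_of_mul_le_mul_left ?_ hCi
    calc Ci * l ≤ C * l := by gcongr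
      _ ≤ ρ ^ 2 * (Ci * L) := h
      _ = _ := by ring
  have hqE : q ≤ 64 * ρ ^ 3 * (√((1 + g) * T) + g * l) :=
    max_mul_log_add_le hg hgT hT hτ hρ hL0 hL hl.le hlL
  have hCnl := mul_max_mul_le hC0.le hCi.le hg hT hτ hρ hL1 hL hl.le halt
  have hv1 := sqrt_variance_le hC0.le hCi.le hg hT0 hρ hL0 hl.le hD2 halt
  have hv2 := sqrt_variance_mul_le hC0.le hCi.le hg hT0 hρ hl.le hD2
  have hv3 := sqrt_comparator_variance_le hg hT hτ hρ hL0 hL hl.le hCi.le hx.le hl' hl0.le hW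
  have h4' : B ≤ 2 * (T * Ci) + 2 * (Ci * q) := by
    have := mul_le_mul_of_nonneg_left hnl hCi.le
    linarith
  have hpred := prediction_sub_le hC0 hD hCi.le hg hT0 hl hn1 hng hq0 hY0 hZ0 hD0 hα0 hα h1 h2 h3 h4'
  have hdev := le_of_mul_le_sq (by positivity) hW0 hl0 hS
  rw [← hn] at hCnl
  have hVn : (Ci + 2 * x) * n * l' ≤ Ci * q + 2 * (x * q) := by
    have := mul_le_mul_of_nonneg_left hnl (by positivity : 0 ≤ Ci + 2 * x)
    linarith
  have hxq := mul_le_mul_of_nonneg_left hnl hx.le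
  have hsqL : 1 ≤ √L := Real.one_le_sqrt.mpr hL1
  set R := √((1 + g) * T) with hR
  have hR0 : 0 ≤ R := Real.sqrt_nonneg _
  set s := √(g * T * l)
  have hs0 : 0 ≤ s := Real.sqrt_nonneg _
  have hCs : Ci ≤ √(C * Ci) := Real.le_sqrt_of_sq_le (by nlinarith)
  -- the six terms of the bound
  set t1 := x * R with ht1
  set t2 := Ci * √L * R with ht2
  set t3 := C * g * l with ht3
  set t4 := x * (g * l) with ht4
  set t5 := x * s with ht5
  set t6 := √(C * Ci) * s with ht6
  have p1 : 0 ≤ t1 := by positivity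
  have p2 : 0 ≤ t2 := by positivity
  have p3 : 0 ≤ t3 := by positivity
  have p4 : 0 ≤ t4 := by positivity
  have p5 : 0 ≤ t5 := by positivity
  have p6 : 0 ≤ t6 := by positivity
  have hCis : Ci * s ≤ t6 := by rw [ht6]; gcongr
  have hCiR : Ci * R ≤ t2 := by
    rw [ht2]
    exact mul_le_mul_of_nonneg_right (le_mul_of_one_le_right hCi.le hsqL) hR0
  have hCigl : Ci * (g * l) ≤ t3 := by
    rw [ht3, mul_assoc]
    exact mul_le_mul_of_nonneg_right hC (by positivity)
  have hCiq : Ci * q ≤ 64 * ρ ^ 3 * (t2 + t3) :=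
    calc Ci * q ≤ Ci * (64 * ρ ^ 3 * (R + g * l)) := by gcongr
      _ = 64 * ρ ^ 3 * (Ci * R + Ci * (g * l)) := by ring
      _ ≤ _ := by gcongr
  have hxq' : x * q ≤ 64 * ρ ^ 3 * (t1 + t4) :=
    calc x * q ≤ x * (64 * ρ ^ 3 * (R + g * l)) := by gcongr
      _ = 64 * ρ ^ 3 * (t1 + t4) := by rw [ht1, ht4]; ring
  have hgL : Ci * (g * L) ≤ Ci * q := by
    refine mul_le_mul_of_nonneg_left ?_ hCi.le
    calc g * L ≤ n * L := by gcongr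
      _ ≤ n * (L + l) := by gcongr; linarith
  have hαT' : 4 * (α * (T * Ci)) ≤ t2 := by
    have := mul_le_mul_of_nonneg_left hαT hCi.le
    rw [ht2]
    linarith
  have hρ1 : ρ ≤ ρ ^ 4 := le_self_pow₀ hρ (by norm_num)
  have hρ2 : ρ ^ 2 ≤ ρ ^ 4 := pow_le_pow_right₀ hρ (by norm_num)
  have hρ3 : ρ ^ 3 ≤ ρ ^ 4 := pow_le_pow_right₀ hρ (by norm_num)
  have hρ0 : 1 ≤ ρ ^ 4 := one_le_pow₀ hρ
  have hup : ∀ {a t : ℝ}, a ≤ ρ ^ 4 → 0 ≤ t → a * t ≤ ρ ^ 4 * t :=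
    fun h ht => mul_le_mul_of_nonneg_right h ht
  have a1 : Ci * q ≤ 64 * (ρ ^ 4 * (t2 + t3)) := by
    linarith [hup hρ3 (add_nonneg p2 p3)]
  have a2 : x * q ≤ 64 * (ρ ^ 4 * (t1 + t4)) := by
    linarith [hup hρ3 (add_nonneg p1 p4)]
  have a3 : D₀ ≤ 3 * (ρ ^ 4 * t2) + 192 * (ρ ^ 4 * (t2 + t3)) := by
    have e1 : ρ * (Ci * (g * L)) ≤ ρ * (64 * ρ ^ 3 * (t2 + t3)) :=
      mul_le_mul_of_nonneg_left (hgL.trans hCiq) (by linarith)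
    have e2 : ρ * (64 * ρ ^ 3 * (t2 + t3)) = 64 * (ρ ^ 4 * (t2 + t3)) := by ring
    linarith [hup hρ1 p2]
  have a4 : √(C * D * T * l) ≤ 2 * (ρ ^ 4 * (t6 + t2)) := by
    linarith [hup hρ2 (add_nonneg p6 p2)]
  have a5 : √(g * C * D * T * l) ≤ 2 * (ρ ^ 4 * t6) := by linarith [hup hρ1 p6]
  have a6 : C * n * l ≤ 16 * (ρ ^ 4 * (t3 + t2)) := by linarith [hup hρ2 (add_nonneg p3 p2)]
  have a7 := hup hρ1 p1
  have b1 := hup hρ0 p1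
  have b2 := hup hρ0 p2
  have b5 := hup hρ0 p5
  have b6 := hup hρ0 p6
  have hgoal : 25600 * ρ ^ 4 * ((x + Ci * √L) * R + (C + x) * g * l + (x + √(C * Ci)) * s)
      = 25600 * (ρ ^ 4 * t1 + ρ ^ 4 * t2 + ρ ^ 4 * t3 + ρ ^ 4 * t4 + ρ ^ 4 * t5 + ρ ^ 4 * t6) := by
    rw [ht1, ht2, ht3, ht4, ht5, ht6]; ring
  rw [hgoal]
  have c1 : 0 ≤ ρ ^ 4 * t1 := by positivity
  have c2 : 0 ≤ ρ ^ 4 * t2 := by positivity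
  have c3 : 0 ≤ ρ ^ 4 * t3 := by positivity
  have c4 : 0 ≤ ρ ^ 4 * t4 := by positivity
  have c5 : 0 ≤ ρ ^ 4 * t5 := by positivity
  have c6 : 0 ≤ ρ ^ 4 * t6 := by positivity
  linarith

/-- A value in `[C / (ρ N), C]` is within a constant factor of one of `log N` dyadic fractions of
`C`. -/
theorem exists_dyadic_scale {C Ci : ℝ} {N : ℕ} (hN : 1 ≤ N) (hρ : 1 ≤ ρ) (hCi : 0 < Ci)
    (hC : Ci ≤ C) (hCN : C ≤ ρ * Ci * N) :
    ∃ n ≤ Nat.log 2 N, Ci ≤ C / 2 ^ n ∧ C / 2 ^ n ≤ 2 * ρ * Ci := by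
  have hfl : 1 ≤ ⌊C / Ci⌋₊ := Nat.le_floor (by rw [Nat.cast_one, one_le_div hCi]; exact hC)
  set m := min ⌊C / Ci⌋₊ N with hm
  have hm1 : 1 ≤ m := le_min hfl hN
  refine ⟨Nat.log 2 m, Nat.log_mono_right (min_le_right _ _), ?_, ?_⟩
  · rw [le_div_iff₀ (by positivity), mul_comm, ← le_div_iff₀ hCi]
    have h1 : 2 ^ Nat.log 2 m ≤ ⌊C / Ci⌋₊ :=
      (Nat.pow_log_le_self 2 (by omega)).trans (min_le_left _ _)
    calc (2 : ℝ) ^ Nat.log 2 m ≤ (⌊C / Ci⌋₊ : ℝ) := by exact_mod_cast h1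
      _ ≤ C / Ci := Nat.floor_le (div_nonneg (hCi.le.trans hC) hCi.le)
  · rw [div_le_iff₀ (by positivity)]
    have h1 : m + 1 ≤ 2 ^ (Nat.log 2 m + 1) := Nat.lt_pow_succ_log_self (by norm_num) m
    have h2 : (m : ℝ) + 1 ≤ 2 * 2 ^ Nat.log 2 m := by
      rw [pow_succ, mul_comm] at h1
      exact_mod_cast h1
    rcases min_cases ⌊C / Ci⌋₊ N with ⟨h, -⟩ | ⟨h, -⟩
    · have h3 := Nat.lt_floor_add_one (C / Ci)
      rw [← h, ← hm, div_lt_iff₀ hCi] at h3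
      have h4 : ((m : ℝ) + 1) * Ci ≤ 2 * 2 ^ Nat.log 2 m * Ci := by gcongr
      have h5 : 2 * 2 ^ Nat.log 2 m * Ci ≤ ρ * (2 * 2 ^ Nat.log 2 m * Ci) :=
        le_mul_of_one_le_left (by positivity) hρ
      linarith
    · rw [← h, ← hm] at hCN
      calc C ≤ ρ * Ci * m := hCN
        _ ≤ ρ * Ci * (2 * 2 ^ Nat.log 2 m) := by gcongr; linarith
        _ = _ := by ring

end Combination

/-! ### The regret of one client -/

section Client

variable {K M J T : ℕ} [NeZero J] {P : Problem K M} {C G : Fin K → ℝ}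
  {Ω : Type*} [mΩ : MeasurableSpace Ω] {μ : Measure Ω} [IsProbabilityMeasure μ]
  {A : ℕ → Fin M → Ω → Fin J → Fin K}

/-- Against one hypothesis, the deviation of the importance weights costs the three tail bounds
collected here, each of which fails with probability at most `ε`. -/
theorem exists_hypothesis_event (hv : ValidParams P J T C G) (hA : IsSampling μ P J T C G A)
    (j : Fin M) (hb : ∀ ω, BoundedAlong P J T C G j (draws A j ω)) (i : Fin K) (v : ℕ → ℝ)
    (hvV : ∀ t < T, |v t| ≤ C i + 2 * (P.U i * G i)) {ε l' : ℝ} (hε : 0 < ε)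
    (hl' : l' = Real.log (1 / ε)) (hl0 : 0 < l') :
    ∃ E : Set Ω, μ.real E ≤ 3 * ε ∧ ∀ ω ∉ E,
      ∑ t ∈ Finset.range T, weight P J T C G j (draws A j ω) t i
          * cost P J T C G j (draws A j ω) t i
        ≤ 2 * (T * C i) + 2 * (C i * (max 1 (gKJ K J) * l')) ∧
      G i ^ 2 / 2 * ∑ t ∈ Finset.range T,
          lam K J (P.U i) (G i) (t + 1) * weight P J T C G j (draws A j ω) t i ^ 2
        ≤ P.U i * G i * √((1 + gKJ K J) * T) + P.U i * G i * (max 1 (gKJ K J) * l') ∧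
      1 / ((C i + 2 * (P.U i * G i)) * max 1 (gKJ K J)
          + √((gKJ K J * ∑ t ∈ Finset.range T, v t ^ 2) / l'))
        * ∑ t ∈ Finset.range T, v t * (weight P J T C G j (draws A j ω) t i - 1)
        ≤ (1 / ((C i + 2 * (P.U i * G i)) * max 1 (gKJ K J)
          + √((gKJ K J * ∑ t ∈ Finset.range T, v t ^ 2) / l'))) ^ 2
            * (gKJ K J * ∑ t ∈ Finset.range T, v t ^ 2) + l' := by
  have hg := hv.g_nonneg
  have hC := hv.C_pos i
  have hU := hv.U_pos i
  have hG := hv.G_pos i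
  have hn1 : 1 ≤ max 1 (gKJ K J) := le_max_left _ _
  have hng : gKJ K J ≤ max 1 (gKJ K J) := le_max_right _ _
  have hlam : 0 < lam K J (P.U i) (G i) 1 := hv.lam_pos i 0
  set V := (C i + 2 * (P.U i * G i)) * max 1 (gKJ K J) with hV
  have hV0 : 0 < V := by positivity
  set s := √((gKJ K J * ∑ t ∈ Finset.range T, v t ^ 2) / l')
  have hs0 : 0 ≤ s := Real.sqrt_nonneg _
  -- the largest admissible parameters for the first two bounds, the optimal one for the third
  set γ₁ := 1 / ((1 + gKJ K J) * C i) with hγ₁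
  set γ₂ := 1 / (lam K J (P.U i) (G i) 1 * (1 + gKJ K J) ^ 2) with hγ₂
  set γ₃ := 1 / (V + s) with hγ₃
  have hγ₁0 : 0 < γ₁ := by positivity
  have hγ₂0 : 0 < γ₂ := by positivity
  have hγ₃0 : 0 < γ₃ := by positivity
  have hγ₁' : γ₁ * ((1 + gKJ K J) * C i) = 1 := one_div_mul_cancel (by positivity)
  have hγ₂' : γ₂ * (lam K J (P.U i) (G i) 1 * (1 + gKJ K J) ^ 2) = 1 :=
    one_div_mul_cancel (by positivity)
  have hγ₃' : γ₃ * V ≤ 1 := by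
    rw [hγ₃, one_div_mul_eq_div, div_le_one (by positivity)]
    linarith
  have t1 := tail_weight_mul_cost hv hA j hb i hγ₁0.le hγ₁'.le hε
  have t2 := tail_weight_sq hv hA j i hγ₂0.le hγ₂'.le hε
  have t3 := tail_weight_sub_one hv hA j i v hγ₃0.le hvV hγ₃' hε
  rw [← hl'] at t1 t2 t3
  refine ⟨_, (measureReal_union_le _ _).trans (add_le_add ((measureReal_union_le _ _).trans
    (add_le_add t1 t2)) t3) |>.trans (by linarith), fun ω hω => ?_⟩
  simp only [Set.mem_union, Set.mem_ofPred_eq, not_or, not_not] at hω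
  obtain ⟨⟨e1, e2⟩, e3⟩ := hω
  refine ⟨?_, ?_, ?_⟩
  · have h1 := mul_le_mul_of_nonneg_left e1 (by positivity : 0 ≤ (1 + gKJ K J) * C i)
    rw [← mul_assoc, mul_comm _ γ₁, hγ₁', one_mul] at h1
    have h2 : (1 + gKJ K J) * C i * (2 * (γ₁ * (T * C i)) + l')
        = 2 * (γ₁ * ((1 + gKJ K J) * C i)) * (T * C i) + (1 + gKJ K J) * (C i * l') := by ring
    rw [h2, hγ₁'] at h1
    have h3 : (1 + gKJ K J) * (C i * l') ≤ 2 * max 1 (gKJ K J) * (C i * l') :=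
      mul_le_mul_of_nonneg_right (by linarith) (by positivity)
    linarith
  · set S := ∑ t ∈ Finset.range T,
      lam K J (P.U i) (G i) (t + 1) * weight P J T C G j (draws A j ω) t i ^ 2
    set b := lam K J (P.U i) (G i) 1 * (1 + gKJ K J) ^ 2 with hb'
    have h1 := mul_le_mul_of_nonneg_left e2 (by positivity : 0 ≤ b)
    rw [← mul_assoc, mul_comm _ γ₂, hγ₂', one_mul] at h1
    have h2 : ∀ y : ℝ, b * (2 * (γ₂ * (1 + gKJ K J) * y) + l')
        = 2 * (γ₂ * b) * ((1 + gKJ K J) * y) + b * l' := fun y => by ring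
    rw [h2, hγ₂'] at h1
    have h3 := mul_le_mul_of_nonneg_left h1 (by positivity : 0 ≤ G i ^ 2 / 2)
    have h4 := mul_le_mul_of_nonneg_left (hv.sum_lam_le i) hG.le
    have h5 := mul_le_mul_of_nonneg_left (hv.lam_one_le i) (by positivity : 0 ≤ G i / 2 * l')
    rw [← hb'] at h5
    linarith
  · linarith

/-- The deviations of the predictions, for one value `D` in place of the unknown scale of the best
loss. -/
theorem exists_prediction_event (hv : ValidParams P J T C G) (hA : IsSampling μ P J T C G A)
    (j : Fin M) (hb : ∀ ω, BoundedAlong P J T C G j (draws A j ω)) {Cm : ℝ} (hC0 : 0 < Cm)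
    (hC : ∀ k, C k ≤ Cm) (D : ℝ) {ε l : ℝ} (hε : 0 < ε) (hl : l = Real.log (1 / ε)) :
    ∃ E : Set Ω, μ.real E ≤ 2 * ε ∧ ∀ ω ∉ E,
      1 / (2 * Cm + √(Cm * D * T / l)) * (∑ t ∈ Finset.range T,
          cost P J T C G j (draws A j ω) t (draws A j ω t 0)
          - ∑ t ∈ Finset.range T, meanCost P J T C G j (draws A j ω) t)
        ≤ (1 / (2 * Cm + √(Cm * D * T / l))) ^ 2 * Cm
          * ∑ t ∈ Finset.range T, meanCost P J T C G j (draws A j ω) t + l ∧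
      1 / (2 * Cm * max 1 (gKJ K J) + √(gKJ K J * Cm * D * T / l))
          * (∑ t ∈ Finset.range T, meanCost P J T C G j (draws A j ω) t
          - ∑ t ∈ Finset.range T, meanCostEst P J T C G j (draws A j ω) t)
        ≤ (1 / (2 * Cm * max 1 (gKJ K J) + √(gKJ K J * Cm * D * T / l))) ^ 2 * (gKJ K J * Cm)
          * ∑ t ∈ Finset.range T, meanCost P J T C G j (draws A j ω) t + l := by
  have hn1 : 1 ≤ max 1 (gKJ K J) := le_max_left _ _
  have hs₁ : 0 ≤ √(Cm * D * T / l) := Real.sqrt_nonneg _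
  have hs₂ : 0 ≤ √(gKJ K J * Cm * D * T / l) := Real.sqrt_nonneg _
  have h₁ : 1 / (2 * Cm + √(Cm * D * T / l)) * Cm ≤ 1 := by
    rw [one_div_mul_eq_div, div_le_one (by positivity)]
    linarith
  have h₂ : 1 / (2 * Cm * max 1 (gKJ K J) + √(gKJ K J * Cm * D * T / l)) * Cm ≤ 1 := by
    rw [one_div_mul_eq_div, div_le_one (by positivity)]
    have := le_mul_of_one_le_right hC0.le hn1
    linarith
  have t1 := tail_prediction hv hA j hb hC (by positivity) h₁ hε
  have t2 := tail_meanCostEst hv hA j hb hC (by positivity) h₂ hε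
  rw [← hl] at t1 t2
  refine ⟨_, (measureReal_union_le _ _).trans (add_le_add t1 t2) |>.trans (by linarith),
    fun ω hω => ?_⟩
  simp only [Set.mem_union, Set.mem_ofPred_eq, not_or, not_not] at hω
  exact hω

/-- High probability regret bound for one client against fixed comparators. -/
theorem client_regret_le (hv : ValidParams P J T C G) (hA : IsSampling μ P J T C G A)
    (hsub : IsSubgradient P.loss P.dloss) (j : Fin M)
    (hb : ∀ ω, BoundedAlong P J T C G j (draws A j ω))
    {u : (i : Fin K) → EuclideanSpace ℝ (Fin (P.dim i))} (hu : ∀ i, ‖u i‖ ≤ P.U i)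
    {ρ δ Cm : ℝ} (hρ : 1 ≤ ρ) (hδ : 0 < δ) (hδ1 : δ < 1) (hC : ∀ k, C k ≤ Cm)
    (hgT : gKJ K J ^ 2 ≤ ρ ^ 2 * T) (hCT : ∀ i, K * Cm ^ 2 ≤ ρ ^ 2 * (C i ^ 2 * T))
    (halt : 1 ≤ ρ ^ 2 * gKJ K J ∨
      ∀ i, Cm * Real.log (1 / δ) ≤ ρ ^ 2 * (C i * Real.log (K * T))) :
    ∃ E : Set Ω, μ.real E ≤ 6 * Real.logb 2 (K * T) * δ ∧ ∀ ω ∉ E, ∀ i,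
      ∑ t ∈ Finset.range T, cost P J T C G j (draws A j ω) t (draws A j ω t 0)
          - ∑ t ∈ Finset.range T, hypLoss P j t i (u i)
        ≤ 25600 * ρ ^ 4 *
          ((P.U i * G i + C i * √(Real.log (K * T))) * √((1 + gKJ K J) * T)
            + (Cm + P.U i * G i) * gKJ K J * Real.log (1 / δ)
            + (P.U i * G i + √(Cm * C i)) * √(gKJ K J * T * Real.log (1 / δ))) := by
  have hg := hv.g_nonneg
  have hK := hv.K_pos
  have hT := hv.T_pos
  have hL1 := hv.one_le_log
  have hKN : 0 < K := by have := hv.two_le_K; omega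
  have hTN : 0 < T := by have := hv.le_T; omega
  have hC0 : 0 < Cm := (hv.C_pos ⟨0, hKN⟩).trans_le (hC _)
  have hl : 0 < Real.log (1 / δ) := Real.log_pos (by rw [lt_div_iff₀ hδ]; linarith)
  obtain ⟨τ, hτ, hTτ, hLτ⟩ := hv.exists_eighth_root
  have hl'eq : Real.log (1 / (δ / K)) = Real.log K + Real.log (1 / δ) := by
    rw [one_div_div, ← mul_one_div, Real.log_mul hK.ne' (by positivity)]
  have hlogK : 0 ≤ Real.log K := Real.log_nonneg (by exact_mod_cast hKN)
  have hlogKT : Real.log K ≤ Real.log (K * T) := by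
    refine Real.log_le_log hK (le_mul_of_one_le_right hK.le ?_)
    exact_mod_cast hTN
  choose v hvabs hvsq hvreg using fun i => exists_comparator hv hA hsub j hb i (hu i) hρ hτ hTτ hgT
  -- confidence `δ / K` for each hypothesis, `δ` for each dyadic scale of the predictions
  choose E₁ hE₁ hE₁' using fun i => exists_hypothesis_event hv hA j hb i (v i) (hvabs i)
    (div_pos hδ hK) rfl (by rw [hl'eq]; linarith)
  choose E₂ hE₂ hE₂' using fun n : ℕ =>
    exists_prediction_event hv hA j hb hC0 hC (Cm / 2 ^ n) hδ rfl
  refine ⟨(⋃ i ∈ Finset.univ, E₁ i) ∪ ⋃ n ∈ Finset.range (Nat.log 2 (K * T) + 1), E₂ n, ?_, ?_⟩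
  · have h1 : μ.real (⋃ i ∈ Finset.univ, E₁ i) ≤ 3 * δ := by
      refine (measureReal_biUnion_finset_le _ _).trans
        ((Finset.sum_le_sum fun i _ => hE₁ i).trans (le_of_eq ?_))
      rw [Finset.sum_const, Finset.card_univ, Fintype.card_fin, nsmul_eq_mul]
      field_simp
    have h2 : μ.real (⋃ n ∈ Finset.range (Nat.log 2 (K * T) + 1), E₂ n)
        ≤ (Real.logb 2 (K * T) + 1) * (2 * δ) := by
      refine (measureReal_biUnion_finset_le _ _).trans
        ((Finset.sum_le_sum fun n _ => hE₂ n).trans ?_)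
      rw [Finset.sum_const, Finset.card_range, nsmul_eq_mul]
      refine mul_le_mul_of_nonneg_right ?_ (by linarith)
      have := Real.natLog_le_logb (K * T) 2
      push_cast at this ⊢
      linarith
    have h3 : 2 ≤ Real.logb 2 (K * T) := by
      rw [Real.le_logb_iff_rpow_le (by norm_num) (by positivity)]
      norm_num
      exact hv.four_le
    have h4 := mul_le_mul_of_nonneg_right h3 hδ.le
    have h5 := measureReal_union_le (μ := μ) (⋃ i ∈ Finset.univ, E₁ i)
      (⋃ n ∈ Finset.range (Nat.log 2 (K * T) + 1), E₂ n)
    linarith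
  · intro ω hω i
    simp only [Set.mem_union, Set.mem_iUnion, Finset.mem_univ, Finset.mem_range, exists_prop,
      true_and, not_or, not_exists, not_and] at hω
    have hCi := hv.C_pos i
    have hρ0 : 0 < ρ := by linarith
    have hscale : Cm ≤ ρ * C i * ((K * T : ℕ) : ℝ) := by
      have hK1 : (1 : ℝ) ≤ K := by exact_mod_cast hKN
      have hT1 : (1 : ℝ) ≤ T := by exact_mod_cast hTN
      refine le_of_sq_le_sq ?_ (by positivity)
      calc Cm ^ 2 ≤ K * Cm ^ 2 := le_mul_of_one_le_left (sq_nonneg _) hK1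
        _ ≤ ρ ^ 2 * (C i ^ 2 * T) := hCT i
        _ = ρ ^ 2 * C i ^ 2 * (1 * T) := by ring
        _ ≤ ρ ^ 2 * C i ^ 2 * (K ^ 2 * T ^ 2) := by
          gcongr
          · exact one_le_pow₀ hK1
          · exact le_self_pow₀ hT1 (by norm_num)
        _ = _ := by push_cast; ring
    obtain ⟨n, hn, hD, hD2⟩ := exists_dyadic_scale (Nat.mul_pos hKN hTN) hρ hCi (hC i) hscale
    obtain ⟨h4, hQ, hS⟩ := hE₁' i ω (hω.1 i)
    obtain ⟨h1, h2⟩ := hE₂' n ω (hω.2 n (by omega))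
    have hmean : ∀ t ∈ Finset.range T, 0 ≤ meanCost P J T C G j (draws A j ω) t := fun t ht =>
      (meanCost_mem hv j (hb ω) hC (Finset.mem_range.mp ht)).1
    have hest : ∀ t ∈ Finset.range T, 0 ≤ meanCostEst P J T C G j (draws A j ω) t := fun t ht =>
      Finset.sum_nonneg fun k _ => mul_nonneg ((hv.state_p_mem j _ t).2.1 k)
        (mul_nonneg (hv.weight_nonneg _ _ _ _) (hb ω t (Finset.mem_range.mp ht) k).1)
    have hη := hv.eta_pos
    have hUG : 0 < P.U i * G i := mul_pos (hv.U_pos i) (hv.G_pos i)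
    have hU := hv.U_pos i
    refine regret_le_of_deviations (hC i) hCi hUG hD hD2 hg hgT hTτ hτ hρ hL1 hLτ hl
      (by rw [hl'eq]; linarith) (by rw [hl'eq]; linarith) (halt.imp_right fun h => h i)
      (Finset.sum_nonneg hmean) (Finset.sum_nonneg hest)
      (vertexDiv_nonneg hv.C_pos hη i fun k => hv.initDist_pos k) (by positivity)
      hv.eta_mul_le_half h1 h2 (hv.sum_meanCostEst_le j (hb ω) i) h4
      (hv.vertexDiv_initDist_le hρ hC i (hCT i)) hv.eta_mul_T_le ?_ hQ
      (mul_nonneg hg (Finset.sum_nonneg fun _ _ => sq_nonneg _)) (hvsq i) hS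
    have e1 := hvreg i ω
    have e2 : 2 * P.U i ^ 2 / lam K J (P.U i) (G i) (T + 1)
        ≤ 8 * (ρ * (P.U i * G i * √((1 + gKJ K J) * T))) := by
      have := mul_le_mul_of_nonneg_left (hv.U_div_lam_le hρ hgT i) (by positivity : 0 ≤ 2 * P.U i)
      calc _ = 2 * P.U i * (P.U i / lam K J (P.U i) (G i) (T + 1)) := by ring
        _ ≤ _ := this
        _ = _ := by ring
    simp only [mul_sub, mul_one, Finset.sum_sub_distrib] at e1 ⊢
    have e3 : ∑ t ∈ Finset.range T, weight P J T C G j (draws A j ω) t i * v i t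
        = ∑ t ∈ Finset.range T, v i t * weight P J T C G j (draws A j ω) t i :=
      Finset.sum_congr rfl fun t _ => mul_comm _ _
    rw [e3] at e1
    linarith

end Client

/-! ### The regret of all clients -/

section Network

variable {K M J T : ℕ} {P : Problem K M}

theorem continuous_hypLoss (hconv : ∀ y, ConvexOn ℝ Set.univ fun v => P.loss v y) (j : Fin M)
    (t : ℕ) (i : Fin K) : Continuous (hypLoss P j t i) := by
  have h : Continuous fun v => P.loss v (P.y j t) :=
    continuousOn_univ.mp ((hconv _).continuousOn isOpen_univ)
  exact h.comp (continuous_id.inner continuous_const)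

theorem exists_best_hypothesis (hconv : ∀ y, ConvexOn ℝ Set.univ fun v => P.loss v y) (i : Fin K)
    (hU : 0 ≤ P.U i) :
    ∃ u : EuclideanSpace ℝ (Fin (P.dim i)), ‖u‖ ≤ P.U i ∧
      sInf ((fun w => ∑ t ∈ Finset.range T, ∑ j, hypLoss P j t i w) ''
        Metric.closedBall 0 (P.U i)) = ∑ t ∈ Finset.range T, ∑ j, hypLoss P j t i u := by
  have hne : (Metric.closedBall (0 : EuclideanSpace ℝ (Fin (P.dim i))) (P.U i)).Nonempty :=
    ⟨0, Metric.mem_closedBall_self hU⟩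
  have hc : Continuous fun w => ∑ t ∈ Finset.range T, ∑ j, hypLoss P j t i w :=
    continuous_finsetSum _ fun t _ => continuous_finsetSum _ fun j _ =>
      continuous_hypLoss hconv j t i
  obtain ⟨u, hu, hmin⟩ := (isCompact_closedBall _ _).exists_sInf_image_eq hne hc.continuousOn
  exact ⟨u, by simpa using hu, hmin⟩

end Network

end NCOOMS

theorem mainTheorem8 :
    ∃ c₁ : ℝ, 0 < c₁ ∧ ∀ κ : ℝ, 0 < κ → ∃ c₂ : ℝ, 0 < c₂ ∧
      ∀ (K M J T : ℕ) [NeZero J] (P : NCOOMS.Problem K M) (C G : Fin K → ℝ) (δ : ℝ)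
        (Ω : Type*) [MeasurableSpace Ω] (μ : MeasureTheory.Measure Ω)
        [MeasureTheory.IsProbabilityMeasure μ] (A : ℕ → Fin M → Ω → Fin J → Fin K),
        2 ≤ J → J ≤ K → K ≤ T → 0 < δ → δ < 1 →
        (∀ i, 0 < P.U i) → (∀ i, 0 < C i) → (∀ i, 0 < G i) →
        (∀ y, ConvexOn ℝ Set.univ (fun v => P.loss v y)) →
        NCOOMS.IsSubgradient P.loss P.dloss →
        -- the draws are those of NCO-OMS run with the parameters above
        NCOOMS.IsSampling μ P J T C G A →
        -- `C i` bounds the losses and `G i` the gradients that occur during the run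
        (∀ ω, ∀ t < T, ∀ j i,
          0 ≤ NCOOMS.hypLoss P j t i ((NCOOMS.run P J T C G A j t ω).w i) ∧
          NCOOMS.hypLoss P j t i ((NCOOMS.run P J T C G A j t ω).w i) ≤ C i ∧
          ‖NCOOMS.hypGrad P j t i ((NCOOMS.run P J T C G A j t ω).w i)‖ ≤ G i) →
        -- the regime in which the terms hidden by the O-notation are of lower order
        κ * NCOOMS.gKJ K J ^ 2 ≤ T →
        (∀ i, κ * K * (⨆ k, C k) ^ 2 ≤ C i ^ 2 * T) →
        (κ ≤ NCOOMS.gKJ K J ∨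
          ∀ i, κ * (⨆ k, C k) * Real.log (1 / δ) ≤ C i * Real.log (K * T)) →
        1 - c₁ * (M * Real.logb 2 (K * T)) * δ ≤
          μ.real {ω | ∀ i, NCOOMS.regret P J T C G A i ω ≤
            c₂ * (M *
              ((P.U i * G i + C i * √(Real.log (K * T))) * √((1 + NCOOMS.gKJ K J) * T)
              + ((⨆ k, C k) + P.U i * G i) * NCOOMS.gKJ K J * Real.log (1 / δ)
              + (P.U i * G i + √((⨆ k, C k) * C i))
                  * √(NCOOMS.gKJ K J * T * Real.log (1 / δ))))} := by
  refine ⟨6, by norm_num, fun κ hκ => ?_⟩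
  -- `ρ ≥ 1` with `κ ρ² ≥ 1`
  obtain ⟨ρ, hρ, hκρ⟩ : ∃ ρ : ℝ, 1 ≤ ρ ∧ 1 ≤ ρ ^ 2 * κ := by
    refine ⟨1 + 1 / κ, by linarith [one_div_pos.mpr hκ], ?_⟩
    have h : (1 + 1 / κ) ^ 2 * κ = κ + 2 + 1 / κ := by field_simp; ring
    linarith [one_div_pos.mpr hκ]
  refine ⟨25600 * ρ ^ 4, by positivity, ?_⟩
  intro K M J T _ P C G δ Ω _ μ _ A hJ hJK hKT hδ hδ1 hU hC hG hconv hsub hA hbound hgT hCT halt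
  have hv : NCOOMS.ValidParams P J T C G := ⟨hJ, hJK, hKT, hU, hC, hG⟩
  have hscale : ∀ {a b : ℝ}, 0 ≤ a → κ * a ≤ b → a ≤ ρ ^ 2 * b := fun {a b} ha h =>
    calc a ≤ ρ ^ 2 * κ * a := le_mul_of_one_le_left ha hκρ
      _ = ρ ^ 2 * (κ * a) := by ring
      _ ≤ ρ ^ 2 * b := by gcongr
  have hCm : ∀ k, C k ≤ ⨆ k, C k := fun k => le_ciSup (Set.finite_range C).bddAbove k
  have hCm0 : 0 ≤ ⨆ k, C k := Real.iSup_nonneg fun k => (hC k).le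
  have hl : 0 ≤ Real.log (1 / δ) := Real.log_nonneg (by rw [le_div_iff₀ hδ]; linarith)
  choose u hu hmin using fun i => NCOOMS.exists_best_hypothesis (T := T) hconv i (hU i).le
  choose E hE hE' using fun j => NCOOMS.client_regret_le hv hA hsub j
    (fun ω t ht i => hbound ω t ht j i) hu hρ hδ hδ1 hCm (hscale (sq_nonneg _) hgT)
    (fun i => hscale (by positivity) (by linarith [hCT i]))
    (halt.imp (fun h => hκρ.trans (by gcongr)) fun h i =>
      hscale (mul_nonneg hCm0 hl) (by linarith [h i]))
  have hbad : μ.real (⋃ j ∈ Finset.univ, E j) ≤ 6 * (M * Real.logb 2 (K * T)) * δ := by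
    refine (measureReal_biUnion_finset_le _ _).trans
      ((Finset.sum_le_sum fun j _ => hE j).trans (le_of_eq ?_))
    rw [Finset.sum_const, Finset.card_univ, Fintype.card_fin, nsmul_eq_mul]
    ring
  refine le_trans ?_ (measureReal_mono (s₁ := (⋃ j ∈ Finset.univ, E j)ᶜ) fun ω hω i => ?_)
  -- subadditivity suffices: the event of the theorem need not be measurable
  · have h := measureReal_union_le (μ := μ) (⋃ j ∈ Finset.univ, E j) (⋃ j ∈ Finset.univ, E j)ᶜ
    rw [Set.union_compl_self, probReal_univ] at h
    linarith
  · simp only [Set.mem_compl_iff, Set.mem_iUnion, Finset.mem_univ, exists_prop, true_and,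
      not_exists] at hω
    rw [NCOOMS.regret, hmin i, Finset.sum_comm, Finset.sum_comm (s := Finset.range T),
      ← Finset.sum_sub_distrib]
    refine (Finset.sum_le_sum fun j _ => hE' j ω (hω j) i).trans (le_of_eq ?_)
    rw [Finset.sum_const, Finset.card_univ, Fintype.card_fin, nsmul_eq_mul]
    ring
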